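/- For every real number $s>2$ there is a constant $C=C(s)$ such that the following holds for every sufficiently large real number $d$ (that is, for every $d\ge d_0$, where $d_0$ depends only on $s$). Let $G$ be a finite simple graph on $n$ vertices with average degree at least $d$, where $d\le n^{\frac{s-2}{s}}$. Then there is a non-empty set $R\subseteq V(G)$ of size $$|R|\le n\,d^{-\frac{s}{s-2}}(\log d)^{C}$$ such that the induced subgraph $G[R]$ has average degree at least $s$. Here the average degree of a graph $H$ on a non-empty finite vertex set is $\frac{1}{|V(H)|}\sum_{v\in V(H)}\deg_H(v)=\frac{2|E(H)|}{|V(H)|}$. -/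

import Mathlib

open Classical in
/-- The average degree `(∑ v, deg v) / |V|` of a finite graph. (It is `0` for the graph without
vertices.) -/
noncomputable def SimpleGraph.averageDegree {V : Type*} [Fintype V] (G : SimpleGraph V) : ℝ :=
  (∑ v : V, (G.degree v : ℝ)) / (Fintype.card V : ℝ)

/-! ### Block states and the merging step -/

namespace SmallDense

set_option linter.unusedSectionVars false

open Finset

variable {P V : Type*} [Fintype P] [DecidableEq P] [Fintype V] [DecidableEq V]

/-! Put θ = s / (s - 2) and x = n d^(-θ); the hypothesis on d says that x ≥ 1.

Regular case (`exists_dense_of_nearly_regular`). Suppose that all degrees are about δ and n ≥ δ^θ.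
Take a caterpillar with k inner path vertices and leaves attached evenly at rate α, where 2(α + 1)k
= s(k + 1), and let p be its number of vertices. Even spacing makes every set Z of inner vertices
touch at least (α + 1)|Z| edges (`caterpillar_balanced`). If kpm copies of the tree are disjoint on
a non-empty Z and send all other positions into a common set of at most pm vertices, then their
union has at least (α + 1)kpm|Z| edges on at most pm + kpm|Z| vertices, hence average degree at
least 2(α + 1)k / (k + 1) = s. So it suffices to find such copies with m about n δ^(-θ) times a
power of log δ (`exists_dense_of_caterpillars`).

Finding the copies. Sample m random vertices for each root (path end or leaf). Many trees have all
their roots sampled, and a second moment argument would extract many trees disjoint on the inner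
positions, unless trees cluster: typical members of the family agree with too many others on some
union J of free positions and blocks in Q. In that case the union becomes a single block, sampled
from the clustered family itself (`BlockState.exists_merge`). Each merge costs only powers of y and
lowers a potential, so the process ends in a stable state (`exists_stable`). A stable state still
has a free position: two blocks joined by a tree edge would be sampled independently, and such pairs
rarely land on edges of a sparse graph (`BlockState.Stable.eq_of_adjacent`), so without free
positions only one block would be left, which is impossible when the family has large weight
(`BlockState.Stable.free_nonempty`). The weighted second moment then works
(`BlockState.Stable.exists_disjoint`), with Z the set of free positions.

Parameters. The total loss is (log δ)^O(p), which is harmless as long as k is at most a small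
multiple of log δ / log log δ. Rounding loses a factor δ^O(1) in the number of trees, and about k
factors (log δ)^C, one per sampled leaf, repay it; so k of exactly this order makes C a constant.

Reduction. Among the sets of average degree at least s, choose S maximizing degSum / |S|^(1 + 1/θ).
Its average degree d₀ satisfies |S| d₀^(-θ) ≤ x. If d₀ is bounded, S itself is small enough.
Otherwise extremality prevents vertices of very large degree from carrying most edges
(`exists_bounded_part`), and truncating degrees gives a nearly regular piece of any prescribed
smaller degree (`exists_nearly_regular`), to which the regular case applies
(`exists_dense_of_extremal`). -/

/-- The members of a family of maps that agree with `T` on `I`. -/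
def agreeing (F : Finset (P → V)) (I : Finset P) (T : P → V) : Finset (P → V) :=
  F.filter fun A => ∀ i ∈ I, A i = T i

/-- The proportion of the members of a family that agree with `T` on `I`. -/
noncomputable def agreeDensity (F : Finset (P → V)) (I : Finset P) (T : P → V) : ℝ :=
  ((agreeing F I T).card : ℝ) / F.card

/-- The positions outside all blocks. -/
def freePositions (blocks : Finset (Finset P)) : Finset P :=
  univ.filter fun v => ∀ B ∈ blocks, v ∉ B

/-- A family of maps together with disjoint blocks of positions, each with a sampling family. -/
structure BlockState (F₀ : Finset (P → V)) (roots : Finset P) (m : ℕ) (y Λ M : ℝ) where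
  blocks : Finset (Finset P)
  sample : Finset P → Finset (P → V)
  fam : Finset (P → V)
  block_nonempty : ∀ B ∈ blocks, B.Nonempty
  disjoint : ∀ B ∈ blocks, ∀ B' ∈ blocks, B ≠ B' → Disjoint B B'
  roots_covered : ∀ u ∈ roots, ∃ B ∈ blocks, u ∈ B
  fam_subset : fam ⊆ F₀
  fam_nonempty : fam.Nonempty
  -- The exponent on the left is the potential, which is at most `3 * Fintype.card P` at the start:
  -- each unit of potential spent allows the family to shrink by a factor `y`. This keeps every
  -- sample drawn from a later family spread out.
  fam_large : y ^ (2 * blocks.card + 3 * (freePositions blocks).card) * (F₀.card : ℝ) ≤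
    y ^ (3 * Fintype.card P) * fam.card
  sample_large : ∀ B ∈ blocks, fam.card ≤ (sample B).card
  sample_spread : ∀ B ∈ blocks, ∀ a ∈ B, ∀ v : V,
    (((sample B).filter fun A => A a = v).card : ℝ) * Fintype.card V ≤ Λ * (sample B).card
  -- With `m` independent samples per block, the product is the expected number of ways in which `T`
  -- occurs. Up to `y ^ 2` per unit of potential spent, its product with the size of the family
  -- stays at least `m * M`.
  weight : ∀ T ∈ fam,
    (m : ℝ) * M * y ^ (2 * (2 * blocks.card + 3 * (freePositions blocks).card)) ≤
      y ^ (6 * Fintype.card P) * (fam.card * ∏ B ∈ blocks, ((m : ℝ) * agreeDensity (sample B) B T))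

/-- The quantity that decreases when blocks are merged. -/
def BlockState.potential {F₀ : Finset (P → V)} {roots : Finset P} {m : ℕ} {y Λ M : ℝ}
    (S : BlockState F₀ roots m y Λ M) : ℕ :=
  2 * S.blocks.card + 3 * (freePositions S.blocks).card

lemma mem_agreeing {F : Finset (P → V)} {I : Finset P} {T A : P → V} :
    A ∈ agreeing F I T ↔ A ∈ F ∧ ∀ i ∈ I, A i = T i := by
  simp [agreeing]

lemma mem_freePositions {blocks : Finset (Finset P)} {v : P} :
    v ∈ freePositions blocks ↔ ∀ B ∈ blocks, v ∉ B := by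
  simp [freePositions]

lemma agreeDensity_nonneg (F : Finset (P → V)) (I : Finset P) (T : P → V) :
    0 ≤ agreeDensity F I T := by
  unfold agreeDensity; positivity

lemma agreeDensity_congr {F : Finset (P → V)} {I : Finset P} {T T' : P → V}
    (h : ∀ i ∈ I, T i = T' i) : agreeDensity F I T = agreeDensity F I T' := by
  have : agreeing F I T = agreeing F I T' := by
    ext A
    simp only [mem_agreeing]
    refine and_congr_right fun _ => ?_
    exact forall₂_congr fun i hi => by rw [h i hi]
  unfold agreeDensity
  rw [this]

section merge

variable {F₀ : Finset (P → V)} {roots : Finset P} {m : ℕ} {y Λ M : ℝ}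

/-- The members of the family that agree with unusually many others on `J` and the blocks in `Q`. -/
noncomputable def BlockState.bad (S : BlockState F₀ roots m y Λ M)
    (J : Finset P) (Q : Finset (Finset P)) : Finset (P → V) :=
  S.fam.filter fun T => ∏ B ∈ Q, ((m : ℝ) * agreeDensity (S.sample B) B T) <
    m * y ^ (Q.card + J.card) * agreeDensity S.fam (J ∪ Q.biUnion id) T

/-- The blocks after merging `J` and the blocks in `Q`. -/
def BlockState.mergedBlocks (S : BlockState F₀ roots m y Λ M)
    (J : Finset P) (Q : Finset (Finset P)) : Finset (Finset P) :=
  insert (J ∪ Q.biUnion id) (S.blocks \ Q)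

lemma BlockState.merge_notMem (S : BlockState F₀ roots m y Λ M) {J : Finset P}
    {Q : Finset (Finset P)} (hJ : J ⊆ freePositions S.blocks) (hQ : Q ⊆ S.blocks) {B : Finset P}
    (hB : B ∈ S.blocks \ Q) : Disjoint (J ∪ Q.biUnion id) B := by
  rw [Finset.mem_sdiff] at hB
  rw [Finset.disjoint_left]
  intro a ha haB
  simp only [Finset.mem_union, Finset.mem_biUnion, id] at ha
  rcases ha with ha | ⟨B', hB', ha⟩
  · exact mem_freePositions.1 (hJ ha) B hB.1 haB
  · exact Finset.disjoint_left.1 (S.disjoint B' (hQ hB') B hB.1 (by rintro rfl; exact hB.2 hB'))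
      ha haB

lemma BlockState.free_merged (S : BlockState F₀ roots m y Λ M) {J : Finset P}
    {Q : Finset (Finset P)} (hQ : Q ⊆ S.blocks) :
    freePositions (S.mergedBlocks J Q) = freePositions S.blocks \ J := by
  ext v
  simp only [mem_freePositions, BlockState.mergedBlocks, Finset.mem_insert, Finset.mem_sdiff,
    forall_eq_or_imp, Finset.mem_union, Finset.mem_biUnion, id, not_or, not_exists, not_and]
  constructor
  · rintro ⟨⟨h1, h2⟩, h3⟩
    refine ⟨fun B hB => ?_, h1⟩
    by_cases hBQ : B ∈ Q
    · exact h2 B hBQ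
    · exact h3 B ⟨hB, hBQ⟩
  · rintro ⟨h1, h2⟩
    exact ⟨⟨h2, fun B hB => h1 B (hQ hB)⟩, fun B hB => h1 B hB.1⟩

/-- The weights 2 for a block and 3 for a free position make a merge save at least `2|Q| + 3|J| -
2`. This is at least `|Q| + |J|`, the exponent of `y` lost in the merge, precisely because `|Q| +
2|J| ≥ 2`. -/
lemma BlockState.potential_merged (S : BlockState F₀ roots m y Λ M) {J : Finset P}
    {Q : Finset (Finset P)} (hJ : J ⊆ freePositions S.blocks) (hQ : Q ⊆ S.blocks)
    (hne : 2 ≤ Q.card + 2 * J.card) :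
    2 * (S.mergedBlocks J Q).card + 3 * (freePositions (S.mergedBlocks J Q)).card +
      (Q.card + J.card) ≤ S.potential := by
  have h1 : (S.mergedBlocks J Q).card ≤ S.blocks.card - Q.card + 1 := by
    unfold BlockState.mergedBlocks
    refine (Finset.card_insert_le _ _).trans ?_
    rw [Finset.card_sdiff_of_subset hQ]
  rw [S.free_merged hQ, Finset.card_sdiff_of_subset hJ]
  have h2 := Finset.card_le_card hJ
  have h3 := Finset.card_le_card hQ
  unfold BlockState.potential
  omega

/-- If the bad members were frequent, the blocks could be merged. -/
lemma BlockState.exists_merge (S : BlockState F₀ roots m y Λ M) {Λ₀ : ℝ} (hy : 1 ≤ y)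
    (hm : 0 < m) (hM : 0 < M) (hF₀ : ∀ a : P, ∀ v : V,
      ((F₀.filter fun A => A a = v).card : ℝ) * Fintype.card V ≤ Λ₀ * F₀.card)
    (hΛ₀ : 0 ≤ Λ₀) (hΛ : Λ₀ * y ^ (3 * Fintype.card P) ≤ Λ) {J : Finset P}
    {Q : Finset (Finset P)} (hJ : J ⊆ freePositions S.blocks) (hQ : Q ⊆ S.blocks)
    (hne : 2 ≤ Q.card + 2 * J.card)
    (hbad : (S.fam.card : ℝ) ≤ y ^ (Q.card + J.card) * (S.bad J Q).card) :
    ∃ S' : BlockState F₀ roots m y Λ M, S'.potential < S.potential := by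
  have hpot := S.potential_merged hJ hQ hne
  set B₀ := J ∪ Q.biUnion id with hB₀
  have hy0 : 0 < y := by linarith
  have hfam : 0 < (S.fam.card : ℝ) := by exact_mod_cast S.fam_nonempty.card_pos
  have hbadpos : 0 < ((S.bad J Q).card : ℝ) := by
    by_contra h
    have : ((S.bad J Q).card : ℝ) = 0 := le_antisymm (not_lt.1 h) (by positivity)
    rw [this, mul_zero] at hbad
    linarith
  have hsub : S.bad J Q ⊆ S.fam := Finset.filter_subset _ _
  have hlarge : y ^ (2 * (S.mergedBlocks J Q).card + 3 * (freePositions (S.mergedBlocks J Q)).card)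
      * (F₀.card : ℝ) ≤ y ^ (3 * Fintype.card P) * (S.bad J Q).card := by
    have h1 := S.fam_large
    have h2 : y ^ (2 * (S.mergedBlocks J Q).card + 3 * (freePositions (S.mergedBlocks J Q)).card)
        * y ^ (Q.card + J.card) ≤ y ^ S.potential := by
      rw [← pow_add]; exact pow_le_pow_right₀ hy hpot
    have h3 : 0 < y ^ (Q.card + J.card) := by positivity
    refine le_of_mul_le_mul_right ?_ h3
    calc _ = (y ^ (2 * (S.mergedBlocks J Q).card +
            3 * (freePositions (S.mergedBlocks J Q)).card) * y ^ (Q.card + J.card)) * F₀.card := by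
          ring
      _ ≤ y ^ S.potential * F₀.card := by gcongr
      _ ≤ y ^ (3 * Fintype.card P) * S.fam.card := h1
      _ ≤ y ^ (3 * Fintype.card P) * (y ^ (Q.card + J.card) * (S.bad J Q).card) := by gcongr
      _ = _ := by ring
  have hB₀not : B₀ ∉ S.blocks \ Q ∨ B₀ = ∅ := by
    by_cases h : B₀ ∈ S.blocks \ Q
    · right
      exact Finset.disjoint_self_iff_empty _ |>.1 (S.merge_notMem hJ hQ h)
    · exact Or.inl h
  have hB₀ne : B₀.Nonempty := by
    rcases Finset.eq_empty_or_nonempty J with hJe | ⟨j, hj⟩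
    · have : 0 < Q.card := by rw [hJe] at hne; simp at hne; omega
      obtain ⟨B, hB⟩ := Finset.card_pos.1 this
      obtain ⟨b, hb⟩ := S.block_nonempty B (hQ hB)
      exact ⟨b, Finset.mem_union_right _ (Finset.mem_biUnion.2 ⟨B, hB, hb⟩)⟩
    · exact ⟨j, Finset.mem_union_left _ hj⟩
  have hB₀nm : B₀ ∉ S.blocks \ Q := by
    rcases hB₀not with h | h
    · exact h
    · exact absurd h hB₀ne.ne_empty
  have hne' : ∀ B ∈ S.blocks \ Q, B ≠ B₀ := fun B hB h => hB₀nm (h ▸ hB)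
  refine ⟨{ blocks := S.mergedBlocks J Q
            sample := Function.update S.sample B₀ (S.bad J Q)
            fam := S.bad J Q
            block_nonempty := ?_
            disjoint := ?_
            roots_covered := ?_
            fam_subset := hsub.trans S.fam_subset
            fam_nonempty := Finset.card_pos.1 (by exact_mod_cast hbadpos)
            fam_large := hlarge
            sample_large := ?_
            sample_spread := ?_
            weight := ?_ }, ?_⟩
  · intro B hB
    rcases Finset.mem_insert.1 hB with rfl | hB
    · exact hB₀ne
    · exact S.block_nonempty B (Finset.mem_sdiff.1 hB).1
  · intro B hB B' hB' hBB'
    rcases Finset.mem_insert.1 hB with rfl | hB <;> rcases Finset.mem_insert.1 hB' with rfl | hB'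
    · exact absurd rfl hBB'
    · exact S.merge_notMem hJ hQ hB'
    · exact (S.merge_notMem hJ hQ hB).symm
    · exact S.disjoint B (Finset.mem_sdiff.1 hB).1 B' (Finset.mem_sdiff.1 hB').1 hBB'
  · intro u hu
    obtain ⟨B, hB, huB⟩ := S.roots_covered u hu
    by_cases hBQ : B ∈ Q
    · exact ⟨B₀, Finset.mem_insert_self _ _,
        Finset.mem_union_right _ (Finset.mem_biUnion.2 ⟨B, hBQ, huB⟩)⟩
    · exact ⟨B, Finset.mem_insert_of_mem (Finset.mem_sdiff.2 ⟨hB, hBQ⟩), huB⟩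
  · intro B hB
    rcases Finset.mem_insert.1 hB with rfl | hB
    · rw [← hB₀, Function.update_self]
    · rw [Function.update_of_ne (hne' B hB)]
      exact (Finset.card_le_card hsub).trans (S.sample_large B (Finset.mem_sdiff.1 hB).1)
  · intro B hB a ha v
    rcases Finset.mem_insert.1 hB with rfl | hB
    · rw [← hB₀, Function.update_self]
      have h1 : (((S.bad J Q).filter fun A => A a = v).card : ℝ) ≤
          ((F₀.filter fun A => A a = v).card : ℝ) := by
        exact_mod_cast Finset.card_le_card
          (Finset.filter_subset_filter _ (hsub.trans S.fam_subset))
      calc _ ≤ ((F₀.filter fun A => A a = v).card : ℝ) * Fintype.card V := by gcongr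
        _ ≤ Λ₀ * F₀.card := hF₀ a v
        _ ≤ Λ₀ * (y ^ (2 * (S.mergedBlocks J Q).card +
              3 * (freePositions (S.mergedBlocks J Q)).card) * (F₀.card : ℝ)) := by
            gcongr
            exact le_mul_of_one_le_left (by positivity) (one_le_pow₀ hy)
        _ ≤ Λ₀ * (y ^ (3 * Fintype.card P) * (S.bad J Q).card) := by gcongr
        _ = Λ₀ * y ^ (3 * Fintype.card P) * (S.bad J Q).card := by ring
        _ ≤ _ := by gcongr
    · rw [Function.update_of_ne (hne' B hB)]
      exact S.sample_spread B (Finset.mem_sdiff.1 hB).1 a ha v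
  · intro T hT
    have hTbad := (Finset.mem_filter.1 hT).2
    have hTfam := hsub hT
    have hprod : ∏ B ∈ S.mergedBlocks J Q,
        ((m : ℝ) * agreeDensity (Function.update S.sample B₀ (S.bad J Q) B) B T) =
        (m * agreeDensity (S.bad J Q) B₀ T) *
          ∏ B ∈ S.blocks \ Q, ((m : ℝ) * agreeDensity (S.sample B) B T) := by
      unfold BlockState.mergedBlocks
      rw [Finset.prod_insert hB₀nm]
      congr 1
      · rw [Function.update_self]
      · refine Finset.prod_congr rfl fun B hB => ?_
        rw [Function.update_of_ne (hne' B hB)]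
    -- Whether a member is bad depends only on its values on `B₀`, so an agreement class on `B₀`
    -- lies entirely inside or outside the bad set. Hence the class keeps its size when the family
    -- shrinks.
    have hagree : agreeing (S.bad J Q) B₀ T = agreeing S.fam B₀ T := by
      ext A
      simp only [mem_agreeing]
      constructor
      · rintro ⟨h1, h2⟩; exact ⟨hsub h1, h2⟩
      · rintro ⟨h1, h2⟩
        refine ⟨Finset.mem_filter.2 ⟨h1, ?_⟩, h2⟩
        rw [agreeDensity_congr h2]
        rw [show ∏ B ∈ Q, ((m : ℝ) * agreeDensity (S.sample B) B A) =
          ∏ B ∈ Q, ((m : ℝ) * agreeDensity (S.sample B) B T) from ?_]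
        · exact hTbad
        · refine Finset.prod_congr rfl fun B hB => ?_
          rw [agreeDensity_congr (I := B) fun i hi => h2 i
            (Finset.mem_union_right _ (Finset.mem_biUnion.2 ⟨B, hB, hi⟩))]
    rw [hprod]
    have hw := S.weight T hTfam
    set R₁ := ∏ B ∈ S.blocks \ Q, ((m : ℝ) * agreeDensity (S.sample B) B T) with hR₁
    set R₂ := ∏ B ∈ Q, ((m : ℝ) * agreeDensity (S.sample B) B T) with hR₂
    have hsplit : ∏ B ∈ S.blocks, ((m : ℝ) * agreeDensity (S.sample B) B T) = R₁ * R₂ :=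
      (Finset.prod_sdiff hQ).symm
    rw [hsplit] at hw
    have hR₁0 : 0 ≤ R₁ := Finset.prod_nonneg fun B _ =>
      mul_nonneg (by positivity) (agreeDensity_nonneg _ _ _)
    have hcount : (S.bad J Q).card * (m * agreeDensity (S.bad J Q) B₀ T) =
        S.fam.card * (m * agreeDensity S.fam B₀ T) := by
      unfold agreeDensity
      rw [hagree]
      field_simp
    set h := Q.card + J.card with hh
    have hyh : 0 < y ^ h := by positivity
    -- The inequality defining badness says exactly that replacing the factors of `Q` by the single
    -- factor of `B₀` loses at most `y ^ h`.
    have hkey : S.fam.card * R₂ ≤ y ^ h * ((S.bad J Q).card *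
        (m * agreeDensity (S.bad J Q) B₀ T)) := by
      rw [hcount]
      calc (S.fam.card : ℝ) * R₂ ≤ S.fam.card * (m * y ^ h * agreeDensity S.fam B₀ T) := by
            gcongr
        _ = _ := by ring
    refine le_of_mul_le_mul_right ?_ hyh
    calc (m : ℝ) * M * y ^ (2 * (2 * (S.mergedBlocks J Q).card +
          3 * (freePositions (S.mergedBlocks J Q)).card)) * y ^ h
        = (m : ℝ) * M * y ^ (2 * (2 * (S.mergedBlocks J Q).card +
          3 * (freePositions (S.mergedBlocks J Q)).card) + h) := by rw [pow_add]; ring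
      _ ≤ (m : ℝ) * M * y ^ (2 * S.potential) := by
          refine mul_le_mul_of_nonneg_left (pow_le_pow_right₀ hy ?_) (by positivity)
          omega
      _ ≤ y ^ (6 * Fintype.card P) * (S.fam.card * (R₁ * R₂)) := hw
      _ = y ^ (6 * Fintype.card P) * (R₁ * (S.fam.card * R₂)) := by ring
      _ ≤ y ^ (6 * Fintype.card P) * (R₁ * (y ^ h * ((S.bad J Q).card *
            (m * agreeDensity (S.bad J Q) B₀ T)))) :=
          mul_le_mul_of_nonneg_left (mul_le_mul_of_nonneg_left hkey hR₁0) (by positivity)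
      _ = _ := by ring
  · have : 0 < Q.card + J.card := by omega
    show 2 * (S.mergedBlocks J Q).card + 3 * (freePositions (S.mergedBlocks J Q)).card < _
    omega

end merge

end SmallDense

/-! ### Stable states -/

namespace SmallDense

set_option linter.unusedSectionVars false

open Finset

variable {P V : Type*} [Fintype P] [DecidableEq P] [Fintype V] [DecidableEq V]

lemma card_filter_apply_eq_mul (a : P) (v : V) :
    (univ.filter fun A : P → V => A a = v).card * Fintype.card V = (univ : Finset (P → V)).card := by
  have h := Fintype.card_filter_piFinset_const_eq_of_mem (s := (univ : Finset V)) (i := a)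
    (x := v) (mem_univ _)
  rw [Fintype.piFinset_univ] at h
  rw [h, Finset.card_univ, Finset.card_univ, Fintype.card_fun, ← pow_succ]
  congr 1
  have : 0 < Fintype.card P := Fintype.card_pos_iff.2 ⟨a⟩
  omega

lemma agreeDensity_univ_singleton (u : P) (T : P → V) :
    agreeDensity (univ : Finset (P → V)) {u} T = 1 / Fintype.card V := by
  have h := card_filter_apply_eq_mul u (T u)
  have hV : 0 < Fintype.card V := Fintype.card_pos_iff.2 ⟨T u⟩
  have hc : 0 < (univ : Finset (P → V)).card := Finset.card_pos.2 ⟨T, mem_univ _⟩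
  have h' : ((univ.filter fun A : P → V => A u = T u).card : ℝ) * Fintype.card V =
    (univ : Finset (P → V)).card := by exact_mod_cast h
  have he : agreeing (univ : Finset (P → V)) {u} T = univ.filter fun A : P → V => A u = T u := by
    ext A; simp [agreeing]
  have hV' : (0 : ℝ) < Fintype.card V := by exact_mod_cast hV
  have hc' : (0 : ℝ) < (univ : Finset (P → V)).card := by exact_mod_cast hc
  unfold agreeDensity
  rw [he, div_eq_div_iff hc'.ne' hV'.ne', h', one_mul]

variable {F₀ : Finset (P → V)} {roots : Finset P} {m : ℕ} {y Λ M : ℝ}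

/-- The state in which every root is its own block, sampled uniformly. -/
lemma exists_blockState (hy : 1 ≤ y) (hF₀ : F₀.Nonempty) (hΛ : 1 ≤ Λ)
    (hM0 : 0 ≤ M) (hM : (m : ℝ) * M ≤ F₀.card * ((m : ℝ) / Fintype.card V) ^ roots.card) :
    Nonempty (BlockState F₀ roots m y Λ M) := by
  have hinj : Function.Injective (fun u : P => ({u} : Finset P)) := Finset.singleton_injective
  have hfree : freePositions (roots.image fun u => ({u} : Finset P)) = rootsᶜ := by
    ext v
    simp only [mem_freePositions, Finset.mem_image, forall_exists_index, and_imp,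
      forall_apply_eq_imp_iff₂, Finset.mem_singleton, Finset.mem_compl]
    exact ⟨fun h hv => h v hv rfl, fun h u hu hvu => h (hvu ▸ hu)⟩
  have hcard : (roots.image fun u => ({u} : Finset P)).card = roots.card :=
    Finset.card_image_of_injective _ hinj
  have hcompl := Finset.card_add_card_compl roots
  have hpot : 2 * (roots.image fun u => ({u} : Finset P)).card +
      3 * (freePositions (roots.image fun u => ({u} : Finset P))).card ≤ 3 * Fintype.card P := by
    rw [hfree, hcard]; omega
  refine ⟨{ blocks := roots.image fun u => {u}
            sample := fun _ => univ
            fam := F₀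
            block_nonempty := ?_
            disjoint := ?_
            roots_covered := ?_
            fam_subset := le_rfl
            fam_nonempty := hF₀
            fam_large := ?_
            sample_large := fun B _ => Finset.card_le_card (Finset.subset_univ _)
            sample_spread := ?_
            weight := ?_ }⟩
  · simp
  · intro B hB B' hB' hne
    obtain ⟨u, -, rfl⟩ := Finset.mem_image.1 hB
    obtain ⟨u', -, rfl⟩ := Finset.mem_image.1 hB'
    rw [Finset.disjoint_singleton]
    rintro rfl
    exact hne rfl
  · intro u hu
    exact ⟨{u}, Finset.mem_image_of_mem _ hu, Finset.mem_singleton_self u⟩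
  · exact mul_le_mul_of_nonneg_right (pow_le_pow_right₀ hy hpot) (by positivity)
  · intro B hB a ha v
    have h := card_filter_apply_eq_mul a v
    have h' : ((univ.filter fun A : P → V => A a = v).card : ℝ) * Fintype.card V =
      (univ : Finset (P → V)).card := by exact_mod_cast h
    rw [h']
    exact le_mul_of_one_le_left (by positivity) hΛ
  · intro T hT
    rw [Finset.prod_image (fun _ _ _ _ h => hinj h)]
    simp only [agreeDensity_univ_singleton, Finset.prod_const, mul_one_div]
    calc _ ≤ (m : ℝ) * M * y ^ (6 * Fintype.card P) := by
          refine mul_le_mul_of_nonneg_left (pow_le_pow_right₀ hy ?_) (by positivity)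
          omega
      _ ≤ (F₀.card * ((m : ℝ) / Fintype.card V) ^ roots.card) * y ^ (6 * Fintype.card P) := by
          gcongr
      _ = _ := by ring

/-- A state in which bad members are rare for every pattern that could be merged. -/
def BlockState.Stable (S : BlockState F₀ roots m y Λ M) : Prop :=
  ∀ J ⊆ freePositions S.blocks, ∀ Q ⊆ S.blocks, 2 ≤ Q.card + 2 * J.card →
    y ^ (Q.card + J.card) * ((S.bad J Q).card : ℝ) < S.fam.card

/-- Potentials are natural numbers, and any failure of stability permits a merge that lowers the
potential. So a state of least potential is stable. -/
lemma exists_stable {Λ₀ : ℝ} (hy : 1 ≤ y) (hm : 0 < m) (hM : 0 < M) (hF₀ : F₀.Nonempty)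
    (hspread : ∀ a : P, ∀ v : V,
      ((F₀.filter fun A => A a = v).card : ℝ) * Fintype.card V ≤ Λ₀ * F₀.card)
    (hΛ₀ : 1 ≤ Λ₀) (hΛ : Λ₀ * y ^ (3 * Fintype.card P) ≤ Λ)
    (hMF : (m : ℝ) * M ≤ F₀.card * ((m : ℝ) / Fintype.card V) ^ roots.card) :
    ∃ S : BlockState F₀ roots m y Λ M, S.Stable := by
  have hΛ1 : 1 ≤ Λ := by
    have := one_le_mul_of_one_le_of_one_le hΛ₀ (one_le_pow₀ hy (n := 3 * Fintype.card P))
    linarith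
  obtain ⟨S₀⟩ := exists_blockState (F₀ := F₀) (roots := roots) hy hF₀ hΛ1 hM.le hMF
  obtain ⟨S, -, hS⟩ := (measure (BlockState.potential
    (F₀ := F₀) (roots := roots) (m := m) (y := y) (Λ := Λ) (M := M))).wf.has_min Set.univ
    ⟨S₀, trivial⟩
  refine ⟨S, fun J hJ Q hQ hne => ?_⟩
  by_contra hcon
  obtain ⟨S', hS'⟩ := S.exists_merge hy hm hM hspread (by linarith) hΛ hJ hQ hne (not_lt.1 hcon)
  exact hS S' trivial hS'

lemma agreeDensity_pos {S : BlockState F₀ roots m y Λ M} (hy : 0 < y) (hm : 0 < m) (hM : 0 < M)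
    {T : P → V} (hT : T ∈ S.fam) {B : Finset P} (hB : B ∈ S.blocks) :
    0 < agreeDensity (S.sample B) B T := by
  have h := S.weight T hT
  have hpos : 0 < (m : ℝ) * M * y ^ (2 * (2 * S.blocks.card + 3 * (freePositions S.blocks).card)) := by
    positivity
  by_contra hcon
  have h0 : agreeDensity (S.sample B) B T = 0 :=
    le_antisymm (not_lt.1 hcon) (agreeDensity_nonneg _ _ _)
  rw [Finset.prod_eq_zero hB (by rw [h0, mul_zero]), mul_zero, mul_zero] at h
  linarith

/-- If the members of `F₀` map adjacent positions to few pairs, then a stable state does not have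
two different blocks containing adjacent positions. -/
lemma BlockState.Stable.eq_of_adjacent {S : BlockState F₀ roots m y Λ M} (hS : S.Stable)
    (hy : 2 ≤ y) (hm : 0 < m) (hΛ : 0 ≤ Λ) {a b : P} {E : Finset (V × V)}
    (hE : ∀ T ∈ F₀, (T a, T b) ∈ E)
    (hsmall : 2 * m * (E.card : ℝ) * Λ ^ 2 < (Fintype.card V : ℝ) ^ 2)
    {B₁ B₂ : Finset P} (hB₁ : B₁ ∈ S.blocks) (hB₂ : B₂ ∈ S.blocks) (ha : a ∈ B₁) (hb : b ∈ B₂) :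
    B₁ = B₂ := by
  by_contra hne
  -- Stability is applied to the merge of the two blocks alone. It forces most members to be not
  -- bad, that is, independent samples from the two blocks produce their values often enough.
  have hstab := hS ∅ (Finset.empty_subset _) {B₁, B₂} (by
    intro B hB
    simp only [Finset.mem_insert, Finset.mem_singleton] at hB
    rcases hB with rfl | rfl <;> assumption) (by rw [Finset.card_pair hne]; simp)
  rw [Finset.card_pair hne, Finset.card_empty, add_zero] at hstab
  set X := S.fam \ S.bad ∅ {B₁, B₂} with hX
  have hsub : S.bad ∅ {B₁, B₂} ⊆ S.fam := Finset.filter_subset _ _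
  have hn : (0 : ℝ) < Fintype.card V := by
    obtain ⟨T, -⟩ := S.fam_nonempty
    exact_mod_cast Fintype.card_pos_iff.2 ⟨T a⟩
  have hfam : 0 < (S.fam.card : ℝ) := by exact_mod_cast S.fam_nonempty.card_pos
  have hXcard : (S.fam.card : ℝ) / 2 ≤ X.card := by
    have h1 : (X.card : ℝ) = S.fam.card - (S.bad ∅ {B₁, B₂}).card := by
      rw [hX, Finset.card_sdiff_of_subset hsub, Nat.cast_sub (Finset.card_le_card hsub)]
    have h2 : (4 : ℝ) ≤ y ^ 2 := by nlinarith
    have h3 : (0 : ℝ) ≤ (S.bad ∅ {B₁, B₂}).card := by positivity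
    nlinarith
  have hs1 : 0 < ((S.sample B₁).card : ℝ) := by
    exact_mod_cast lt_of_lt_of_le S.fam_nonempty.card_pos (S.sample_large B₁ hB₁)
  have hs2 : 0 < ((S.sample B₂).card : ℝ) := by
    exact_mod_cast lt_of_lt_of_le S.fam_nonempty.card_pos (S.sample_large B₂ hB₂)
  set ag : (P → V) → ℝ := fun T => ((agreeing S.fam (B₁ ∪ B₂) T).card : ℝ) with hag
  have hagpos : ∀ T ∈ S.fam, 0 < ag T := fun T hT => by
    have : T ∈ agreeing S.fam (B₁ ∪ B₂) T := mem_agreeing.2 ⟨hT, fun _ _ => rfl⟩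
    exact Nat.cast_pos.2 (Finset.card_pos.2 ⟨T, this⟩)
  have hunion : (∅ ∪ ({B₁, B₂} : Finset (Finset P)).biUnion id) = B₁ ∪ B₂ := by
    ext; simp
  have hXT : ∀ T ∈ X, ag T * ((S.sample B₁).card * (S.sample B₂).card) ≤
      S.fam.card * (m * ((agreeing (S.sample B₁) B₁ T).card *
        (agreeing (S.sample B₂) B₂ T).card : ℝ)) := by
    intro T hT
    rw [hX, Finset.mem_sdiff] at hT
    have hnb := hT.2
    unfold BlockState.bad at hnb
    rw [Finset.mem_filter, not_and, not_lt] at hnb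
    have h1 := hnb hT.1
    rw [hunion, Finset.prod_pair hne, Finset.card_pair hne, Finset.card_empty, add_zero] at h1
    unfold agreeDensity at h1
    have hy2 : (1 : ℝ) ≤ y ^ 2 := one_le_pow₀ (by linarith)
    have hm' : (0 : ℝ) < m := by exact_mod_cast hm
    have h2 : (m : ℝ) * 1 * (ag T / S.fam.card) ≤ m * y ^ 2 * (ag T / S.fam.card) := by
      have := (hagpos T hT.1).le
      gcongr
    have h3 := h2.trans h1
    have h4 : (m : ℝ) * ((agreeing (S.sample B₁) B₁ T).card / (S.sample B₁).card) *
        (m * ((agreeing (S.sample B₂) B₂ T).card / (S.sample B₂).card)) =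
        m * (m * ((agreeing (S.sample B₁) B₁ T).card *
        (agreeing (S.sample B₂) B₂ T).card : ℝ)) / ((S.sample B₁).card * (S.sample B₂).card) := by
      field_simp
    rw [h4, mul_one, ← mul_div_assoc, div_le_div_iff₀ hfam (by positivity)] at h3
    refine le_of_mul_le_mul_left ?_ hm'
    calc _ = m * ag T * ((S.sample B₁).card * (S.sample B₂).card) := by ring
      _ ≤ _ := h3
      _ = _ := by ring
  -- Double counting of pairs of samples. A pair matches only members of one agreement class on `B₁
  -- ∪ B₂`, and the weights `1 / ag` of a class add up to at most 1; a pair that matches any member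
  -- sends `(a, b)` into `E`.
  have hsum : ∑ T ∈ X, ((agreeing (S.sample B₁) B₁ T).card *
        (agreeing (S.sample B₂) B₂ T).card : ℝ) / ag T ≤
      ∑ A ∈ (S.sample B₁) ×ˢ (S.sample B₂), if (A.1 a, A.2 b) ∈ E then (1 : ℝ) else 0 := by
    have h1 : ∀ T ∈ X, ((agreeing (S.sample B₁) B₁ T).card *
        (agreeing (S.sample B₂) B₂ T).card : ℝ) / ag T =
        ∑ A ∈ (S.sample B₁) ×ˢ (S.sample B₂),
          if (∀ i ∈ B₁, A.1 i = T i) ∧ (∀ i ∈ B₂, A.2 i = T i) then 1 / ag T else 0 := by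
      intro T _
      rw [← Finset.sum_filter, Finset.sum_const, nsmul_eq_mul, mul_one_div,
        Finset.filter_product (fun A : P → V => ∀ i ∈ B₁, A i = T i)
          (fun A : P → V => ∀ i ∈ B₂, A i = T i), Finset.card_product]
      push_cast
      rfl
    rw [Finset.sum_congr rfl h1, Finset.sum_comm]
    refine Finset.sum_le_sum fun A hA => ?_
    rw [← Finset.sum_filter]
    set Y := X.filter fun T => (∀ i ∈ B₁, A.1 i = T i) ∧ (∀ i ∈ B₂, A.2 i = T i) with hY
    rcases Y.eq_empty_or_nonempty with hYe | ⟨T₀, hT₀⟩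
    · rw [hYe, Finset.sum_empty]; split_ifs <;> norm_num
    · have hT₀' := Finset.mem_filter.1 hT₀
      have hT₀f : T₀ ∈ S.fam := (Finset.mem_sdiff.1 hT₀'.1).1
      rw [if_pos (by
        rw [hT₀'.2.1 a ha, hT₀'.2.2 b hb]
        exact hE T₀ (S.fam_subset hT₀f))]
      have hYag : ∀ T ∈ Y, agreeing S.fam (B₁ ∪ B₂) T = agreeing S.fam (B₁ ∪ B₂) T₀ := by
        intro T hT
        have hT' := Finset.mem_filter.1 hT
        ext A'
        simp only [mem_agreeing]
        refine and_congr_right fun _ => forall₂_congr fun i hi => ?_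
        rcases Finset.mem_union.1 hi with hi | hi
        · rw [← hT'.2.1 i hi, ← hT₀'.2.1 i hi]
        · rw [← hT'.2.2 i hi, ← hT₀'.2.2 i hi]
      have hYsub : Y ⊆ agreeing S.fam (B₁ ∪ B₂) T₀ := by
        intro T hT
        rw [← hYag T hT, mem_agreeing]
        exact ⟨(Finset.mem_sdiff.1 (Finset.mem_filter.1 hT).1).1, fun _ _ => rfl⟩
      have h2 : ∑ T ∈ Y, 1 / ag T = ∑ T ∈ Y, 1 / ag T₀ :=
        Finset.sum_congr rfl fun T hT => by simp only [hag]; rw [hYag T hT]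
      rw [h2, Finset.sum_const, nsmul_eq_mul, mul_one_div, div_le_one (hagpos T₀ hT₀f)]
      exact Nat.cast_le.2 (Finset.card_le_card hYsub)
  have hcount : ∑ A ∈ (S.sample B₁) ×ˢ (S.sample B₂), (if (A.1 a, A.2 b) ∈ E then (1 : ℝ) else 0) ≤
      E.card * ((Λ * (S.sample B₁).card / Fintype.card V) *
        (Λ * (S.sample B₂).card / Fintype.card V)) := by
    have h1 : ∀ A ∈ (S.sample B₁) ×ˢ (S.sample B₂), (if (A.1 a, A.2 b) ∈ E then (1 : ℝ) else 0) =
        ∑ e ∈ E, if A.1 a = e.1 ∧ A.2 b = e.2 then (1 : ℝ) else 0 := by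
      intro A _
      have : ∀ e ∈ E, (if A.1 a = e.1 ∧ A.2 b = e.2 then (1 : ℝ) else 0) =
          if (A.1 a, A.2 b) = e then 1 else 0 := by
        intro e _; simp [Prod.ext_iff]
      rw [Finset.sum_congr rfl this, Finset.sum_ite_eq]
    rw [Finset.sum_congr rfl h1, Finset.sum_comm]
    rw [← nsmul_eq_mul]
    refine Finset.sum_le_card_nsmul _ _ _ fun e _ => ?_
    rw [← Finset.sum_filter, Finset.sum_const, nsmul_eq_mul, mul_one,
      Finset.filter_product (fun A : P → V => A a = e.1) (fun A : P → V => A b = e.2),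
      Finset.card_product]
    push_cast
    have h2 := S.sample_spread B₁ hB₁ a ha e.1
    have h3 := S.sample_spread B₂ hB₂ b hb e.2
    rw [← le_div_iff₀ hn] at h2 h3
    gcongr
  have hfinal : (X.card : ℝ) * ((S.sample B₁).card * (S.sample B₂).card) ≤
      S.fam.card * m * (E.card * ((Λ * (S.sample B₁).card / Fintype.card V) *
        (Λ * (S.sample B₂).card / Fintype.card V))) := by
    calc (X.card : ℝ) * ((S.sample B₁).card * (S.sample B₂).card)
        = ∑ T ∈ X, ((S.sample B₁).card * (S.sample B₂).card : ℝ) := by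
          rw [Finset.sum_const, nsmul_eq_mul]
      _ ≤ ∑ T ∈ X, S.fam.card * m * (((agreeing (S.sample B₁) B₁ T).card *
        (agreeing (S.sample B₂) B₂ T).card : ℝ) / ag T) := by
          refine Finset.sum_le_sum fun T hT => ?_
          have h0 := hagpos T (Finset.mem_sdiff.1 hT).1
          rw [← mul_div_assoc, le_div_iff₀ h0]
          have := hXT T hT
          linarith
      _ = S.fam.card * m * ∑ T ∈ X, ((agreeing (S.sample B₁) B₁ T).card *
        (agreeing (S.sample B₂) B₂ T).card : ℝ) / ag T := by rw [Finset.mul_sum]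
      _ ≤ _ := by gcongr; exact hsum.trans hcount
  have h5 : (S.fam.card : ℝ) / 2 * ((S.sample B₁).card * (S.sample B₂).card) ≤
      S.fam.card * m * (E.card * ((Λ * (S.sample B₁).card / Fintype.card V) *
        (Λ * (S.sample B₂).card / Fintype.card V))) :=
    le_trans (by gcongr) hfinal
  have h6 : S.fam.card * m * (E.card * ((Λ * (S.sample B₁).card / Fintype.card V) *
        (Λ * (S.sample B₂).card / Fintype.card V))) =
      (S.fam.card / 2 * ((S.sample B₁).card * (S.sample B₂).card)) *
        ((2 * m * (E.card : ℝ) * Λ ^ 2) / (Fintype.card V : ℝ) ^ 2) := by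
    field_simp
  rw [h6] at h5
  have h7 : (2 * m * (E.card : ℝ) * Λ ^ 2) / (Fintype.card V : ℝ) ^ 2 < 1 := by
    rw [div_lt_one (by positivity)]; exact hsmall
  have h8 : (0 : ℝ) < S.fam.card / 2 * ((S.sample B₁).card * (S.sample B₂).card) := by positivity
  nlinarith

/-- A stable state has free positions, provided that the initial family is large enough. -/
lemma BlockState.Stable.free_nonempty {S : BlockState F₀ roots m y Λ M} (hS : S.Stable)
    (hy : 2 ≤ y) (hm : 0 < m) (hΛ : 0 ≤ Λ) (hM : y ^ (6 * Fintype.card P) < M)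
    (adj : P → P → Prop) (z : P) (hconn : ∀ B : Finset P, z ∈ B → B ≠ univ →
      ∃ a ∈ B, ∃ b ∉ B, adj a b)
    {Ecard : ℝ} (hE : ∀ a b, adj a b → ∃ E : Finset (V × V), (∀ T ∈ F₀, (T a, T b) ∈ E) ∧
      (E.card : ℝ) ≤ Ecard)
    (hsmall : 2 * m * Ecard * Λ ^ 2 < (Fintype.card V : ℝ) ^ 2) :
    (freePositions S.blocks).Nonempty := by
  by_contra hfree
  rw [Finset.not_nonempty_iff_eq_empty] at hfree
  have hcov : ∀ v : P, ∃ B ∈ S.blocks, v ∈ B := by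
    intro v
    have : v ∉ freePositions S.blocks := by rw [hfree]; simp
    rw [mem_freePositions] at this
    push Not at this
    exact this
  obtain ⟨B, hB, hzB⟩ := hcov z
  -- By connectivity, a proper block containing `z` would be joined to a different block.
  have hBuniv : B = univ := by
    by_contra hne
    obtain ⟨a, ha, b, hb, hab⟩ := hconn B hzB hne
    obtain ⟨B', hB', hbB'⟩ := hcov b
    obtain ⟨E, hE1, hE2⟩ := hE a b hab
    have := hS.eq_of_adjacent hy hm hΛ hE1 (lt_of_le_of_lt (by gcongr) hsmall) hB hB' ha hbB'
    exact hb (this ▸ hbB')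
  have hblocks : S.blocks = {B} := by
    ext B'
    rw [Finset.mem_singleton]
    constructor
    · intro hB'
      by_contra hne
      have hdis := S.disjoint B hB B' hB' (Ne.symm hne)
      obtain ⟨b, hb⟩ := S.block_nonempty B' hB'
      exact Finset.disjoint_left.1 hdis (hBuniv ▸ mem_univ b) hb
    · rintro rfl; exact hB
  obtain ⟨T, hT⟩ := S.fam_nonempty
  have hw := S.weight T hT
  rw [hblocks, Finset.prod_singleton] at hw
  have hs : 0 < ((S.sample B).card : ℝ) := by
    exact_mod_cast lt_of_lt_of_le S.fam_nonempty.card_pos (S.sample_large B hB)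
  have hle : ((agreeing (S.sample B) B T).card : ℝ) ≤ 1 := by
    have : agreeing (S.sample B) B T ⊆ {T} := by
      intro A hA
      rw [Finset.mem_singleton]
      funext i
      exact (mem_agreeing.1 hA).2 i (hBuniv ▸ mem_univ i)
    exact_mod_cast (Finset.card_le_card this).trans_eq (Finset.card_singleton _)
  -- Agreement on all positions is equality, so the density is at most `1 / |sample|`, and the
  -- sample is no smaller than the family. This caps the weight at `m`, against `M > y ^ (6 *
  -- Fintype.card P)`.
  have h1 : (S.fam.card : ℝ) * (m * agreeDensity (S.sample B) B T) ≤ m := by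
    unfold agreeDensity
    have h2 : (S.fam.card : ℝ) ≤ (S.sample B).card := by exact_mod_cast S.sample_large B hB
    have h3 : (S.fam.card : ℝ) * ((agreeing (S.sample B) B T).card / (S.sample B).card) ≤ 1 := by
      rw [← mul_div_assoc, div_le_one hs]
      nlinarith
    have hm' : (0 : ℝ) < m := by exact_mod_cast hm
    nlinarith
  have hm' : (0 : ℝ) < m := by exact_mod_cast hm
  have h4 : (1 : ℝ) ≤ y ^ (2 * (2 * ({B} : Finset (Finset P)).card +
      3 * (freePositions ({B} : Finset (Finset P))).card)) := one_le_pow₀ (by linarith)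
  have hM0 : 0 < M := lt_trans (by positivity) hM
  have h5 : (m : ℝ) * M * 1 ≤ y ^ (6 * Fintype.card P) * m :=
    le_trans (by gcongr) (hw.trans (by gcongr))
  nlinarith

end SmallDense

/-! ### Weighted independent sets and moments of independent samples -/

namespace SmallDense

set_option linter.unusedSectionVars false

open Finset

section weighted

variable {α : Type*} [DecidableEq α]

/-- A weighted graph of total weight `X` whose adjacent pairs have total weight `Y` contains an
independent set of size at least `X ^ 2 / (4 * Y)`. -/
lemma exists_independent (G : Finset α) (ω : α → ℝ) (hω : ∀ T ∈ G, 0 ≤ ω T)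
    (conf : α → α → Prop) [DecidableRel conf] (hrefl : ∀ T, conf T T)
    (hsymm : ∀ T T', conf T T' → conf T' T) (hX : 0 < ∑ T ∈ G, ω T) :
    ∃ F ⊆ G, (∀ T ∈ F, 0 < ω T) ∧ (∀ T ∈ F, ∀ T' ∈ F, T ≠ T' → ¬ conf T T') ∧
      (∑ T ∈ G, ω T) ^ 2 ≤
        4 * (∑ T ∈ G, ∑ T' ∈ G.filter (conf T), ω T * ω T') * F.card := by
  set X := ∑ T ∈ G, ω T with hXdef
  set ℓ : α → ℝ := fun T => ∑ T' ∈ G.filter (conf T), ω T' with hℓ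
  set Y := ∑ T ∈ G, ∑ T' ∈ G.filter (conf T), ω T * ω T' with hYdef
  have hY : Y = ∑ T ∈ G, ω T * ℓ T := by
    simp only [hYdef, hℓ, Finset.mul_sum]
  have hℓ0 : ∀ T, 0 ≤ ℓ T := fun T =>
    Finset.sum_nonneg fun T' hT' => hω T' (Finset.mem_filter.1 hT').1
  -- The average of `ℓ` with respect to `ω` is `Y / X`; by Markov, the vertices with `ℓ` at most
  -- twice this carry half of the weight.
  set light := G.filter fun T => 0 < ω T ∧ X * ℓ T ≤ 2 * Y with hlight
  have hsplit : X ≤ 2 * ∑ T ∈ light, ω T := by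
    have h1 : ∑ T ∈ G.filter (fun T => ¬ (0 < ω T ∧ X * ℓ T ≤ 2 * Y)), ω T * (2 * Y) ≤
        ∑ T ∈ G, ω T * (X * ℓ T) := by
      calc _ ≤ ∑ T ∈ G.filter (fun T => ¬ (0 < ω T ∧ X * ℓ T ≤ 2 * Y)), ω T * (X * ℓ T) := by
            refine Finset.sum_le_sum fun T hT => ?_
            rw [Finset.mem_filter, not_and_or, not_lt, not_le] at hT
            rcases hT with ⟨hTG, h | h⟩
            · have : ω T = 0 := le_antisymm h (hω T hTG)
              simp [this]
            · exact mul_le_mul_of_nonneg_left h.le (hω T hTG)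
        _ ≤ _ := Finset.sum_le_sum_of_subset_of_nonneg (Finset.filter_subset _ _)
            fun T hT _ => mul_nonneg (hω T hT) (mul_nonneg hX.le (hℓ0 T))
    have h2 : ∑ T ∈ G, ω T * (X * ℓ T) = X * Y := by
      rw [hY, Finset.mul_sum]
      exact Finset.sum_congr rfl fun T _ => by ring
    rw [h2, ← Finset.sum_mul] at h1
    have h3 := Finset.sum_filter_add_sum_filter_not G (fun T => 0 < ω T ∧ X * ℓ T ≤ 2 * Y) ω
    have hYpos : 0 < Y := by
      obtain ⟨T, hT, hTpos⟩ := Finset.exists_ne_zero_of_sum_ne_zero hX.ne'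
      have hTpos' : 0 < ω T := lt_of_le_of_ne (hω T hT) (Ne.symm hTpos)
      have h4 : ω T * ω T ≤ ω T * ℓ T := by
        refine mul_le_mul_of_nonneg_left ?_ hTpos'.le
        exact Finset.single_le_sum (f := ω) (fun T' hT' => hω T' (Finset.mem_filter.1 hT').1)
          (Finset.mem_filter.2 ⟨hT, hrefl T⟩)
      have h5 : ω T * ℓ T ≤ Y := by
        rw [hY]
        exact Finset.single_le_sum (f := fun T => ω T * ℓ T)
          (fun T' hT' => mul_nonneg (hω T' hT') (hℓ0 T')) hT
      nlinarith
    nlinarith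
  -- A largest independent set among the light vertices dominates them, so their weight is at most
  -- the sum of `ℓ` over `F`, that is, at most `|F| * 2Y / X`.
  obtain ⟨F, hF, hFmax⟩ := Finset.exists_max_image
    (light.powerset.filter fun F => ∀ T ∈ F, ∀ T' ∈ F, T ≠ T' → ¬ conf T T') Finset.card
    ⟨∅, by simp⟩
  rw [Finset.mem_filter, Finset.mem_powerset] at hF
  have hcover : ∀ T ∈ light, ∃ T' ∈ F, conf T' T := by
    intro T hT
    by_contra hcon
    push Not at hcon
    have hTF : T ∉ F := fun h => hcon T h (hrefl T)
    have := hFmax (insert T F) (by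
      rw [Finset.mem_filter, Finset.mem_powerset]
      refine ⟨Finset.insert_subset hT hF.1, ?_⟩
      intro A hA A' hA' hne
      rcases Finset.mem_insert.1 hA with rfl | hAF <;>
        rcases Finset.mem_insert.1 hA' with rfl | hAF'
      · exact absurd rfl hne
      · exact fun h => hcon A' hAF' (hsymm _ _ h)
      · exact hcon A hAF
      · exact hF.2 A hAF A' hAF' hne)
    rw [Finset.card_insert_of_notMem hTF] at this
    omega
  refine ⟨F, hF.1.trans (Finset.filter_subset _ _),
    fun T hT => (Finset.mem_filter.1 (hF.1 hT)).2.1, hF.2, ?_⟩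
  have h1 : ∑ T ∈ light, ω T ≤ ∑ T' ∈ F, ℓ T' := by
    have hlG : ∀ T ∈ light, 0 ≤ ω T := fun T hT => hω T (Finset.mem_filter.1 hT).1
    calc ∑ T ∈ light, ω T ≤ ∑ T ∈ light, ∑ T' ∈ F, if conf T' T then ω T else 0 := by
          refine Finset.sum_le_sum fun T hT => ?_
          obtain ⟨T', hT', hc⟩ := hcover T hT
          have := Finset.single_le_sum (f := fun T' => if conf T' T then ω T else 0)
            (fun A _ => by split_ifs; exacts [hlG T hT, le_rfl]) hT'
          simpa [hc] using this
      _ = ∑ T' ∈ F, ∑ T ∈ light, if conf T' T then ω T else 0 := Finset.sum_comm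
      _ ≤ ∑ T' ∈ F, ℓ T' := by
          refine Finset.sum_le_sum fun T' _ => ?_
          rw [← Finset.sum_filter]
          exact Finset.sum_le_sum_of_subset_of_nonneg
            (Finset.filter_subset_filter _ (Finset.filter_subset _ _))
            fun T hT _ => hω T (Finset.mem_filter.1 hT).1
  have h2 : X * ∑ T' ∈ F, ℓ T' ≤ F.card * (2 * Y) := by
    rw [Finset.mul_sum, ← nsmul_eq_mul]
    exact Finset.sum_le_card_nsmul _ _ _ fun T hT => (Finset.mem_filter.1 (hF.1 hT)).2.2
  nlinarith

end weighted

section sampling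

variable {α : Type*} [DecidableEq α]

lemma sum_piFinset_apply_mul_apply (A : Finset α) (hA : A.Nonempty) {m : ℕ} (f g : α → ℝ)
    {l l' : Fin m} (hl : l ≠ l') :
    ∑ σ ∈ Fintype.piFinset (fun _ : Fin m => A), f (σ l) * g (σ l') =
      (A.card : ℝ) ^ m * (((∑ a ∈ A, f a) / A.card) * ((∑ a ∈ A, g a) / A.card)) := by
  have hA' : (A.card : ℝ) ≠ 0 := by exact_mod_cast hA.card_pos.ne'
  set h : Fin m → α → ℝ := fun x a => if x = l then f a else if x = l' then g a else 1 with hh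
  have h1 : ∀ σ ∈ Fintype.piFinset (fun _ : Fin m => A), f (σ l) * g (σ l') = ∏ x, h x (σ x) := by
    intro σ _
    rw [Fintype.prod_eq_mul l l' hl]
    · simp [hh, hl.symm]
    · rintro x ⟨hx, hx'⟩
      simp [hh, hx, hx']
  rw [Finset.sum_congr rfl h1, ← Finset.prod_univ_sum (fun _ : Fin m => A) h]
  have h2 : ∀ x, ∑ a ∈ A, h x a = A.card * ((∑ a ∈ A, h x a) / A.card) := by
    intro x; field_simp
  rw [Finset.prod_congr rfl fun x _ => h2 x, Finset.prod_mul_distrib, Finset.prod_const,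
    Finset.card_univ, Fintype.card_fin, Fintype.prod_eq_mul l l' hl]
  · simp [hh, hl.symm]
  · rintro x ⟨hx, hx'⟩
    simp [hh, hx, hx', hA']

lemma sum_piFinset_apply' (A : Finset α) (hA : A.Nonempty) {m : ℕ} (f : α → ℝ) (l : Fin m) :
    ∑ σ ∈ Fintype.piFinset (fun _ : Fin m => A), f (σ l) =
      (A.card : ℝ) ^ m * ((∑ a ∈ A, f a) / A.card) := by
  have hA' : (A.card : ℝ) ≠ 0 := by exact_mod_cast hA.card_pos.ne'
  rw [Fintype.sum_piFinset_apply, Fintype.card_fin, nsmul_eq_mul]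
  have hm : m = m - 1 + 1 := by have := l.2; omega
  conv_rhs => rw [hm, pow_succ]
  push_cast
  field_simp

lemma sum_piFinset_sum (A : Finset α) (hA : A.Nonempty) (m : ℕ) (f : α → ℝ) :
    ∑ σ ∈ Fintype.piFinset (fun _ : Fin m => A), ∑ l, f (σ l) =
      (A.card : ℝ) ^ m * (m * ((∑ a ∈ A, f a) / A.card)) := by
  rw [Finset.sum_comm, Finset.sum_congr rfl fun l _ => sum_piFinset_apply' A hA f l,
    Finset.sum_const, Finset.card_univ, Fintype.card_fin, nsmul_eq_mul]
  ring

/-- Pairs of distinct indices are independent and give the product of the means; the `m` diagonal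
pairs give the mean of the product. -/
lemma sum_piFinset_sum_mul_sum_le (A : Finset α) (hA : A.Nonempty) (m : ℕ) (f g : α → ℝ)
    (hf : ∀ a, 0 ≤ f a) (hg : ∀ a, 0 ≤ g a) :
    ∑ σ ∈ Fintype.piFinset (fun _ : Fin m => A), (∑ l, f (σ l)) * (∑ l, g (σ l)) ≤
      (A.card : ℝ) ^ m * ((m * ((∑ a ∈ A, f a) / A.card)) * (m * ((∑ a ∈ A, g a) / A.card)) +
        m * ((∑ a ∈ A, f a * g a) / A.card)) := by
  have hF : 0 ≤ (∑ a ∈ A, f a) / A.card :=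
    div_nonneg (Finset.sum_nonneg fun a _ => hf a) (by positivity)
  have hG : 0 ≤ (∑ a ∈ A, g a) / A.card :=
    div_nonneg (Finset.sum_nonneg fun a _ => hg a) (by positivity)
  have hH : 0 ≤ (∑ a ∈ A, f a * g a) / A.card :=
    div_nonneg (Finset.sum_nonneg fun a _ => mul_nonneg (hf a) (hg a)) (by positivity)
  have h1 : ∀ l l' : Fin m, ∑ σ ∈ Fintype.piFinset (fun _ : Fin m => A), f (σ l) * g (σ l') ≤
      (A.card : ℝ) ^ m * (((∑ a ∈ A, f a) / A.card) * ((∑ a ∈ A, g a) / A.card) +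
        if l = l' then (∑ a ∈ A, f a * g a) / A.card else 0) := by
    intro l l'
    by_cases hl : l = l'
    · subst hl
      rw [sum_piFinset_apply' A hA (fun a => f a * g a) l, if_pos rfl]
      gcongr
      exact le_add_of_nonneg_left (by positivity)
    · rw [sum_piFinset_apply_mul_apply A hA f g hl, if_neg hl, add_zero]
  simp_rw [Finset.sum_mul_sum]
  rw [Finset.sum_comm]
  simp_rw [Finset.sum_comm (s := Fintype.piFinset (fun _ : Fin m => A))]
  calc _ ≤ ∑ l : Fin m, ∑ l' : Fin m, ((A.card : ℝ) ^ m *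
        (((∑ a ∈ A, f a) / A.card) * ((∑ a ∈ A, g a) / A.card) +
        if l = l' then (∑ a ∈ A, f a * g a) / A.card else 0)) :=
        Finset.sum_le_sum fun l _ => Finset.sum_le_sum fun l' _ => h1 l l'
    _ = _ := by
        simp only [mul_add, Finset.sum_add_distrib, Finset.sum_const, Finset.card_univ,
          Fintype.card_fin, nsmul_eq_mul, ← Finset.mul_sum, Finset.sum_ite_eq, Finset.mem_univ,
          if_true]
        ring

end sampling

end SmallDense

/-! ### The second moment argument in a stable state -/

namespace SmallDense

set_option linter.unusedSectionVars false

open Finset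

variable {P V : Type*} [Fintype P] [DecidableEq P] [Fintype V] [DecidableEq V]

/-- The number of samples that agree with `T` on `B`. -/
noncomputable def hits {m : ℕ} (B : Finset P) (T : P → V) (σ : Fin m → P → V) : ℝ :=
  ∑ l, if ∀ i ∈ B, σ l i = T i then (1 : ℝ) else 0

lemma hits_nonneg {m : ℕ} (B : Finset P) (T : P → V) (σ : Fin m → P → V) : 0 ≤ hits B T σ :=
  Finset.sum_nonneg fun _ _ => by split_ifs <;> norm_num

lemma agreeDensity_eq_sum (A : Finset (P → V)) (B : Finset P) (T : P → V) :
    agreeDensity A B T = (∑ a ∈ A, if ∀ i ∈ B, a i = T i then (1 : ℝ) else 0) / A.card := by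
  rw [← Finset.sum_filter, Finset.sum_const, nsmul_eq_mul, mul_one]
  rfl

lemma sum_hits {A : Finset (P → V)} (hA : A.Nonempty) (m : ℕ) (B : Finset P) (T : P → V) :
    ∑ σ ∈ Fintype.piFinset (fun _ : Fin m => A), hits B T σ =
      (A.card : ℝ) ^ m * (m * agreeDensity A B T) := by
  rw [agreeDensity_eq_sum, ← sum_piFinset_sum A hA]
  rfl

/-- The extra indicator comes from a single sample hitting both `T` and `T'`, which forces them to
agree on `B`. -/
lemma sum_hits_mul_hits_le {A : Finset (P → V)} (hA : A.Nonempty) (m : ℕ) (B : Finset P)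
    (T T' : P → V) :
    ∑ σ ∈ Fintype.piFinset (fun _ : Fin m => A), hits B T σ * hits B T' σ ≤
      (A.card : ℝ) ^ m * ((m * agreeDensity A B T) *
        (m * agreeDensity A B T' + if ∀ i ∈ B, T' i = T i then 1 else 0)) := by
  refine (sum_piFinset_sum_mul_sum_le A hA m
    (fun a => if ∀ i ∈ B, a i = T i then (1 : ℝ) else 0)
    (fun a => if ∀ i ∈ B, a i = T' i then (1 : ℝ) else 0) (fun _ => by split_ifs <;> norm_num)
    (fun _ => by split_ifs <;> norm_num)).trans ?_
  rw [← agreeDensity_eq_sum, ← agreeDensity_eq_sum]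
  refine mul_le_mul_of_nonneg_left ?_ (by positivity)
  rw [mul_add]
  refine add_le_add le_rfl ?_
  have h : (∑ a ∈ A, (if ∀ i ∈ B, a i = T i then (1 : ℝ) else 0) *
      (if ∀ i ∈ B, a i = T' i then (1 : ℝ) else 0)) / A.card ≤
      agreeDensity A B T * (if ∀ i ∈ B, T' i = T i then (1 : ℝ) else 0) := by
    rw [agreeDensity_eq_sum, div_mul_eq_mul_div, Finset.sum_mul]
    refine div_le_div_of_nonneg_right (Finset.sum_le_sum fun a _ => ?_) (by positivity)
    by_cases h1 : ∀ i ∈ B, a i = T i <;> by_cases h2 : ∀ i ∈ B, a i = T' i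
    · rw [if_pos h1, if_pos h2, if_pos (fun i hi => (h2 i hi).symm.trans (h1 i hi))]
    · rw [if_neg h2, mul_zero]; split_ifs <;> norm_num
    · rw [if_neg h1, zero_mul, zero_mul]
    · rw [if_neg h1, zero_mul, zero_mul]
  calc _ ≤ (m : ℝ) * (agreeDensity A B T * (if ∀ i ∈ B, T' i = T i then (1 : ℝ) else 0)) := by
        gcongr
    _ = _ := by ring

variable {F₀ : Finset (P → V)} {roots : Finset P} {m : ℕ} {y Λ M : ℝ}

lemma BlockState.sum_card_blocks_le (S : BlockState F₀ roots m y Λ M) :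
    ∑ B ∈ S.blocks, B.card ≤ Fintype.card P := by
  have h := Finset.card_biUnion (s := S.blocks) (t := id)
    (fun B hB B' hB' hne => S.disjoint B hB B' hB' hne)
  simp only [id] at h
  rw [← h]
  exact Finset.card_le_univ _

lemma BlockState.card_blocks_le (S : BlockState F₀ roots m y Λ M) :
    S.blocks.card ≤ Fintype.card P := by
  refine le_trans ?_ S.sum_card_blocks_le
  rw [Finset.card_eq_sum_ones]
  exact Finset.sum_le_sum fun B hB => (S.block_nonempty B hB).card_pos

lemma one_add_inv_pow_le {p b : ℕ} (hb : b ≤ p) (hy : 4 * (p : ℝ) ≤ y) (hy0 : 0 < y) :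
    (1 + 1 / y) ^ b ≤ 2 := by
  have h1 : 1 + 1 / y ≤ Real.exp (1 / y) := by linarith [Real.add_one_le_exp (1 / y)]
  have h2 : (1 + 1 / y) ^ b ≤ Real.exp (b * (1 / y)) := by
    rw [Real.exp_nat_mul]
    exact pow_le_pow_left₀ (by positivity) h1 b
  refine h2.trans ?_
  have hb' : (b : ℝ) ≤ p := by exact_mod_cast hb
  have h3 : (b : ℝ) * (1 / y) ≤ Real.log 2 := by
    rw [mul_one_div, div_le_iff₀ hy0]
    nlinarith [Real.log_two_gt_d9]
  calc _ ≤ Real.exp (Real.log 2) := Real.exp_le_exp.2 h3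
    _ = 2 := Real.exp_log (by norm_num)

/-- The members that are not bad for any pattern with exactly one free position. -/
noncomputable def BlockState.good (S : BlockState F₀ roots m y Λ M) : Finset (P → V) :=
  S.fam.filter fun T => ∀ z ∈ freePositions S.blocks, ∀ Q ∈ S.blocks.powerset, T ∉ S.bad {z} Q

lemma sum_powerset_inv_pow_le (S : BlockState F₀ roots m y Λ M) (hy0 : 0 < y)
    (hy : 4 * (Fintype.card P : ℝ) ≤ y) :
    ∑ _z ∈ freePositions S.blocks, ∑ Q ∈ S.blocks.powerset, (1 / y) ^ (Q.card + 1) ≤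
      2 * Fintype.card P / y := by
  have h := Finset.sum_pow_mul_eq_add_pow (1 / y) (1 : ℝ) S.blocks
  simp only [one_pow, mul_one] at h
  simp_rw [pow_succ, ← Finset.sum_mul]
  rw [h, Finset.sum_const, nsmul_eq_mul, add_comm]
  have h1 := one_add_inv_pow_le S.card_blocks_le hy hy0
  have h2 : ((freePositions S.blocks).card : ℝ) ≤ Fintype.card P := by
    exact_mod_cast Finset.card_le_univ _
  calc _ = ((freePositions S.blocks).card * (1 + 1 / y) ^ S.blocks.card) * (1 / y) := by ring
    _ ≤ (Fintype.card P * 2) * (1 / y) := by gcongr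
    _ = _ := by ring

/-- A union bound over the patterns with one free position: the bad proportions are at most `y ^
(-(|Q| + 1))`, and their sum over all `z` and `Q` is at most `2p / y ≤ 1/2`, where `p` is the number
of positions. -/
lemma BlockState.Stable.card_good {S : BlockState F₀ roots m y Λ M} (hS : S.Stable)
    (hy0 : 0 < y) (hy : 4 * (Fintype.card P : ℝ) ≤ y) :
    (S.fam.card : ℝ) ≤ 2 * S.good.card := by
  have hsub : S.fam \ S.good ⊆ (freePositions S.blocks).biUnion fun z =>
      S.blocks.powerset.biUnion fun Q => S.bad {z} Q := by
    intro T hT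
    rw [Finset.mem_sdiff, BlockState.good, Finset.mem_filter, not_and] at hT
    have := hT.2 hT.1
    push Not at this
    obtain ⟨z, hz, Q, hQ, h⟩ := this
    exact Finset.mem_biUnion.2 ⟨z, hz, Finset.mem_biUnion.2 ⟨Q, hQ, h⟩⟩
  have h1 : ((S.fam \ S.good).card : ℝ) ≤
      ∑ z ∈ freePositions S.blocks, ∑ Q ∈ S.blocks.powerset, ((S.bad {z} Q).card : ℝ) := by
    refine (Nat.cast_le.2 ((Finset.card_le_card hsub).trans (Finset.card_biUnion_le))).trans ?_
    push_cast
    refine Finset.sum_le_sum fun z _ => ?_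
    exact_mod_cast Finset.card_biUnion_le
  have h2 : ∑ z ∈ freePositions S.blocks, ∑ Q ∈ S.blocks.powerset, ((S.bad {z} Q).card : ℝ) ≤
      ∑ _z ∈ freePositions S.blocks, ∑ Q ∈ S.blocks.powerset,
        (1 / y) ^ (Q.card + 1) * S.fam.card := by
    refine Finset.sum_le_sum fun z hz => Finset.sum_le_sum fun Q hQ => ?_
    have h := hS {z} (Finset.singleton_subset_iff.2 hz) Q (Finset.mem_powerset.1 hQ)
      (by rw [Finset.card_singleton]; omega)
    rw [Finset.card_singleton] at h
    rw [one_div, inv_pow, inv_mul_eq_div, le_div_iff₀ (by positivity)]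
    linarith
  have h3 := sum_powerset_inv_pow_le S hy0 hy
  simp_rw [← Finset.sum_mul] at h2
  have h4 : (S.fam.card : ℝ) = (S.fam \ S.good).card + S.good.card := by
    have : S.good ⊆ S.fam := Finset.filter_subset _ _
    exact_mod_cast (Finset.card_sdiff_add_card_eq_card this).symm
  have h5 : 2 * (Fintype.card P : ℝ) / y ≤ 1 / 2 := by
    rw [div_le_div_iff₀ hy0 (by norm_num)]; linarith
  have h6 : (∑ _z ∈ freePositions S.blocks, ∑ Q ∈ S.blocks.powerset, (1 / y) ^ (Q.card + 1)) *
      (S.fam.card : ℝ) ≤ 1 / 2 * S.fam.card := by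
    gcongr; exact h3.trans h5
  linarith

section expectation

variable (S : BlockState F₀ roots m y Λ M)

/-- All choices of `m` samples for every block. -/
def BlockState.samples : Finset (S.blocks → Fin m → P → V) :=
  Fintype.piFinset fun B : S.blocks => Fintype.piFinset fun _ : Fin m => S.sample B

/-- The reciprocal of the expected number of occurrences of `T`, up to normalization. -/
noncomputable def BlockState.invWeight (T : P → V) : ℝ :=
  ∏ B ∈ S.blocks, ((m : ℝ) * agreeDensity (S.sample B) B T)

/-- The number of ways in which `T` occurs in a choice of samples. -/
noncomputable def BlockState.occ (σ : S.blocks → Fin m → P → V) (T : P → V) : ℝ :=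
  ∏ B : S.blocks, hits B T (σ B)

lemma BlockState.sample_nonempty {B : Finset P} (hB : B ∈ S.blocks) : (S.sample B).Nonempty :=
  Finset.card_pos.1 (lt_of_lt_of_le S.fam_nonempty.card_pos (S.sample_large B hB))

lemma BlockState.card_samples :
    (S.samples.card : ℝ) = ∏ B : S.blocks, ((S.sample B).card : ℝ) ^ m := by
  simp [BlockState.samples, Fintype.card_piFinset]

lemma BlockState.card_samples_pos : 0 < (S.samples.card : ℝ) := by
  rw [S.card_samples]
  refine Finset.prod_pos fun B _ => pow_pos ?_ _
  exact_mod_cast (S.sample_nonempty B.2).card_pos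

lemma BlockState.sum_occ (T : P → V) :
    ∑ σ ∈ S.samples, S.occ σ T = S.samples.card * S.invWeight T := by
  unfold BlockState.occ BlockState.samples
  rw [← Finset.prod_univ_sum (fun B : S.blocks => Fintype.piFinset fun _ : Fin m => S.sample B)
    (fun B τ => hits (B : Finset P) T τ)]
  rw [Finset.prod_congr rfl fun (B : S.blocks) _ => sum_hits (S.sample_nonempty B.2) m B T,
    Finset.prod_mul_distrib, ← S.card_samples]
  congr 1
  exact Finset.prod_coe_sort S.blocks fun B => (m : ℝ) * agreeDensity (S.sample B) B T

lemma BlockState.sum_occ_mul_occ_le (T T' : P → V) :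
    ∑ σ ∈ S.samples, S.occ σ T * S.occ σ T' ≤ S.samples.card * (S.invWeight T *
      ∏ B ∈ S.blocks, ((m : ℝ) * agreeDensity (S.sample B) B T' +
        if ∀ i ∈ B, T' i = T i then 1 else 0)) := by
  unfold BlockState.occ BlockState.samples
  simp_rw [← Finset.prod_mul_distrib]
  rw [← Finset.prod_univ_sum (fun B : S.blocks => Fintype.piFinset fun _ : Fin m => S.sample B)
    (fun B τ => hits (B : Finset P) T τ * hits (B : Finset P) T' τ)]
  refine (Finset.prod_le_prod (fun B _ => Finset.sum_nonneg fun τ _ =>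
    mul_nonneg (hits_nonneg _ _ _) (hits_nonneg _ _ _)) fun (B : S.blocks) _ =>
    sum_hits_mul_hits_le (S.sample_nonempty B.2) m B T T').trans_eq ?_
  rw [Finset.prod_mul_distrib, Finset.prod_mul_distrib]
  rw [show (Fintype.piFinset fun B : S.blocks => Fintype.piFinset fun _ : Fin m => S.sample B) =
    S.samples from rfl, S.card_samples]
  congr 2
  · exact Finset.prod_coe_sort S.blocks fun B => (m : ℝ) * agreeDensity (S.sample B) B T
  · exact Finset.prod_coe_sort S.blocks fun B => ((m : ℝ) * agreeDensity (S.sample B) B T' +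
        if ∀ i ∈ B, T' i = T i then 1 else 0)

lemma BlockState.invWeight_pos (hy : 0 < y) (hm : 0 < m) (hM : 0 < M) {T : P → V}
    (hT : T ∈ S.fam) : 0 < S.invWeight T :=
  Finset.prod_pos fun _ hB => mul_pos (by exact_mod_cast hm) (agreeDensity_pos hy hm hM hT hB)

/-- The relation of sharing the value at a free position. -/
def BlockState.conflict (T T' : P → V) : Prop := ∃ z ∈ freePositions S.blocks, T' z = T z

instance : DecidableRel S.conflict := fun T T' => by
  unfold BlockState.conflict; infer_instance

/-- The conflicts of a good member have small weight. -/
lemma BlockState.sum_conflict_le (hy0 : 0 < y) (hy : 4 * (Fintype.card P : ℝ) ≤ y) (hm : 0 < m)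
    (hM : 0 < M) {T : P → V} (hT : T ∈ S.good) :
    ∑ T' ∈ S.good.filter (S.conflict T),
      (∏ B ∈ S.blocks, ((m : ℝ) * agreeDensity (S.sample B) B T' +
        if ∀ i ∈ B, T' i = T i then 1 else 0)) / S.invWeight T' ≤
      S.fam.card * (2 * Fintype.card P / (m * y)) := by
  have hm' : (0 : ℝ) < m := by exact_mod_cast hm
  have hTf : T ∈ S.fam := (Finset.mem_filter.1 hT).1
  set D : Finset P → ℝ := fun B => (m : ℝ) * agreeDensity (S.sample B) B T with hD
  have hDpos : ∀ B ∈ S.blocks, 0 < D B := fun B hB =>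
    mul_pos hm' (agreeDensity_pos hy0 hm hM hTf hB)
  have hterm : ∀ T' ∈ S.good.filter (S.conflict T),
      (∏ B ∈ S.blocks, ((m : ℝ) * agreeDensity (S.sample B) B T' +
        if ∀ i ∈ B, T' i = T i then 1 else 0)) / S.invWeight T' ≤
      ∑ z ∈ freePositions S.blocks, ∑ Q ∈ S.blocks.powerset,
        if ∀ i ∈ ({z} ∪ Q.biUnion id : Finset P), T' i = T i then 1 / ∏ B ∈ Q, D B else 0 := by
    intro T' hT'
    obtain ⟨hT'g, z, hz, hzz⟩ := Finset.mem_filter.1 hT'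
    have hT'f : T' ∈ S.fam := (Finset.mem_filter.1 hT'g).1
    have h1 : (∏ B ∈ S.blocks, ((m : ℝ) * agreeDensity (S.sample B) B T' +
        if ∀ i ∈ B, T' i = T i then 1 else 0)) / S.invWeight T' =
        ∑ Q ∈ S.blocks.powerset, ∏ B ∈ Q, if ∀ i ∈ B, T' i = T i then 1 / D B else 0 := by
      unfold BlockState.invWeight
      rw [← Finset.prod_div_distrib, ← Finset.prod_one_add]
      refine Finset.prod_congr rfl fun B hB => ?_
      have h2 : 0 < (m : ℝ) * agreeDensity (S.sample B) B T' :=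
        mul_pos hm' (agreeDensity_pos hy0 hm hM hT'f hB)
      rw [add_div, div_self h2.ne']
      by_cases h : ∀ i ∈ B, T' i = T i
      · rw [if_pos h, if_pos h, agreeDensity_congr h]
      · rw [if_neg h, if_neg h, zero_div]
    have h3 : ∀ Q ∈ S.blocks.powerset, (∏ B ∈ Q, if ∀ i ∈ B, T' i = T i then 1 / D B else 0) =
        if ∀ i ∈ ({z} ∪ Q.biUnion id : Finset P), T' i = T i then 1 / ∏ B ∈ Q, D B else 0 := by
      intro Q _
      by_cases h : ∀ i ∈ ({z} ∪ Q.biUnion id : Finset P), T' i = T i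
      · rw [if_pos h, one_div, ← Finset.prod_inv_distrib]
        refine Finset.prod_congr rfl fun B hB => ?_
        have hBi : ∀ i ∈ B, T' i = T i := fun i hi =>
          h i (Finset.mem_union_right _ (Finset.mem_biUnion.2 ⟨B, hB, hi⟩))
        rw [if_pos hBi, one_div]
      · rw [if_neg h]
        push Not at h
        obtain ⟨i, hi, hne⟩ := h
        rcases Finset.mem_union.1 hi with hi | hi
        · rw [Finset.mem_singleton] at hi
          exact absurd (hi ▸ hzz) hne
        · obtain ⟨B, hB, hiB⟩ := Finset.mem_biUnion.1 hi
          exact Finset.prod_eq_zero hB (if_neg fun h => hne (h i hiB))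
    rw [h1, Finset.sum_congr rfl h3]
    refine Finset.single_le_sum (f := fun z => ∑ Q ∈ S.blocks.powerset,
        if ∀ i ∈ ({z} ∪ Q.biUnion id : Finset P), T' i = T i then 1 / ∏ B ∈ Q, D B else 0) ?_ hz
    intro z' _
    refine Finset.sum_nonneg fun Q hQ => ?_
    split_ifs
    · exact one_div_nonneg.2 (Finset.prod_nonneg fun B hB =>
        (hDpos B (Finset.mem_powerset.1 hQ hB)).le)
    · exact le_rfl
  refine (Finset.sum_le_sum hterm).trans ?_
  rw [Finset.sum_comm]
  simp_rw [Finset.sum_comm (s := S.good.filter (S.conflict T))]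
  have h4 : ∀ z ∈ freePositions S.blocks, ∀ Q ∈ S.blocks.powerset,
      (∑ T' ∈ S.good.filter (S.conflict T),
        if ∀ i ∈ ({z} ∪ Q.biUnion id : Finset P), T' i = T i then 1 / ∏ B ∈ Q, D B else 0) ≤
      S.fam.card / m * (1 / y) ^ (Q.card + 1) := by
    intro z hz Q hQ
    -- Since `T` is good, few members agree with it on `z` and the blocks of `Q`. The factor `∏ D`
    -- in this bound cancels the denominator, leaving a geometric term in `|Q|`.
    have hnb := (Finset.mem_filter.1 hT).2 z hz Q hQ
    unfold BlockState.bad at hnb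
    rw [Finset.mem_filter, not_and, not_lt] at hnb
    have h5 := hnb hTf
    rw [Finset.card_singleton] at h5
    have hPD : 0 < ∏ B ∈ Q, D B :=
      Finset.prod_pos fun B hB => hDpos B (Finset.mem_powerset.1 hQ hB)
    rw [← Finset.sum_filter, Finset.sum_const, nsmul_eq_mul, mul_one_div, div_le_iff₀ hPD]
    have hfam : 0 < (S.fam.card : ℝ) := by exact_mod_cast S.fam_nonempty.card_pos
    have h6 : (((S.good.filter (S.conflict T)).filter
        fun T' => ∀ i ∈ ({z} ∪ Q.biUnion id : Finset P), T' i = T i).card : ℝ) ≤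
        S.fam.card * agreeDensity S.fam ({z} ∪ Q.biUnion id) T := by
      unfold agreeDensity
      rw [mul_div_cancel₀ _ hfam.ne']
      refine Nat.cast_le.2 (Finset.card_le_card fun A hA => ?_)
      rw [Finset.mem_filter, Finset.mem_filter] at hA
      exact mem_agreeing.2 ⟨(Finset.mem_filter.1 hA.1.1).1, hA.2⟩
    refine h6.trans ?_
    calc (S.fam.card : ℝ) * agreeDensity S.fam ({z} ∪ Q.biUnion id) T
        = S.fam.card / m * (1 / y) ^ (Q.card + 1) *
          (m * y ^ (Q.card + 1) * agreeDensity S.fam ({z} ∪ Q.biUnion id) T) := by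
          rw [one_div, inv_pow]; field_simp
      _ ≤ _ := by gcongr
  refine (Finset.sum_le_sum fun z hz => Finset.sum_le_sum fun Q hQ => h4 z hz Q hQ).trans ?_
  simp_rw [← Finset.mul_sum]
  have h7 := sum_powerset_inv_pow_le S hy0 hy
  calc _ ≤ (S.fam.card / m : ℝ) * (2 * Fintype.card P / y) := by gcongr
    _ = _ := by field_simp

end expectation

/-- A stable state with a free position yields a large subfamily whose members are disjoint on the
free positions and take the other positions to a small set. -/
lemma BlockState.Stable.exists_disjoint {S : BlockState F₀ roots m y Λ M} (hS : S.Stable)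
    (hy0 : 0 < y) (hy : 4 * (Fintype.card P : ℝ) ≤ y) (hm : 0 < m) (hM : 0 < M)
    (hfree : (freePositions S.blocks).Nonempty) :
    ∃ Z : Finset P, Z.Nonempty ∧ Disjoint Z roots ∧ ∃ H : Finset V, ∃ F ⊆ F₀,
      H.card ≤ Fintype.card P * m ∧ (m : ℝ) * y ≤ 200 * Fintype.card P * F.card ∧
      (∀ T ∈ F, ∀ v ∉ Z, T v ∈ H) ∧ (∀ T ∈ F, ∀ T' ∈ F, T ≠ T' → ∀ z ∈ Z, T z ≠ T' z) := by
  have hm' : (0 : ℝ) < m := by exact_mod_cast hm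
  have hp : (0 : ℝ) < Fintype.card P := by
    obtain ⟨z, -⟩ := hfree
    exact_mod_cast Fintype.card_pos_iff.2 ⟨z⟩
  have hfam : 0 < (S.fam.card : ℝ) := by exact_mod_cast S.fam_nonempty.card_pos
  have hgood := hS.card_good hy0 hy
  have hgf : ∀ T ∈ S.good, T ∈ S.fam := fun T hT => (Finset.mem_filter.1 hT).1
  have hN := S.card_samples_pos
  set N := (S.samples.card : ℝ) with hNdef
  set p := (Fintype.card P : ℝ) with hpdef
  -- Normalizing by `invWeight` makes every member contribute the same expected weight `1 / |fam|`,
  -- however likely it is to occur.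
  set w : (P → V) → ℝ := fun T => 1 / (S.fam.card * S.invWeight T) with hw
  have hwpos : ∀ T ∈ S.good, 0 < w T := fun T hT =>
    one_div_pos.2 (mul_pos hfam (S.invWeight_pos hy0 hm hM (hgf T hT)))
  set X : (S.blocks → Fin m → P → V) → ℝ := fun σ => ∑ T ∈ S.good, w T * S.occ σ T with hX
  set Y : (S.blocks → Fin m → P → V) → ℝ := fun σ =>
    ∑ T ∈ S.good, ∑ T' ∈ S.good.filter (S.conflict T), (w T * S.occ σ T) * (w T' * S.occ σ T')
    with hY
  have hEX : N * (1 / 2) ≤ ∑ σ ∈ S.samples, X σ := by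
    simp only [hX]
    rw [Finset.sum_comm]
    have h1 : ∀ T ∈ S.good, ∑ σ ∈ S.samples, w T * S.occ σ T = N * (1 / S.fam.card) := by
      intro T hT
      have := S.invWeight_pos hy0 hm hM (hgf T hT)
      rw [← Finset.mul_sum, S.sum_occ, ← hNdef]
      simp only [hw]
      field_simp
    rw [Finset.sum_congr rfl h1, Finset.sum_const, nsmul_eq_mul]
    calc N * (1 / 2) = N * (S.fam.card / 2 * (1 / S.fam.card)) := by field_simp
      _ ≤ N * (S.good.card * (1 / S.fam.card)) := by gcongr; linarith
      _ = _ := by ring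
  have hEY : ∑ σ ∈ S.samples, Y σ ≤ N * (2 * p / (m * y)) := by
    simp only [hY]
    rw [Finset.sum_comm]
    have h1 : ∀ T ∈ S.good, ∑ σ ∈ S.samples, ∑ T' ∈ S.good.filter (S.conflict T),
        (w T * S.occ σ T) * (w T' * S.occ σ T') ≤ N * (1 / S.fam.card * (2 * p / (m * y))) := by
      intro T hT
      have hWT := S.invWeight_pos hy0 hm hM (hgf T hT)
      rw [Finset.sum_comm]
      have h2 : ∀ T' ∈ S.good.filter (S.conflict T),
          ∑ σ ∈ S.samples, (w T * S.occ σ T) * (w T' * S.occ σ T') ≤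
          N / (S.fam.card * S.fam.card) * ((∏ B ∈ S.blocks,
            ((m : ℝ) * agreeDensity (S.sample B) B T' +
              if ∀ i ∈ B, T' i = T i then 1 else 0)) / S.invWeight T') := by
        intro T' hT'
        have hT'g := (Finset.mem_filter.1 hT').1
        have hWT' := S.invWeight_pos hy0 hm hM (hgf T' hT'g)
        calc _ = w T * w T' * ∑ σ ∈ S.samples, S.occ σ T * S.occ σ T' := by
              rw [Finset.mul_sum]
              exact Finset.sum_congr rfl fun σ _ => by ring
          _ ≤ w T * w T' * _ := mul_le_mul_of_nonneg_left (S.sum_occ_mul_occ_le T T')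
              (mul_nonneg (hwpos T hT).le (hwpos T' hT'g).le)
          _ = _ := by
              simp only [hw, ← hNdef]
              field_simp
      refine (Finset.sum_le_sum h2).trans ?_
      rw [← Finset.mul_sum]
      calc _ ≤ N / (S.fam.card * S.fam.card) * (S.fam.card * (2 * p / (m * y))) :=
            mul_le_mul_of_nonneg_left (S.sum_conflict_le hy0 hy hm hM hT) (by positivity)
        _ = _ := by field_simp
    refine (Finset.sum_le_sum h1).trans ?_
    rw [Finset.sum_const, nsmul_eq_mul]
    have h3 : (S.good.card : ℝ) ≤ S.fam.card :=
      Nat.cast_le.2 (Finset.card_le_card (Finset.filter_subset _ _))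
    calc _ ≤ (S.fam.card : ℝ) * (N * (1 / S.fam.card * (2 * p / (m * y)))) := by gcongr
      _ = _ := by field_simp
  -- This turns the bound on the mean of `Y` into `κ * E[Y] ≤ 1/8`. As `E[X] ≥ 1/2`, some choice of
  -- samples has `X - κ * Y ≥ 3/8`.
  set κ := m * y / (16 * p) with hκ
  have hκpos : 0 < κ := by positivity
  have hex : ∃ σ ∈ S.samples, 3 / 8 + κ * Y σ ≤ X σ := by
    by_contra hcon
    push Not at hcon
    have hne : S.samples.Nonempty := Finset.card_pos.1 (Nat.cast_pos.1 hN)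
    have h1 := Finset.sum_lt_sum_of_nonempty hne hcon
    rw [Finset.sum_add_distrib, Finset.sum_const, nsmul_eq_mul, ← Finset.mul_sum] at h1
    have h2 : κ * ∑ σ ∈ S.samples, Y σ ≤ N * (1 / 8) := by
      calc _ ≤ κ * (N * (2 * p / (m * y))) := by gcongr
        _ = _ := by rw [hκ]; field_simp; norm_num
    linarith
  obtain ⟨σ, hσ, hXY⟩ := hex
  have hocc : ∀ T, 0 ≤ S.occ σ T := fun T => Finset.prod_nonneg fun B _ => hits_nonneg _ _ _
  have hY0 : 0 ≤ Y σ := Finset.sum_nonneg fun T hT => Finset.sum_nonneg fun T' hT' =>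
    mul_nonneg (mul_nonneg (hwpos T hT).le (hocc T))
      (mul_nonneg (hwpos T' (Finset.mem_filter.1 hT').1).le (hocc T'))
  have hXpos : 0 < X σ := lt_of_lt_of_le (by positivity) hXY
  obtain ⟨F, hF, hFpos, hFind, hFcard⟩ := exists_independent S.good (fun T => w T * S.occ σ T)
    (fun T hT => mul_nonneg (hwpos T hT).le (hocc T)) S.conflict
    (fun T => ⟨hfree.choose, hfree.choose_spec, rfl⟩)
    (fun T T' => fun ⟨z, hz, h⟩ => ⟨z, hz, h.symm⟩) hXpos
  change X σ ^ 2 ≤ 4 * Y σ * F.card at hFcard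
  -- `H` consists of all values that the samples take on their own blocks. A member of positive
  -- weight has each of its block restrictions among the samples.
  refine ⟨freePositions S.blocks, hfree, ?_, (univ : Finset S.blocks).biUnion fun B =>
    (univ : Finset (Fin m)).biUnion fun l => (B : Finset P).image (σ B l), F,
    fun T hT => S.fam_subset (hgf T (hF hT)), ?_, ?_, ?_, ?_⟩
  · rw [Finset.disjoint_left]
    intro v hv hroot
    obtain ⟨B, hB, hvB⟩ := S.roots_covered v hroot
    exact mem_freePositions.1 hv B hB hvB
  · calc _ ≤ ∑ B : S.blocks, ∑ _l : Fin m, (B : Finset P).card := by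
          refine Finset.card_biUnion_le.trans (Finset.sum_le_sum fun B _ => ?_)
          exact Finset.card_biUnion_le.trans (Finset.sum_le_sum fun l _ => Finset.card_image_le)
      _ = (∑ B ∈ S.blocks, B.card) * m := by
          rw [← Finset.sum_coe_sort S.blocks, Finset.sum_mul]
          refine Finset.sum_congr rfl fun B _ => ?_
          rw [Finset.sum_const, Finset.card_univ, Fintype.card_fin, smul_eq_mul, mul_comm]
      _ ≤ _ := Nat.mul_le_mul_right _ S.sum_card_blocks_le
  · have hFc : (0 : ℝ) ≤ F.card := by positivity
    have h1 : κ * X σ ^ 2 ≤ 4 * X σ * F.card := by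
      calc κ * X σ ^ 2 ≤ κ * (4 * Y σ * F.card) := by gcongr
        _ = 4 * (κ * Y σ) * F.card := by ring
        _ ≤ 4 * X σ * F.card := by gcongr; linarith
    have h2 : κ * X σ ≤ 4 * F.card := by
      refine le_of_mul_le_mul_right ?_ hXpos
      linarith
    -- This means `|F| ≥ 3 m y / (512 p)`, and `512 / 3 < 200`.
    have h3 : κ * (3 / 8) ≤ 4 * F.card := by
      refine le_trans ?_ h2
      gcongr
      nlinarith
    have h4 : m * y = κ * (16 * p) := by rw [hκ]; field_simp
    rw [h4]
    nlinarith
  · intro T hT v hv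
    have hv' : ∃ B ∈ S.blocks, v ∈ B := by
      rw [mem_freePositions] at hv
      push Not at hv
      exact hv
    obtain ⟨B, hB, hvB⟩ := hv'
    have h1 : S.occ σ T ≠ 0 := by
      intro h0
      have := hFpos T hT
      rw [h0, mul_zero] at this
      exact lt_irrefl _ this
    have h2 := Finset.prod_ne_zero_iff.1 h1 ⟨B, hB⟩ (mem_univ _)
    obtain ⟨l, -, hl⟩ := Finset.exists_ne_zero_of_sum_ne_zero h2
    have hl' : ∀ i ∈ B, σ ⟨B, hB⟩ l i = T i := by
      by_contra hcon
      exact hl (if_neg hcon)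
    refine Finset.mem_biUnion.2 ⟨⟨B, hB⟩, mem_univ _, Finset.mem_biUnion.2 ⟨l, mem_univ _, ?_⟩⟩
    exact Finset.mem_image.2 ⟨v, hvB, hl' v hvB⟩
  · intro T hT T' hT' hne z hz heq
    exact hFind T hT T' hT' hne ⟨z, hz, heq.symm⟩

end SmallDense

/-! ### Counting tree homomorphisms and their edges -/

namespace SmallDense

set_option linter.unusedSectionVars false

open Finset

variable {V : Type*} [Fintype V] [DecidableEq V]

section trees

variable (G : SimpleGraph V) [DecidableRel G.Adj] (q : ℕ → ℕ)

/-- The homomorphisms to `G` from the tree on `0, …, e` in which `q i` is the parent of `i + 1`. -/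
def treeHoms (hq : ∀ i, q i ≤ i) (e : ℕ) : Finset (Fin (e + 1) → V) :=
  univ.filter fun T => ∀ i : Fin e,
    G.Adj (T ⟨q i, lt_of_le_of_lt (hq i) (by omega)⟩) (T i.succ)

variable {G q} (hq : ∀ i, q i ≤ i)

lemma mem_treeHoms {e : ℕ} {T : Fin (e + 1) → V} : T ∈ treeHoms G q hq e ↔ ∀ i : Fin e,
    G.Adj (T ⟨q i, lt_of_le_of_lt (hq i) (by omega)⟩) (T i.succ) := by
  simp [treeHoms]

lemma mem_treeHoms_succ {e : ℕ} {T : Fin (e + 2) → V} : T ∈ treeHoms G q hq (e + 1) ↔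
    Fin.init T ∈ treeHoms G q hq e ∧
      G.Adj (Fin.init T ⟨q e, lt_of_le_of_lt (hq e) (by omega)⟩) (T (Fin.last _)) := by
  rw [mem_treeHoms, mem_treeHoms]
  constructor
  · intro h
    exact ⟨fun i => h i.castSucc, h (Fin.last e)⟩
  · rintro ⟨h1, h2⟩ i
    refine Fin.lastCases ?_ (fun i => ?_) i
    · exact h2
    · exact h1 i

lemma eq_of_init_eq {e : ℕ} {T T' : Fin (e + 2) → V} (h : Fin.init T = Fin.init T')
    (h' : T (Fin.last _) = T' (Fin.last _)) : T = T' := by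
  rw [← Fin.snoc_init_self T, ← Fin.snoc_init_self T', h, h']

/-- At most `Δ ^ e` homomorphisms take a given value at a given position. -/
lemma card_treeHoms_apply_le {Δ : ℕ} (hΔ : ∀ v, G.degree v ≤ Δ) (e : ℕ) (a : Fin (e + 1)) (v : V) :
    ((treeHoms G q hq e).filter fun T => T a = v).card ≤ Δ ^ e := by
  induction e generalizing v with
  | zero =>
    rw [pow_zero, Finset.card_le_one]
    intro T hT T' hT'
    have h1 := (Finset.mem_filter.1 hT).2
    have h2 := (Finset.mem_filter.1 hT').2
    funext i
    rw [show i = a from Fin.ext (by omega), h1, h2]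
  | succ e ih =>
    rw [pow_succ]
    refine Fin.lastCases ?_ (fun a => ?_) a
    -- If the prescribed position is the last vertex, the value at its parent is one of at most `Δ`
    -- neighbours, and the induction hypothesis is used at the parent's position. Otherwise the last
    -- vertex is removed and has at most `Δ` choices.
    · calc _ ≤ ((G.neighborFinset v).sigma fun w => (treeHoms G q hq e).filter fun T =>
            T ⟨q e, lt_of_le_of_lt (hq e) (by omega)⟩ = w).card := by
            refine Finset.card_le_card_of_injOn (fun T =>
              ⟨Fin.init T ⟨q e, lt_of_le_of_lt (hq e) (by omega)⟩, Fin.init T⟩) ?_ ?_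
            · intro T hT
              obtain ⟨h1, h2⟩ := Finset.mem_filter.1 hT
              rw [mem_treeHoms_succ hq] at h1
              refine Finset.mem_sigma.2 ⟨?_, Finset.mem_filter.2 ⟨h1.1, rfl⟩⟩
              rw [SimpleGraph.mem_neighborFinset, ← h2]
              exact h1.2.symm
            · intro T hT T' hT' h
              have h1 := (Finset.mem_filter.1 hT).2
              have h2 := (Finset.mem_filter.1 hT').2
              simp only [Sigma.mk.injEq, heq_eq_eq] at h
              exact eq_of_init_eq h.2 (h1.trans h2.symm)
        _ = ∑ w ∈ G.neighborFinset v, ((treeHoms G q hq e).filter fun T =>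
            T ⟨q e, lt_of_le_of_lt (hq e) (by omega)⟩ = w).card := Finset.card_sigma _ _
        _ ≤ (G.neighborFinset v).card • Δ ^ e :=
            Finset.sum_le_card_nsmul _ _ _ fun w _ => ih _ w
        _ ≤ Δ ^ e * Δ := by
            rw [smul_eq_mul, mul_comm]
            exact Nat.mul_le_mul_left _ (hΔ v)
    · calc _ ≤ (((treeHoms G q hq e).filter fun T => T a = v).sigma fun T =>
            G.neighborFinset (T ⟨q e, lt_of_le_of_lt (hq e) (by omega)⟩)).card := by
            refine Finset.card_le_card_of_injOn (fun T => ⟨Fin.init T, T (Fin.last _)⟩) ?_ ?_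
            · intro T hT
              obtain ⟨h1, h2⟩ := Finset.mem_filter.1 hT
              rw [mem_treeHoms_succ hq] at h1
              refine Finset.mem_sigma.2 ⟨Finset.mem_filter.2 ⟨h1.1, h2⟩, ?_⟩
              rw [SimpleGraph.mem_neighborFinset]
              exact h1.2
            · intro T hT T' hT' h
              simp only [Sigma.mk.injEq, heq_eq_eq] at h
              exact eq_of_init_eq h.1 h.2
        _ = ∑ T ∈ (treeHoms G q hq e).filter fun T => T a = v,
            (G.neighborFinset (T ⟨q e, lt_of_le_of_lt (hq e) (by omega)⟩)).card :=
            Finset.card_sigma _ _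
        _ ≤ ((treeHoms G q hq e).filter fun T => T a = v).card • Δ :=
            Finset.sum_le_card_nsmul _ _ _ fun w _ => hΔ _
        _ ≤ Δ ^ e * Δ := by
            rw [smul_eq_mul]
            exact Nat.mul_le_mul_right _ (ih a v)

/-- The number of injective homomorphisms is at least `n * δ ^ e` if every vertex has at least
`δ + e` neighbours. -/
lemma le_card_injective_treeHoms {D δ : ℕ} (hD : ∀ v, D ≤ G.degree v) (e : ℕ) (hδ : δ + e ≤ D) :
    Fintype.card V * δ ^ e ≤
      ((treeHoms G q hq e).filter fun T => Function.Injective T).card := by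
  induction e with
  | zero =>
    rw [pow_zero, mul_one, ← Finset.card_univ]
    refine Finset.card_le_card_of_injOn (fun v _ => v) ?_ ?_
    · intro v _
      refine Finset.mem_filter.2 ⟨(mem_treeHoms hq).2 fun i => i.elim0, ?_⟩
      intro i j _
      exact Fin.ext (by omega)
    · intro v _ v' _ h
      exact congrFun h 0
  | succ e ih =>
    have ih' := ih (by omega)
    calc Fintype.card V * δ ^ (e + 1) = (Fintype.card V * δ ^ e) * δ := by ring
      _ ≤ ((treeHoms G q hq e).filter fun T => Function.Injective T).card • δ := by
          rw [smul_eq_mul]; exact Nat.mul_le_mul_right _ ih'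
      _ ≤ ∑ T ∈ (treeHoms G q hq e).filter fun T => Function.Injective T,
          (G.neighborFinset (T ⟨q e, lt_of_le_of_lt (hq e) (by omega)⟩) \ univ.image T).card := by
          refine Finset.card_nsmul_le_sum _ _ _ fun T _ => ?_
          have h1 := Finset.le_card_sdiff (univ.image T)
            (G.neighborFinset (T ⟨q e, lt_of_le_of_lt (hq e) (by omega)⟩))
          have h2 : (univ.image T).card ≤ e + 1 := Finset.card_image_le.trans (by simp)
          have h3 := hD (T ⟨q e, lt_of_le_of_lt (hq e) (by omega)⟩)
          rw [← SimpleGraph.card_neighborFinset_eq_degree] at h3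
          omega
      _ = (((treeHoms G q hq e).filter fun T => Function.Injective T).sigma fun T =>
          G.neighborFinset (T ⟨q e, lt_of_le_of_lt (hq e) (by omega)⟩) \ univ.image T).card :=
          (Finset.card_sigma _ _).symm
      _ ≤ _ := by
          refine Finset.card_le_card_of_injOn
            (fun x => (Fin.snoc (α := fun _ => V) x.1 x.2 : Fin (e + 2) → V)) ?_ ?_
          · rintro ⟨T, v⟩ hx
            obtain ⟨h1, h2⟩ := Finset.mem_sigma.1 hx
            obtain ⟨h1, h3⟩ := Finset.mem_filter.1 h1
            obtain ⟨h2, h4⟩ := Finset.mem_sdiff.1 h2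
            refine Finset.mem_filter.2 ⟨(mem_treeHoms_succ hq).2 ⟨?_, ?_⟩, ?_⟩
            · simpa using h1
            · simpa using h2
            · refine Fin.snoc_injective_iff.2 ⟨h3, ?_⟩
              simpa using h4
          · rintro ⟨T, v⟩ _ ⟨T', v'⟩ _ h
            have h1 := congrArg Fin.init h
            have h2 := congrFun h (Fin.last _)
            simp only [Fin.init_snoc, Fin.snoc_last] at h1 h2
            rw [h1, h2]

end trees

/-- Some colouring of the vertices by the positions is respected by many of the given injections. -/
lemma exists_colouring {P : Type*} [Fintype P] [DecidableEq P] [Nonempty P] (F : Finset (P → V))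
    (hF : ∀ T ∈ F, Function.Injective T) : ∃ c : V → P,
      F.card ≤ Fintype.card P ^ Fintype.card P * (F.filter fun T => ∀ i, c (T i) = i).card := by
  classical
  have hT : ∀ T ∈ F, Fintype.card (V → P) ≤
      Fintype.card P ^ Fintype.card P * (univ.filter fun c : V → P => ∀ i, c (T i) = i).card := by
    intro T hT
    have hinj := hF T hT
    rw [← Fintype.card_fun, ← Finset.card_univ, ← Finset.card_univ, mul_comm,
      ← Finset.card_product]
    -- A colouring is recovered from its values on the image of `T` together with the colouring
    -- corrected there to respect `T`. Hence a random colouring respects `T` with probability at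
    -- least `p ^ (-p)`, where `p` is the number of positions.
    refine Finset.card_le_card_of_injOn
      (fun c => (fun v => if h : ∃ i, T i = v then h.choose else c v, fun i => c (T i))) ?_ ?_
    · intro c _
      refine Finset.mem_product.2 ⟨Finset.mem_filter.2 ⟨mem_univ _, fun i => ?_⟩, mem_univ _⟩
      have h : ∃ j, T j = T i := ⟨i, rfl⟩
      simp only [dif_pos h]
      exact hinj h.choose_spec
    · intro c _ c' _ h
      obtain ⟨h1, h2⟩ := Prod.mk.inj h
      funext v
      by_cases hv : ∃ i, T i = v
      · obtain ⟨i, rfl⟩ := hv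
        exact congrFun h2 i
      · have := congrFun h1 v
        simpa [dif_neg hv] using this
  have hsum : F.card * Fintype.card (V → P) ≤ Fintype.card P ^ Fintype.card P *
      ∑ c : V → P, (F.filter fun T => ∀ i, c (T i) = i).card := by
    calc F.card * Fintype.card (V → P) = ∑ T ∈ F, Fintype.card (V → P) := by
          rw [Finset.sum_const, smul_eq_mul]
      _ ≤ ∑ T ∈ F, Fintype.card P ^ Fintype.card P *
          (univ.filter fun c : V → P => ∀ i, c (T i) = i).card := Finset.sum_le_sum hT
      _ = _ := by
          rw [← Finset.mul_sum]
          simp_rw [Finset.card_filter]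
          rw [Finset.sum_comm]
  by_contra hcon
  push Not at hcon
  have h1 : ∑ c : V → P, Fintype.card P ^ Fintype.card P *
      (F.filter fun T => ∀ i, c (T i) = i).card < ∑ _c : V → P, F.card :=
    Finset.sum_lt_sum_of_nonempty Finset.univ_nonempty fun c _ => hcon c
  rw [← Finset.mul_sum, Finset.sum_const, Finset.card_univ, smul_eq_mul, mul_comm _ F.card] at h1
  exact absurd hsum (not_le.2 h1)

/-- The number of ordered pairs of adjacent vertices in `R`. -/
def adjPairs (G : SimpleGraph V) [DecidableRel G.Adj] (R : Finset V) : ℕ :=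
  ((R ×ˢ R).filter fun x => G.Adj x.1 x.2).card

/-- The tree edges that touch `Z`, indexed by their later endpoint. -/
def touching {e : ℕ} (q : ℕ → ℕ) (hq : ∀ i, q i ≤ i) (Z : Finset (Fin (e + 1))) : Finset (Fin e) :=
  univ.filter fun i => (⟨q i, lt_of_le_of_lt (hq i) (by omega)⟩ : Fin (e + 1)) ∈ Z ∨ i.succ ∈ Z

/-- Coloured homomorphisms that are disjoint on `Z` have distinct edges touching `Z`. -/
lemma le_adjPairs {G : SimpleGraph V} [DecidableRel G.Adj] {q : ℕ → ℕ} (hq : ∀ i, q i ≤ i) {e : ℕ}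
    {F : Finset (Fin (e + 1) → V)} (hF : F ⊆ treeHoms G q hq e) (c : V → Fin (e + 1))
    (hc : ∀ T ∈ F, ∀ i, c (T i) = i) {Z : Finset (Fin (e + 1))}
    (hZ : ∀ T ∈ F, ∀ T' ∈ F, T ≠ T' → ∀ z ∈ Z, T z ≠ T' z) {R : Finset V}
    (hR : ∀ T ∈ F, ∀ i, T i ∈ R) :
    2 * (F.card * (touching q hq Z).card) ≤ adjPairs G R := by
  have h2 : 2 * (F.card * (touching q hq Z).card) =
      ((F ×ˢ touching q hq Z) ×ˢ (univ : Finset Bool)).card := by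
    rw [Finset.card_product, Finset.card_product, Finset.card_univ, Fintype.card_bool, mul_comm]
  rw [h2]
  -- The colour of the later endpoint identifies the tree edge. That edge has an endpoint in `Z`,
  -- where the value identifies the homomorphism.
  have hedge : ∀ T ∈ F, ∀ T' ∈ F, ∀ i ∈ touching q hq Z, ∀ i' : Fin e,
      T ⟨q i, lt_of_le_of_lt (hq i) (by omega)⟩ = T' ⟨q i', lt_of_le_of_lt (hq i') (by omega)⟩ →
      T i.succ = T' i'.succ → T = T' ∧ i = i' := by
    intro T hT T' hT' i hi i' h1 h2
    have h3 := congrArg c h2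
    rw [hc T hT, hc T' hT'] at h3
    obtain rfl := Fin.succ_injective _ h3
    refine ⟨?_, rfl⟩
    by_contra hne
    rcases (Finset.mem_filter.1 hi).2 with h | h
    · exact hZ T hT T' hT' hne _ h h1
    · exact hZ T hT T' hT' hne _ h h2
  -- Parents have smaller labels, so comparing colours excludes that two images coincide with
  -- opposite orientations. Both orientations of an edge can therefore be counted.
  have hcross : ∀ T ∈ F, ∀ T' ∈ F, ∀ i i' : Fin e,
      T ⟨q i, lt_of_le_of_lt (hq i) (by omega)⟩ = T' i'.succ →
      T i.succ = T' ⟨q i', lt_of_le_of_lt (hq i') (by omega)⟩ → False := by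
    intro T hT T' hT' i i' h1 h2
    have h3 := congrArg c h1
    have h4 := congrArg c h2
    rw [hc T hT, hc T' hT', Fin.ext_iff] at h3 h4
    simp only [Fin.val_succ] at h3 h4
    have := hq i
    have := hq i'
    omega
  refine Finset.card_le_card_of_injOn (fun x => if x.2 then
    (x.1.1 ⟨q x.1.2, lt_of_le_of_lt (hq x.1.2) (by omega)⟩, x.1.1 x.1.2.succ) else
    (x.1.1 x.1.2.succ, x.1.1 ⟨q x.1.2, lt_of_le_of_lt (hq x.1.2) (by omega)⟩)) ?_ ?_
  · rintro ⟨⟨T, i⟩, b⟩ hx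
    have hT : T ∈ F := (Finset.mem_product.1 (Finset.mem_product.1 hx).1).1
    have hadj := (mem_treeHoms hq).1 (hF hT) i
    rcases b with _ | _
    · exact Finset.mem_filter.2 ⟨Finset.mem_product.2 ⟨hR T hT _, hR T hT _⟩, hadj.symm⟩
    · exact Finset.mem_filter.2 ⟨Finset.mem_product.2 ⟨hR T hT _, hR T hT _⟩, hadj⟩
  · rintro ⟨⟨T, i⟩, b⟩ hx ⟨⟨T', i'⟩, b'⟩ hx' h
    obtain ⟨hT, hi⟩ := Finset.mem_product.1 (Finset.mem_product.1 hx).1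
    obtain ⟨hT', hi'⟩ := Finset.mem_product.1 (Finset.mem_product.1 hx').1
    rcases b with _ | _ <;> rcases b' with _ | _ <;>
      simp only [if_true, Bool.false_eq_true, if_false, Prod.mk.injEq] at h
    · obtain ⟨rfl, rfl⟩ := hedge T hT T' hT' i hi i' h.2 h.1
      rfl
    · exact (hcross T hT T' hT' i i' h.2 h.1).elim
    · exact (hcross T hT T' hT' i i' h.1 h.2).elim
    · obtain ⟨rfl, rfl⟩ := hedge T hT T' hT' i hi i' h.1 h.2
      rfl

end SmallDense

/-! ### Balanced caterpillars -/

namespace SmallDense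

set_option linter.unusedSectionVars false

open Finset

/-- The parent function of the caterpillar: a path on `0, …, k + 1`, followed by leaves, the
leaves being attached to `1, …, k` at rate `α`. -/
noncomputable def catParent (k : ℕ) (α : ℝ) (i : ℕ) : ℕ :=
  if i ≤ k then i else min k ⌈((i - k : ℕ) : ℝ) / α⌉₊

lemma catParent_le (k : ℕ) (α : ℝ) (i : ℕ) : catParent k α i ≤ i := by
  unfold catParent
  split_ifs with h
  · exact le_rfl
  · exact (min_le_left _ _).trans (by omega)

/-- The number of edges of the caterpillar. -/
noncomputable def catEdges (k : ℕ) (α : ℝ) : ℕ := k + 1 + ⌊k * α⌋₊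

/-- The ends of the path and the leaves. -/
noncomputable def catRoots (k : ℕ) (α : ℝ) : Finset (Fin (catEdges k α + 1)) :=
  univ.filter fun v => v.val = 0 ∨ k < v.val

lemma card_catRoots (k : ℕ) (α : ℝ) : (catRoots k α).card = ⌊k * α⌋₊ + 2 := by
  have h : (catRoots k α)ᶜ.card = k := by
    have hk : k < catEdges k α + 1 := by unfold catEdges; omega
    have : (catRoots k α)ᶜ.map Fin.valEmbedding = Finset.Icc 1 k := by
      ext i
      simp only [catRoots, Finset.mem_map, Finset.mem_compl, Finset.mem_filter, Finset.mem_univ,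
        true_and, not_or, not_lt, Fin.valEmbedding_apply, Finset.mem_Icc]
      constructor
      · rintro ⟨v, ⟨h1, h2⟩, rfl⟩
        omega
      · rintro ⟨h1, h2⟩
        exact ⟨⟨i, by omega⟩, ⟨by simp only; omega, h2⟩, rfl⟩
    rw [← Finset.card_map Fin.valEmbedding, this, Nat.card_Icc]
    omega
  have h2 := Finset.card_add_card_compl (catRoots k α)
  rw [h, Fintype.card_fin] at h2
  unfold catEdges at *
  omega

/-- The number of leaves attached to members of `Z`. -/
lemma le_card_leaves {k : ℕ} {α : ℝ} (hα : 0 < α) {Z : Finset ℕ} (hZ : ∀ z ∈ Z, 1 ≤ z ∧ z ≤ k) :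
    ∑ z ∈ Z, (⌊z * α⌋₊ - ⌊(z - 1 : ℕ) * α⌋₊) ≤
      ((range ⌊k * α⌋₊).filter fun j => catParent k α (k + 1 + j) ∈ Z).card := by
  -- Leaf `j`, counted from 0, hangs at `z` when `(z - 1) * α < j + 1 ≤ z * α`.
  have hmem : ∀ z ∈ Z, ∀ j ∈ Ico ⌊(z - 1 : ℕ) * α⌋₊ ⌊z * α⌋₊, catParent k α (k + 1 + j) = z := by
    intro z hz j hj
    obtain ⟨h1, h2⟩ := Finset.mem_Ico.1 hj
    obtain ⟨hz1, hzk⟩ := hZ z hz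
    have h3 : ((j + 1 : ℕ) : ℝ) ≤ z * α := by
      have := (Nat.le_floor_iff (by positivity)).1 (Nat.succ_le_of_lt h2)
      exact_mod_cast this
    have h4 : ((z - 1 : ℕ) : ℝ) * α < (j + 1 : ℕ) :=
      lt_of_lt_of_le (Nat.lt_floor_add_one _) (by exact_mod_cast Nat.succ_le_succ h1)
    have h5 : ⌈((j + 1 : ℕ) : ℝ) / α⌉₊ = z := by
      rw [Nat.ceil_eq_iff (by omega)]
      exact ⟨by rwa [lt_div_iff₀ hα], by rwa [div_le_iff₀ hα]⟩
    unfold catParent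
    rw [if_neg (by omega), show k + 1 + j - k = j + 1 by omega, h5]
    exact min_eq_right hzk
  have hdisj : ∀ z ∈ Z, ∀ z' ∈ Z, z ≠ z' → Disjoint (Ico ⌊(z - 1 : ℕ) * α⌋₊ ⌊z * α⌋₊)
      (Ico ⌊(z' - 1 : ℕ) * α⌋₊ ⌊z' * α⌋₊) := by
    intro z hz z' hz' hne
    rw [Finset.disjoint_left]
    intro j hj hj'
    exact hne ((hmem z hz j hj).symm.trans (hmem z' hz' j hj'))
  calc _ = (Z.biUnion fun z => Ico ⌊(z - 1 : ℕ) * α⌋₊ ⌊z * α⌋₊).card := by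
        rw [Finset.card_biUnion hdisj]
        simp
    _ ≤ _ := by
        refine Finset.card_le_card fun j hj => ?_
        obtain ⟨z, hz, hj⟩ := Finset.mem_biUnion.1 hj
        refine Finset.mem_filter.2 ⟨Finset.mem_range.2 ?_, ?_⟩
        · refine lt_of_lt_of_le (Finset.mem_Ico.1 hj).2 (Nat.floor_le_floor ?_)
          have : (z : ℝ) ≤ k := by exact_mod_cast (hZ z hz).2
          gcongr
        · rw [hmem z hz j hj]; exact hz

/-- Every set of inner path vertices touches at least `α + 1` edges per vertex. -/
lemma caterpillar_balanced_nat {k : ℕ} {α : ℝ} (hα : 0 < α) {Z : Finset ℕ}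
    (hZ : ∀ z ∈ Z, 1 ≤ z ∧ z ≤ k) :
    (α + 1) * (Z.card : ℝ) ≤ (((range (catEdges k α)).filter fun i =>
      catParent k α i ∈ Z ∨ i + 1 ∈ Z).card : ℝ) := by
  set χ : ℕ → ℝ := fun i => if i ∈ Z then 1 else 0 with hχ
  -- The fractional part of `i * α`: the vertex `z` carries `α - (f z - f (z - 1))` leaves, and this
  -- rounding error is paid for by path edges.
  set f : ℕ → ℝ := fun i => i * α - ⌊(i : ℝ) * α⌋₊ with hf
  have hf0 : ∀ i, 0 ≤ f i := fun i => sub_nonneg.2 (Nat.floor_le (by positivity))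
  have hf1 : ∀ i, f i ≤ 1 := fun i => by
    have := Nat.lt_floor_add_one ((i : ℝ) * α)
    simp only [hf]; linarith
  have hχ0 : χ 0 = 0 := if_neg fun h => by have := (hZ 0 h).1; omega
  have hχk : χ (k + 1) = 0 := if_neg fun h => by have := (hZ _ h).2; omega
  have hsub : Z ⊆ range (k + 2) := fun z hz => Finset.mem_range.2 (by have := (hZ z hz).2; omega)
  have hZsum : ∀ g : ℕ → ℝ, ∑ z ∈ Z, g z = ∑ i ∈ range (k + 2), χ i * g i := by
    intro g
    simp only [hχ, ite_mul, one_mul, zero_mul]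
    rw [Finset.sum_ite_mem, Finset.inter_eq_right.2 hsub]
  -- Summation by parts turns the left side into a sum over path edges of `f i * χ i + (1 - f i) * χ
  -- (i + 1)`. As `0 ≤ f i ≤ 1`, this is a convex combination, so it is at most the indicator that
  -- the edge touches `Z`. The boundary terms vanish because the path ends are not in `Z`.
  have hpath : (Z.card : ℝ) + ∑ z ∈ Z, (f z - f (z - 1)) ≤
      ∑ i ∈ range (k + 1), if catParent k α i ∈ Z ∨ i + 1 ∈ Z then (1 : ℝ) else 0 := by
    have h1 : (Z.card : ℝ) = ∑ i ∈ range (k + 1), χ (i + 1) := by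
      have := hZsum fun _ => 1
      rw [Finset.sum_const, nsmul_eq_mul, mul_one, Finset.sum_range_succ'] at this
      simpa [hχ0] using this
    have h2 : ∑ z ∈ Z, f z = ∑ i ∈ range (k + 1), χ i * f i := by
      rw [hZsum, Finset.sum_range_succ, hχk, zero_mul, add_zero]
    have h3 : ∑ z ∈ Z, f (z - 1) = ∑ i ∈ range (k + 1), χ (i + 1) * f i := by
      rw [hZsum (fun z => f (z - 1)), Finset.sum_range_succ', hχ0, zero_mul, add_zero]
      rfl
    rw [Finset.sum_sub_distrib, h1, h2, h3, ← Finset.sum_sub_distrib, ← Finset.sum_add_distrib]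
    refine Finset.sum_le_sum fun i hi => ?_
    have hik : catParent k α i = i := if_pos (by have := Finset.mem_range.1 hi; omega)
    rw [hik]
    have h4 := hf0 i
    have h5 := hf1 i
    by_cases ha : i ∈ Z <;> by_cases hb : i + 1 ∈ Z <;> simp only [hχ, ha, hb, if_true, if_false,
      or_true, true_or, or_self] <;> linarith
  have hleaf : α * Z.card - ∑ z ∈ Z, (f z - f (z - 1)) ≤
      (((range ⌊k * α⌋₊).filter fun j => catParent k α (k + 1 + j) ∈ Z).card : ℝ) := by
    have h1 : ((∑ z ∈ Z, (⌊z * α⌋₊ - ⌊(z - 1 : ℕ) * α⌋₊) : ℕ) : ℝ) ≤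
      (((range ⌊k * α⌋₊).filter fun j => catParent k α (k + 1 + j) ∈ Z).card : ℝ) :=
      Nat.cast_le.2 (le_card_leaves hα hZ)
    refine le_trans (le_of_eq ?_) h1
    rw [mul_comm, ← nsmul_eq_mul, ← Finset.sum_const, ← Finset.sum_sub_distrib]
    push_cast
    refine Finset.sum_congr rfl fun z hz => ?_
    have hz1 := (hZ z hz).1
    rw [Nat.cast_sub (Nat.floor_le_floor (by gcongr; omega))]
    simp only [hf]
    rw [Nat.cast_sub hz1]
    push_cast
    ring
  have hsplit : (((range (catEdges k α)).filter fun i =>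
      catParent k α i ∈ Z ∨ i + 1 ∈ Z).card : ℝ) =
      (∑ i ∈ range (k + 1), if catParent k α i ∈ Z ∨ i + 1 ∈ Z then (1 : ℝ) else 0) +
      (((range ⌊k * α⌋₊).filter fun j => catParent k α (k + 1 + j) ∈ Z).card : ℝ) := by
    unfold catEdges
    rw [Finset.card_filter, Finset.sum_range_add, Finset.card_filter]
    push_cast
    congr 1
    refine Finset.sum_congr rfl fun j _ => ?_
    have : k + 1 + j + 1 ∉ Z := fun h => by have := (hZ _ h).2; omega
    simp [this]
  rw [hsplit]
  linarith

lemma caterpillar_balanced {k : ℕ} {α : ℝ} (hα : 0 < α) {Z : Finset (Fin (catEdges k α + 1))}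
    (hZ : Disjoint Z (catRoots k α)) :
    (α + 1) * (Z.card : ℝ) ≤ (touching (catParent k α) (catParent_le k α) Z).card := by
  have h1 : ∀ z ∈ Z.map Fin.valEmbedding, 1 ≤ z ∧ z ≤ k := by
    intro z hz
    obtain ⟨v, hv, rfl⟩ := Finset.mem_map.1 hz
    have h2 := Finset.disjoint_left.1 hZ hv
    simp only [catRoots, Finset.mem_filter, Finset.mem_univ, true_and, not_or, not_lt] at h2
    simp only [Fin.valEmbedding_apply]
    omega
  have h2 := caterpillar_balanced_nat hα h1
  rw [Finset.card_map] at h2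
  refine h2.trans (Nat.cast_le.2 ?_)
  have hmem : ∀ v : Fin (catEdges k α + 1), v.val ∈ Z.map Fin.valEmbedding ↔ v ∈ Z := by
    intro v
    exact Finset.mem_map' Fin.valEmbedding
  calc _ ≤ ((touching (catParent k α) (catParent_le k α) Z).map Fin.valEmbedding).card := by
        refine Finset.card_le_card fun i hi => ?_
        obtain ⟨hi, h⟩ := Finset.mem_filter.1 hi
        rw [Finset.mem_range] at hi
        refine Finset.mem_map.2 ⟨⟨i, hi⟩, Finset.mem_filter.2 ⟨mem_univ _, ?_⟩, rfl⟩
        rw [← hmem, ← hmem]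
        exact h
    _ = _ := Finset.card_map _

end SmallDense

/-! ### From caterpillars to a small dense set -/

namespace SmallDense

set_option linter.unusedSectionVars false

open Finset

variable {V : Type*} [Fintype V] [DecidableEq V]

lemma card_adj_le {G : SimpleGraph V} [DecidableRel G.Adj] {Δ : ℕ} (hΔ : ∀ v, G.degree v ≤ Δ) :
    (univ.filter fun x : V × V => G.Adj x.1 x.2).card ≤ Fintype.card V * Δ := by
  calc _ = (univ.sigma fun v => G.neighborFinset v).card := by
        refine Finset.card_bij (fun x _ => ⟨x.1, x.2⟩) ?_ ?_ ?_
        · intro x hx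
          simpa using hx
        · rintro ⟨a, b⟩ _ ⟨a', b'⟩ _ h
          simpa using h
        · rintro ⟨a, b⟩ h
          exact ⟨(a, b), by simpa using h, rfl⟩
    _ = ∑ v, (G.neighborFinset v).card := Finset.card_sigma _ _
    _ ≤ (univ : Finset V).card • Δ := Finset.sum_le_card_nsmul _ _ _ fun v _ => hΔ v
    _ = _ := by rw [smul_eq_mul, Finset.card_univ]

/-- In a nearly regular graph with suitable parameters, caterpillars produce a small dense set. -/
theorem exists_dense_of_caterpillars (G : SimpleGraph V) [DecidableRel G.Adj] [Nonempty V]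
    {k : ℕ} (hk : 1 ≤ k) {α s : ℝ} (hα : 0 < α) (hs : 0 < s) (hαs : 2 * (α + 1) * k = s * (k + 1))
    {D Δ δ : ℕ} (hD : ∀ v, D ≤ G.degree v) (hΔ : ∀ v, G.degree v ≤ Δ) (hδ : 1 ≤ δ)
    {e : ℕ} (he : e = catEdges k α) (hδD : δ + e ≤ D) {m : ℕ} (hm : 0 < m) {p : ℕ} (hp : p = e + 1)
    {y Λ M : ℝ} (hy : y = 200 * (p : ℝ) ^ 3) (hM : y ^ (6 * p) < M)
    (hmM : (m : ℝ) * M * (p : ℝ) ^ p ≤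
      Fintype.card V * (δ : ℝ) ^ e * ((m : ℝ) / Fintype.card V) ^ (⌊k * α⌋₊ + 2))
    (hΛ : (Δ : ℝ) ^ e * (p : ℝ) ^ p / (δ : ℝ) ^ e * y ^ (3 * p) ≤ Λ)
    (hsmall : 2 * m * Δ * Λ ^ 2 < Fintype.card V) :
    ∃ R : Finset V, R.Nonempty ∧ R.card ≤ 2 * p ^ 3 * m ∧ s * R.card ≤ adjPairs G R := by
  classical
  have hkp : k ≤ p := by rw [hp, he]; unfold catEdges; omega
  have hp1 : 1 ≤ p := by omega
  have hp1' : (1 : ℝ) ≤ p := by exact_mod_cast hp1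
  have hP : Fintype.card (Fin (catEdges k α + 1)) = p := by rw [Fintype.card_fin, hp, he]
  have hq := catParent_le k α
  subst he
  set F₁ := (treeHoms G (catParent k α) hq (catEdges k α)).filter fun T => Function.Injective T
    with hF₁
  have hF₁card := le_card_injective_treeHoms (G := G) (q := catParent k α) hq hD _ hδD
  obtain ⟨c, hc⟩ := exists_colouring F₁ fun T hT => (Finset.mem_filter.1 hT).2
  set F₀ := F₁.filter fun T => ∀ i, c (T i) = i with hF₀
  rw [hP] at hc
  have hn : (0 : ℝ) < Fintype.card V := by exact_mod_cast Fintype.card_pos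
  have hδ' : (0 : ℝ) < δ := by exact_mod_cast hδ
  have hcard : (Fintype.card V : ℝ) * (δ : ℝ) ^ catEdges k α ≤ (p : ℝ) ^ p * F₀.card := by
    have hc' : F₁.card ≤ p ^ p * F₀.card := by
      rw [hF₀]
      convert hc
    have h := (Nat.cast_le (α := ℝ)).2 (hF₁card.trans hc')
    push_cast at h
    exact h
  have hpp : (0 : ℝ) < (p : ℝ) ^ p := by positivity
  have hF₀pos : (0 : ℝ) < F₀.card := by
    have : (0 : ℝ) < (p : ℝ) ^ p * F₀.card := lt_of_lt_of_le (by positivity) hcard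
    exact pos_of_mul_pos_right this hpp.le
  have hF₀ne : F₀.Nonempty := Finset.card_pos.1 (by exact_mod_cast hF₀pos)
  have hF₀sub : F₀ ⊆ treeHoms G (catParent k α) hq (catEdges k α) :=
    (Finset.filter_subset _ _).trans (Finset.filter_subset _ _)
  have hy200 : 200 ≤ y := by
    rw [hy]; nlinarith [one_le_pow₀ hp1' (n := 3)]
  have hy1 : 1 ≤ y := by linarith
  have hyp : 4 * (p : ℝ) ≤ y := by
    rw [hy]; nlinarith [one_le_pow₀ hp1' (n := 2), pow_succ (p : ℝ) 2]
  set Λ₀ := (Δ : ℝ) ^ catEdges k α * (p : ℝ) ^ p / (δ : ℝ) ^ catEdges k α with hΛ₀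
  have hδΔ : (δ : ℝ) ≤ Δ := by
    have := (hD (Classical.arbitrary V)).trans (hΔ _)
    exact_mod_cast (by omega : δ ≤ Δ)
  have hΛ₀1 : 1 ≤ Λ₀ := by
    rw [hΛ₀, le_div_iff₀ (by positivity), one_mul]
    exact (pow_le_pow_left₀ hδ'.le hδΔ _).trans
      (le_mul_of_one_le_right (by positivity) (one_le_pow₀ hp1'))
  have hspread : ∀ a : Fin (catEdges k α + 1), ∀ v : V,
      ((F₀.filter fun A => A a = v).card : ℝ) * Fintype.card V ≤ Λ₀ * F₀.card := by
    intro a v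
    have h1 : ((F₀.filter fun A => A a = v).card : ℝ) ≤ (Δ : ℝ) ^ catEdges k α := by
      exact_mod_cast (Finset.card_le_card (Finset.filter_subset_filter _ hF₀sub)).trans
        (card_treeHoms_apply_le hq hΔ _ a v)
    calc _ ≤ (Δ : ℝ) ^ catEdges k α * Fintype.card V := by gcongr
      _ = (Δ : ℝ) ^ catEdges k α / (δ : ℝ) ^ catEdges k α *
          (Fintype.card V * (δ : ℝ) ^ catEdges k α) := by field_simp
      _ ≤ (Δ : ℝ) ^ catEdges k α / (δ : ℝ) ^ catEdges k α * ((p : ℝ) ^ p * F₀.card) := by gcongr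
      _ = _ := by rw [hΛ₀]; ring
  have hM0 : 0 < M := lt_trans (by positivity) hM
  have hMF : (m : ℝ) * M ≤ F₀.card * ((m : ℝ) / Fintype.card V) ^ (catRoots k α).card := by
    rw [card_catRoots]
    refine le_of_mul_le_mul_right ?_ hpp
    calc _ ≤ _ := hmM
      _ ≤ ((p : ℝ) ^ p * F₀.card) * ((m : ℝ) / Fintype.card V) ^ (⌊k * α⌋₊ + 2) := by gcongr
      _ = _ := by ring
  obtain ⟨S, hS⟩ := exists_stable (F₀ := F₀) (roots := catRoots k α) (Λ := Λ) hy1 hm hM0 hF₀ne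
    hspread hΛ₀1 (by rw [hP]; exact hΛ) hMF
  have hΛ0 : 0 ≤ Λ := le_trans (by positivity) hΛ
  have hfree := hS.free_nonempty (by linarith) hm hΛ0 (by rw [hP]; exact hM)
    (fun a b => ∃ i : Fin (catEdges k α), a =
      ⟨catParent k α i, lt_of_le_of_lt (hq i) (by omega)⟩ ∧ b = i.succ) 0
    (by
      intro B hB0 hB
      -- The least position missing from `B` is not 0, and its parent has a smaller label, hence
      -- lies in `B`.
      have hex : ∃ b, ∃ h : b < catEdges k α + 1, (⟨b, h⟩ : Fin (catEdges k α + 1)) ∉ B := by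
        by_contra hcon
        push Not at hcon
        exact hB (Finset.eq_univ_iff_forall.2 fun v => hcon v.1 v.2)
      obtain ⟨hb, hbB⟩ := Nat.find_spec hex
      set b := Nat.find hex with hbdef
      have hb0 : b ≠ 0 := by
        intro h
        apply hbB
        have h0 : (⟨b, hb⟩ : Fin (catEdges k α + 1)) = 0 := Fin.ext h
        rw [h0]
        exact hB0
      have hmin : ∀ a (ha : a < b), (⟨a, by omega⟩ : Fin (catEdges k α + 1)) ∈ B := by
        intro a ha
        by_contra hcon
        exact Nat.find_min hex ha ⟨by omega, hcon⟩
      refine ⟨_, hmin (catParent k α (b - 1)) (lt_of_le_of_lt (hq _) (by omega)), _, hbB,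
        ⟨b - 1, by omega⟩, rfl, ?_⟩
      rw [Fin.ext_iff]
      simp only [Fin.val_succ]
      omega)
    (Ecard := Fintype.card V * Δ)
    (by
      rintro a b ⟨i, rfl, rfl⟩
      refine ⟨univ.filter fun x : V × V => G.Adj x.1 x.2, fun T hT => ?_, ?_⟩
      · exact Finset.mem_filter.2 ⟨mem_univ _, (mem_treeHoms hq).1 (hF₀sub hT) i⟩
      · exact_mod_cast card_adj_le hΔ)
    (by
      calc _ = (2 * m * Δ * Λ ^ 2) * Fintype.card V := by ring
        _ < Fintype.card V * Fintype.card V := by gcongr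
        _ = _ := by ring)
  obtain ⟨Z, hZne, hZroots, H, F, hFF₀, hHcard, hFcard, hFH, hFdisj⟩ :=
    hS.exists_disjoint (by linarith) (by rw [hP]; exact hyp) hm hM0 hfree
  rw [hP] at hHcard hFcard
  -- The value `y = 200 * p ^ 3` is chosen so that `m * y ≤ 200 * p * |F|` gives `|F| ≥ p ^ 2 * m`.
  -- Exactly `k * p * m` members are kept, to bound the size of `R`.
  have hfF : k * p * m ≤ F.card := by
    have h1 : (200 * (p : ℝ)) * (p ^ 2 * m) ≤ (200 * p) * F.card := by
      rw [hy] at hFcard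
      calc _ = (m : ℝ) * (200 * p ^ 3) := by ring
        _ ≤ _ := hFcard
    have h2 : (p : ℝ) ^ 2 * m ≤ F.card := le_of_mul_le_mul_left h1 (by positivity)
    have h3 : p ^ 2 * m ≤ F.card := by exact_mod_cast h2
    calc k * p * m ≤ p * p * m := by gcongr
      _ = p ^ 2 * m := by ring
      _ ≤ _ := h3
  obtain ⟨F', hF'F, hF'card⟩ := Finset.exists_subset_card_eq hfF
  set R := H ∪ F'.biUnion fun T => Z.image T with hR
  have hRmem : ∀ T ∈ F', ∀ i, T i ∈ R := by
    intro T hT i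
    by_cases hi : i ∈ Z
    · exact Finset.mem_union_right _
        (Finset.mem_biUnion.2 ⟨T, hT, Finset.mem_image_of_mem _ hi⟩)
    · exact Finset.mem_union_left _ (hFH T (hF'F hT) i hi)
  have hpairs := le_adjPairs hq (F := F') (fun T hT => hF₀sub (hFF₀ (hF'F hT))) c
    (fun T hT => (Finset.mem_filter.1 (hFF₀ (hF'F hT))).2)
    (fun T hT T' hT' => hFdisj T (hF'F hT) T' (hF'F hT')) hRmem
  have hRcard : R.card ≤ p * m + k * p * m * Z.card := by
    refine (Finset.card_union_le _ _).trans (add_le_add hHcard ?_)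
    refine Finset.card_biUnion_le.trans ?_
    rw [← hF'card, ← smul_eq_mul]
    exact Finset.sum_le_card_nsmul _ _ _ fun T _ => Finset.card_image_le
  have hZp : Z.card ≤ p := by rw [← hP]; exact Finset.card_le_univ _
  have hF'ne : F'.Nonempty := Finset.card_pos.1 (by rw [hF'card]; positivity)
  refine ⟨R, ?_, ?_, ?_⟩
  · obtain ⟨T, hT⟩ := hF'ne
    exact ⟨_, hRmem T hT 0⟩
  · refine hRcard.trans ?_
    have h1 : p * m ≤ p ^ 3 * m := Nat.mul_le_mul_right _ (Nat.le_self_pow (by norm_num) p)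
    have h2 : k * p * m * Z.card ≤ p * p * m * p := by gcongr
    calc _ ≤ p ^ 3 * m + p * p * m * p := add_le_add h1 h2
      _ = _ := by ring
  · have hbal := caterpillar_balanced hα hZroots
    have hZ1 : (1 : ℝ) ≤ Z.card := by exact_mod_cast hZne.card_pos
    have h1 : (2 : ℝ) * ((k * p * m) * (touching (catParent k α) hq Z).card) ≤ adjPairs G R := by
      rw [hF'card] at hpairs
      exact_mod_cast hpairs
    have h2 : (R.card : ℝ) ≤ p * m + k * p * m * Z.card := by exact_mod_cast hRcard
    -- The common part `p * m` is a `1 / k` fraction of the `k * p * m` private copies of even a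
    -- single position. This turns the ratio `2 * (α + 1)` into `s = 2 * (α + 1) * k / (k + 1)`.
    calc s * R.card ≤ s * (p * m + k * p * m * Z.card) := by gcongr
      _ ≤ s * (p * m * Z.card + k * p * m * Z.card) := by
          exact mul_le_mul_of_nonneg_left
            (add_le_add (le_mul_of_one_le_right (by positivity) hZ1) le_rfl) hs.le
      _ = (s * (k + 1)) * (p * m * Z.card) := by ring
      _ = (2 * (α + 1) * k) * (p * m * Z.card) := by rw [hαs]
      _ = 2 * ((k * p * m) * ((α + 1) * Z.card)) := by ring
      _ ≤ 2 * ((k * p * m) * (touching (catParent k α) hq Z).card) := by gcongr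
      _ ≤ _ := h1

end SmallDense

/-! ### Choice of parameters in the nearly regular case -/

namespace SmallDense

set_option linter.unusedSectionVars false

open Finset Filter

variable {V : Type*} [Fintype V] [DecidableEq V]

set_option maxHeartbeats 1000000 in
/-- Caterpillars with `k` inner vertices in a nearly regular graph whose degrees are about `exp ℓ`,
where `ℓ = exp t`. -/
lemma exists_dense_of_log (G : SimpleGraph V) [DecidableRel G.Adj] [Nonempty V]
    {s c K ε C ℓ t : ℝ} {k : ℕ} (hs : 2 < s) (hc : c * (s / 2 - 1) = 1) (hK : 1 ≤ K) (hε : 0 < ε)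
    (hC : C = 2 * c / ε * (27 * (s + 2) * ε + c * (s / 2 + 1)))
    (hℓt : ℓ = Real.exp t) (hk : 1 ≤ k) (hkt : k * t ≤ ε * ℓ) (hkt' : ε * ℓ / 2 ≤ k * t)
    (ht : 0 < t) (hεt : (s + 2) * ε ≤ t) (hℓ : 200 ≤ ℓ) (hℓK : 2 * K ≤ ℓ)
    (hℓexp : 2 * ℓ ≤ Real.exp ℓ)
    (hlarge : Real.log (4 * K) + C * t + 28 * (s + 2) * (ε * ℓ) < c * ℓ)
    (hD : ∀ v, Real.exp ℓ ≤ G.degree v) (hΔ : ∀ v, (G.degree v : ℝ) ≤ K * Real.exp ℓ)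
    (hn : Real.exp ((1 + c) * ℓ) ≤ Fintype.card V) :
    ∃ R : Finset V, R.Nonempty ∧
      (R.card : ℝ) ≤ Fintype.card V * Real.exp (-((1 + c) * ℓ)) * Real.exp ((C + 4) * t) ∧
      s * R.card ≤ adjPairs G R := by
  have hc0 : 0 < c := by
    by_contra hcon
    nlinarith
  have hC0 : 0 ≤ C := by rw [hC]; positivity
  have hℓ0 : 0 < ℓ := by linarith
  have hk' : (1 : ℝ) ≤ k := by exact_mod_cast hk
  -- The solution of `2 * (α + 1) * k = s * (k + 1)`.
  set α : ℝ := s / 2 - 1 + s / (2 * k) with hα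
  have hkα : k * α = k * (s / 2 - 1) + s / 2 := by rw [hα]; field_simp
  have hα0 : 0 < α := by
    have : 0 < s / (2 * k) := by positivity
    rw [hα]; linarith
  set b := ⌊k * α⌋₊ with hb
  have hb1 : (b : ℝ) ≤ k * α := Nat.floor_le (by positivity)
  have hb2 : k * α < b + 1 := Nat.lt_floor_add_one _
  set e := catEdges k α with he
  have heb : e = k + 1 + b := rfl
  set p := e + 1 with hp
  have hpR : (p : ℝ) = k + 2 + b := by rw [hp, heb]; push_cast; ring
  have hpk : (p : ℝ) ≤ (s + 2) * k := by rw [hpR]; nlinarith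
  have hpt : p * t ≤ (s + 2) * (ε * ℓ) := by
    calc p * t ≤ (s + 2) * k * t := by gcongr
      _ = (s + 2) * (k * t) := by ring
      _ ≤ _ := by gcongr
  have hpℓ : (p : ℝ) ≤ ℓ := by
    have : p * t ≤ ℓ * t := hpt.trans (by nlinarith)
    exact le_of_mul_le_mul_right this ht
  have hp1 : (1 : ℝ) ≤ p := by rw [hpR]; nlinarith [Nat.cast_nonneg (α := ℝ) b]
  have hep : (e : ℝ) ≤ p := by rw [hp]; push_cast; linarith
  have hepN : e ≤ p := by omega
  set L := Real.exp ℓ with hL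
  have hL0 : 0 < L := Real.exp_pos _
  set D := ⌈L⌉₊ with hDdef
  have hDL : L ≤ D := Nat.le_ceil _
  have heD : e < D := by
    have : (e : ℝ) < D := by linarith
    exact_mod_cast this
  set δ := D - e with hδ
  have hδe : δ + e = D := by omega
  have hδL : L / 2 ≤ δ := by
    have : (δ : ℝ) + e = D := by exact_mod_cast hδe
    linarith
  have hδ0 : (0 : ℝ) < δ := by linarith
  set Δ := ⌊K * L⌋₊ with hΔdef
  have hΔL : (Δ : ℝ) ≤ K * L := Nat.floor_le (by positivity)
  set N : ℝ := (Fintype.card V : ℝ) with hN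
  have hN0 : 0 < N := by rw [hN]; exact_mod_cast Fintype.card_pos
  set x := N * Real.exp (-((1 + c) * ℓ)) with hx
  have hx1 : 1 ≤ x := by
    rw [hx, Real.exp_neg, ← div_eq_mul_inv, le_div_iff₀ (Real.exp_pos _)]
    linarith
  have hNx : N = x * Real.exp ((1 + c) * ℓ) := by
    rw [hx, mul_assoc, ← Real.exp_add]
    simp
  set B := Real.exp (C * t) with hB
  have hB1 : 1 ≤ B := Real.one_le_exp (by positivity)
  have hxB : 1 ≤ x * B := one_le_mul_of_one_le_of_one_le hx1 hB1
  set m := ⌈x * B⌉₊ with hm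
  have hm1 : x * B ≤ m := Nat.le_ceil _
  have hm2 : (m : ℝ) ≤ 2 * (x * B) := by
    have := Nat.ceil_lt_add_one (by positivity : 0 ≤ x * B)
    rw [hm]; linarith
  have hm0 : (0 : ℝ) < m := by linarith
  have hℓpow : ∀ j : ℕ, ℓ ^ (j * p) = Real.exp (j * (p * t)) := by
    intro j
    rw [hℓt, ← Real.exp_nat_mul]
    push_cast
    ring_nf
  have hℓ1 : 1 ≤ ℓ := by linarith
  set y := 200 * (p : ℝ) ^ 3 with hy
  have hy0 : 0 ≤ y := by positivity
  have hyℓ : y ≤ ℓ ^ 4 := by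
    calc y ≤ ℓ * ℓ ^ 3 := by rw [hy]; gcongr
      _ = ℓ ^ 4 := by ring
  have hpp : (p : ℝ) ^ p ≤ ℓ ^ p := by gcongr
  -- All losses are absorbed into powers of `ℓ ≥ p`. From `y ≤ ℓ ^ 4` one gets `y ^ (6 * p) ≤ ℓ ^
  -- (24 * p) < M`, and `Λ` pays `ℓ ^ p` for the degree ratio, `ℓ ^ p` for the colouring and `ℓ ^
  -- (12 * p)` for `y ^ (3 * p)`.
  obtain ⟨R, hR, hRcard, hRadj⟩ := exists_dense_of_caterpillars G hk (α := α) (s := s) hα0 (by linarith)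
    (by rw [hα]; field_simp; ring) (D := D) (Δ := Δ) (δ := δ)
    (fun v => Nat.ceil_le.2 (hD v)) (fun v => Nat.le_floor (hΔ v))
    (by exact_mod_cast hδ0) he hδe.le (m := m) (by exact_mod_cast hm0) hp hy (M := ℓ ^ (25 * p))
    (Λ := ℓ ^ (14 * p))
    (by
      calc y ^ (6 * p) ≤ (ℓ ^ 4) ^ (6 * p) := by gcongr
        _ = ℓ ^ (24 * p) := by rw [← pow_mul]; ring_nf
        _ < ℓ ^ (25 * p) := pow_lt_pow_right₀ (by linarith) (by omega))
    (by
      have h1 : L ^ e * Real.exp ((b + 1) * (C * t - (1 + c) * ℓ)) =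
          Real.exp (e * ℓ + (b + 1) * (C * t - (1 + c) * ℓ)) := by
        rw [hL, ← Real.exp_nat_mul, ← Real.exp_add]
      -- The exponent on the right is `(k - c * (b + 1)) * ℓ + (b + 1) * C * t`. Since `c * k * α =
      -- k + c * s / 2`, the first term is at least `-c * (s / 2 + 1) * ℓ`. As `b + 1 ≥ k / c` and
      -- `k * t ≥ ε * ℓ / 2`, the second term repays this deficit and the `27 * p * t`; this
      -- determines `C`.
      have h2 : Real.exp (27 * (p * t)) ≤
          Real.exp (e * ℓ + (b + 1) * (C * t - (1 + c) * ℓ)) := by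
        apply Real.exp_le_exp.2
        have hck : c * (k * α) = k + c * (s / 2) := by rw [hkα]; linear_combination k * hc
        have hcb1 : c * b ≤ c * (k * α) := by gcongr
        have hcb2 : c * (k * α) ≤ c * (b + 1) := by gcongr
        have hcs : 0 ≤ c * (s / 2) := by positivity
        have h3 : -(c * (s / 2 + 1)) ≤ (k : ℝ) - c * (b + 1) := by linarith
        have h4 : (k : ℝ) ≤ c * (b + 1) := by linarith
        have h5 : 27 * (s + 2) * (ε * ℓ) + c * (s / 2 + 1) * ℓ ≤ (b + 1) * (C * t) := by
          calc 27 * (s + 2) * (ε * ℓ) + c * (s / 2 + 1) * ℓ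
              = C / c * (ε * ℓ / 2) := by rw [hC]; field_simp
            _ ≤ C / c * (k * t) := by gcongr
            _ ≤ C / c * (c * (b + 1) * t) := by gcongr
            _ = _ := by field_simp
        have h6 : (e : ℝ) = k + 1 + b := by rw [heb]; push_cast; ring
        have h7 := mul_le_mul_of_nonneg_right h3 hℓ0.le
        rw [h6]
        linarith
      have h7 : B * Real.exp (-((1 + c) * ℓ)) ≤ m / N := by
        rw [le_div_iff₀ hN0]
        calc _ = x * B := by rw [hx]; ring
          _ ≤ _ := hm1
      have h8 : (B * Real.exp (-((1 + c) * ℓ))) ^ (b + 1) =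
          Real.exp ((b + 1) * (C * t - (1 + c) * ℓ)) := by
        rw [hB, ← Real.exp_add, ← Real.exp_nat_mul]
        push_cast
        ring_nf
      have h9 : ℓ ^ (25 * p) * (p : ℝ) ^ p ≤ (δ : ℝ) ^ e * (m / N) ^ (b + 1) := by
        -- The factor `2 ^ e` comes from `δ ≥ L / 2`, the degree left after reserving `e` neighbours
        -- for injectivity. Together with `M` and the colouring it gives the exponent 27.
        have h2e : (2 : ℝ) ^ e ≤ ℓ ^ p :=
          (pow_le_pow_left₀ (by norm_num) (by linarith) e).trans (pow_le_pow_right₀ hℓ1 hepN)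
        refine le_of_mul_le_mul_left ?_ (by positivity : (0 : ℝ) < 2 ^ e)
        calc 2 ^ e * (ℓ ^ (25 * p) * (p : ℝ) ^ p) ≤ ℓ ^ p * (ℓ ^ (25 * p) * ℓ ^ p) := by gcongr
          _ = ℓ ^ (27 * p) := by rw [← pow_add, ← pow_add]; ring_nf
          _ = Real.exp (27 * (p * t)) := by rw [hℓpow]; norm_num
          _ ≤ _ := h2
          _ = L ^ e * (B * Real.exp (-((1 + c) * ℓ))) ^ (b + 1) := by rw [h8, h1]
          _ ≤ (2 * δ) ^ e * (m / N) ^ (b + 1) := by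
              have : L ≤ 2 * δ := by linarith
              gcongr
          _ = _ := by rw [mul_pow]; ring
      calc (m : ℝ) * ℓ ^ (25 * p) * (p : ℝ) ^ p = m * (ℓ ^ (25 * p) * (p : ℝ) ^ p) := by ring
        _ ≤ m * ((δ : ℝ) ^ e * (m / N) ^ (b + 1)) := by gcongr
        _ = N * (δ : ℝ) ^ e * (m / N) ^ (b + 2) := by
            rw [pow_succ _ (b + 1)]; field_simp)
    (by
      have h1 : (Δ : ℝ) ^ e ≤ ℓ ^ p * (δ : ℝ) ^ e := by
        calc (Δ : ℝ) ^ e ≤ (ℓ * δ) ^ e := by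
              gcongr
              calc (Δ : ℝ) ≤ K * L := hΔL
                _ ≤ K * (2 * δ) := by gcongr; linarith
                _ = (2 * K) * δ := by ring
                _ ≤ _ := by gcongr
          _ = ℓ ^ e * (δ : ℝ) ^ e := mul_pow _ _ _
          _ ≤ _ := by gcongr
      calc (Δ : ℝ) ^ e * (p : ℝ) ^ p / (δ : ℝ) ^ e * y ^ (3 * p)
          ≤ (ℓ ^ p * (δ : ℝ) ^ e) * ℓ ^ p / (δ : ℝ) ^ e * (ℓ ^ 4) ^ (3 * p) := by gcongr
        _ = ℓ ^ p * ℓ ^ p * (ℓ ^ 4) ^ (3 * p) := by field_simp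
        _ = ℓ ^ (14 * p) := by rw [← pow_mul, ← pow_add, ← pow_add]; ring_nf)
    (by
      have h1 : 4 * K * B * Real.exp (28 * (p * t)) < Real.exp (c * ℓ) := by
        rw [← Real.exp_log (by positivity : (0 : ℝ) < 4 * K), hB, ← Real.exp_add, ← Real.exp_add]
        apply Real.exp_lt_exp.2
        linarith
      have h2 : (ℓ ^ (14 * p)) ^ 2 = Real.exp (28 * (p * t)) := by
        rw [← pow_mul, show 14 * p * 2 = 28 * p by ring, hℓpow]
        norm_num
      change 2 * (m : ℝ) * Δ * (ℓ ^ (14 * p)) ^ 2 < N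
      rw [h2]
      calc 2 * (m : ℝ) * Δ * Real.exp (28 * (p * t))
          ≤ 2 * (2 * (x * B)) * (K * L) * Real.exp (28 * (p * t)) := by gcongr
        _ = x * L * (4 * K * B * Real.exp (28 * (p * t))) := by ring
        _ < x * L * Real.exp (c * ℓ) := by gcongr
        _ = N := by
            rw [hNx, hL, mul_assoc, ← Real.exp_add]
            ring_nf)
  refine ⟨R, hR, ?_, hRadj⟩
  have h1 : (R.card : ℝ) ≤ 2 * p ^ 3 * m := by exact_mod_cast hRcard
  calc (R.card : ℝ) ≤ 2 * p ^ 3 * m := h1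
    _ ≤ 2 * ℓ ^ 3 * (2 * (x * B)) := by gcongr
    _ = 4 * ℓ ^ 3 * x * B := by ring
    _ ≤ ℓ * ℓ ^ 3 * x * B := by gcongr; linarith
    _ = x * (ℓ ^ 4 * B) := by ring
    _ = _ := by
        rw [hB, hℓt, ← Real.exp_nat_mul, ← Real.exp_add]
        congr 2
        push_cast
        ring

end SmallDense

namespace SmallDense

set_option linter.unusedSectionVars false

open Finset Filter

/-- The theorem for nearly regular graphs. -/
theorem exists_dense_of_nearly_regular {s K : ℝ} (hs : 2 < s) (hK : 1 ≤ K) :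
    ∃ C : ℝ, 0 ≤ C ∧ ∀ᶠ δ : ℝ in atTop, ∀ (V : Type*) [Fintype V] [Nonempty V] [DecidableEq V]
      (G : SimpleGraph V) [DecidableRel G.Adj], (∀ v, δ ≤ G.degree v) →
      (∀ v, (G.degree v : ℝ) ≤ K * δ) → δ ^ (s / (s - 2)) ≤ Fintype.card V →
      ∃ R : Finset V, R.Nonempty ∧
        (R.card : ℝ) ≤ Fintype.card V * δ ^ (-(s / (s - 2))) * Real.log δ ^ C ∧
        s * R.card ≤ adjPairs G R := by
  have hs2 : 0 < s - 2 := by linarith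
  set c := 2 / (s - 2) with hc
  have hc0 : 0 < c := by positivity
  have hc1 : s / (s - 2) = 1 + c := by rw [hc]; field_simp; ring
  have hcs : c * (s / 2 - 1) = 1 := by rw [hc]; field_simp
  -- Then `28 * (s + 2) * ε = c / 2`: the loss `Λ ^ 2` uses only half of the sparsity margin `exp (c
  -- * ℓ)`.
  set ε := c / (56 * (s + 2)) with hε
  have hε0 : 0 < ε := by positivity
  set C := 2 * c / ε * (27 * (s + 2) * ε + c * (s / 2 + 1)) with hC
  have hC0 : 0 ≤ C := by positivity
  refine ⟨C + 4, by positivity, ?_⟩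
  have hlog := Real.tendsto_log_atTop
  have e1 : ∀ᶠ ℓ : ℝ in atTop, Real.log ℓ ≤ ε / 2 * ℓ :=
    (Real.isLittleO_log_id_atTop.bound (by positivity : 0 < ε / 2)).mp
      ((eventually_ge_atTop 1).mono fun ℓ h1 h => by
        rw [Real.norm_of_nonneg (Real.log_nonneg h1), id, Real.norm_of_nonneg (by linarith)] at h
        exact h)
  have e2 : ∀ᶠ ℓ : ℝ in atTop, Real.log (4 * K) + C * Real.log ℓ < c / 2 * ℓ := by
    have h : ∀ᶠ ℓ : ℝ in atTop, Real.log ℓ ≤ c / (4 * (C + 1)) * ℓ :=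
      (Real.isLittleO_log_id_atTop.bound (by positivity : 0 < c / (4 * (C + 1)))).mp
        ((eventually_ge_atTop 1).mono fun ℓ h1 h => by
          rw [Real.norm_of_nonneg (Real.log_nonneg h1), id, Real.norm_of_nonneg (by linarith)] at h
          exact h)
    filter_upwards [h, eventually_gt_atTop (4 * Real.log (4 * K) / c), eventually_ge_atTop 1]
      with ℓ h1 h2 h3
    rw [div_lt_iff₀ hc0] at h2
    have h4 := Real.log_nonneg h3
    have h5 : C * Real.log ℓ ≤ c / 4 * ℓ := by
      calc C * Real.log ℓ ≤ (C + 1) * Real.log ℓ := by gcongr; linarith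
        _ ≤ (C + 1) * (c / (4 * (C + 1)) * ℓ) := by gcongr
        _ = _ := by field_simp
    linarith
  have e3 : ∀ᶠ ℓ : ℝ in atTop, 2 * ℓ ≤ Real.exp ℓ := by
    filter_upwards [(Real.tendsto_exp_div_pow_atTop 1).eventually_ge_atTop 2,
      eventually_gt_atTop 0] with ℓ h1 h2
    rwa [pow_one, le_div_iff₀ h2] at h1
  have key : ∀ᶠ δ : ℝ in atTop, 0 < δ ∧ 1 ≤ Real.log (Real.log δ) ∧
      (s + 2) * ε ≤ Real.log (Real.log δ) ∧ 200 ≤ Real.log δ ∧ 2 * K ≤ Real.log δ ∧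
      Real.log (Real.log δ) ≤ ε / 2 * Real.log δ ∧
      Real.log (4 * K) + C * Real.log (Real.log δ) < c / 2 * Real.log δ ∧
      2 * Real.log δ ≤ Real.exp (Real.log δ) := by
    refine (eventually_gt_atTop 0).and <|
      ((hlog.comp hlog).eventually_ge_atTop _).and <|
      ((hlog.comp hlog).eventually_ge_atTop _).and <|
      (hlog.eventually_ge_atTop _).and <| (hlog.eventually_ge_atTop _).and <|
      (hlog.eventually e1).and <| (hlog.eventually e2).and (hlog.eventually e3)
  filter_upwards [key] with δ ⟨hδ, h1, h2, h3, h4, h5, h6, h7⟩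
  intro V _ _ _ G _ hD hΔ hn
  set ℓ := Real.log δ with hℓ
  set t := Real.log ℓ with ht
  have hℓ0 : 0 < ℓ := by linarith
  have ht0 : 0 < t := by linarith
  have hδℓ : Real.exp ℓ = δ := Real.exp_log hδ
  set k := ⌊ε * ℓ / t⌋₊ with hk
  have hk1 : (k : ℝ) ≤ ε * ℓ / t := Nat.floor_le (by positivity)
  have hk2 : ε * ℓ / t < k + 1 := Nat.lt_floor_add_one _
  have hkt : k * t ≤ ε * ℓ := by rwa [le_div_iff₀ ht0] at hk1
  have hkt' : ε * ℓ / 2 ≤ k * t := by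
    rw [div_lt_iff₀ ht0] at hk2
    linarith
  have hkpos : 1 ≤ k := by
    rw [hk, Nat.one_le_floor_iff, le_div_iff₀ ht0]
    nlinarith
  have hεℓ : 28 * (s + 2) * (ε * ℓ) = c / 2 * ℓ := by rw [hε]; field_simp; ring
  obtain ⟨R, hR, hRcard, hRadj⟩ := exists_dense_of_log G hs hcs hK hε0 hC
    (Real.exp_log hℓ0).symm hkpos hkt hkt' ht0 h2 h3 h4 h7 (by rw [hεℓ]; linarith)
    (by rwa [hδℓ]) (by rwa [hδℓ])
    (by rw [Real.rpow_def_of_pos hδ, hc1] at hn; rwa [mul_comm])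
  refine ⟨R, hR, ?_, hRadj⟩
  rw [Real.rpow_def_of_pos hδ, Real.rpow_def_of_pos hℓ0, hc1]
  rwa [← hℓ, ← ht, mul_comm ℓ, mul_comm t, neg_mul]

end SmallDense

/-! ### Degree sums, truncation and minimum degree -/

namespace SmallDense

set_option linter.unusedSectionVars false

open Finset

variable {V : Type*}

open Classical in
/-- The number of neighbours of `v` in `S`. -/
noncomputable def degIn (G : SimpleGraph V) (S : Finset V) (v : V) : ℕ :=
  (S.filter fun u => G.Adj v u).card

/-- Twice the number of edges inside `S`. -/
noncomputable def degSum (G : SimpleGraph V) (S : Finset V) : ℕ := ∑ v ∈ S, degIn G S v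

lemma adjPairs_eq_degSum [DecidableEq V] (G : SimpleGraph V) [DecidableRel G.Adj] (S : Finset V) :
    adjPairs G S = degSum G S := by
  unfold adjPairs degSum degIn
  rw [Finset.card_filter, Finset.sum_product]
  refine Finset.sum_congr rfl fun v _ => ?_
  rw [Finset.card_filter]
  exact Finset.sum_congr rfl fun u _ => by split_ifs <;> simp_all

lemma degIn_mono_right (G : SimpleGraph V) {S T : Finset V} (h : S ⊆ T) (v : V) :
    degIn G S v ≤ degIn G T v := by
  classical
  exact Finset.card_le_card (Finset.filter_subset_filter _ h)

lemma degIn_mono_left {F G : SimpleGraph V} (h : F ≤ G) (S : Finset V) (v : V) :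
    degIn F S v ≤ degIn G S v := by
  classical
  refine Finset.card_le_card fun u hu => ?_
  rw [Finset.mem_filter] at hu ⊢
  exact ⟨hu.1, h hu.2⟩

lemma degSum_mono_left {F G : SimpleGraph V} (h : F ≤ G) (S : Finset V) :
    degSum F S ≤ degSum G S :=
  Finset.sum_le_sum fun _ _ => degIn_mono_left h _ _

lemma degSum_le_sq (G : SimpleGraph V) (S : Finset V) : degSum G S ≤ S.card * S.card := by
  classical
  rw [← smul_eq_mul]
  exact Finset.sum_le_card_nsmul _ _ _ fun _ _ => Finset.card_le_card (Finset.filter_subset _ _)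

lemma degIn_comap {W : Type*} (f : W ↪ V) (G : SimpleGraph V) (R : Finset W) (w : W) :
    degIn (G.comap f) R w = degIn G (R.map f) (f w) := by
  classical
  unfold degIn
  rw [← Finset.card_map f, Finset.map_filter']
  congr 1
  ext v
  simp only [Finset.mem_filter, Finset.mem_map, SimpleGraph.comap_adj]
  constructor
  · rintro ⟨⟨a, ha, rfl⟩, b, hb, hba⟩
    exact ⟨⟨a, ha, rfl⟩, hba ▸ hb⟩
  · rintro ⟨⟨a, ha, rfl⟩, h⟩
    exact ⟨⟨a, ha, rfl⟩, a, h, rfl⟩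

lemma degSum_comap {W : Type*} (f : W ↪ V) (G : SimpleGraph V) (R : Finset W) :
    degSum (G.comap f) R = degSum G (R.map f) := by
  unfold degSum
  rw [Finset.sum_map]
  exact Finset.sum_congr rfl fun w _ => degIn_comap f G R w

lemma degree_eq_degIn [Fintype V] (G : SimpleGraph V) (v : V) [Fintype (G.neighborSet v)] :
    G.degree v = degIn G univ v := by
  classical
  rw [← SimpleGraph.card_neighborFinset_eq_degree, degIn]
  congr 1
  ext u
  simp

lemma sum_degIn_comm (G : SimpleGraph V) (S T : Finset V) :
    ∑ v ∈ S, degIn G T v = ∑ u ∈ T, degIn G S u := by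
  classical
  unfold degIn
  simp_rw [Finset.card_filter]
  rw [Finset.sum_comm]
  simp_rw [G.adj_comm]

lemma degIn_sdiff_add [DecidableEq V] (G : SimpleGraph V) {A S : Finset V} (hA : A ⊆ S) (v : V) :
    degIn G (S \ A) v + degIn G A v = degIn G S v := by
  classical
  unfold degIn
  simp_rw [Finset.card_filter]
  exact Finset.sum_sdiff hA

lemma degSum_le_sdiff_add [DecidableEq V] (G : SimpleGraph V) {A S : Finset V} (hA : A ⊆ S) :
    degSum G S ≤ degSum G (S \ A) + 2 * ∑ v ∈ A, degIn G S v := by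
  have h1 : degSum G S = ∑ v ∈ S \ A, degIn G S v + ∑ v ∈ A, degIn G S v :=
    (Finset.sum_sdiff hA).symm
  have h2 : ∑ v ∈ S \ A, degIn G S v = degSum G (S \ A) + ∑ v ∈ S \ A, degIn G A v := by
    unfold degSum
    rw [← Finset.sum_add_distrib]
    exact Finset.sum_congr rfl fun v _ => (degIn_sdiff_add G hA v).symm
  have h3 : ∑ v ∈ S \ A, degIn G A v ≤ ∑ v ∈ A, degIn G S v := by
    rw [sum_degIn_comm]
    exact Finset.sum_le_sum fun v _ => degIn_mono_right G Finset.sdiff_subset v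
  omega

/-- Some subset of prescribed size has at least its proportional share of the total weight. -/
lemma exists_subset_sum_ge [DecidableEq V] (w : V → ℕ) (t j : ℕ) :
    ∀ S : Finset V, S.card = t + j →
      ∃ B ⊆ S, B.card = t ∧ t * ∑ v ∈ S, w v ≤ S.card * ∑ v ∈ B, w v := by
  induction j with
  | zero => exact fun S hS => ⟨S, Finset.Subset.rfl, hS, by rw [hS]; exact le_rfl⟩
  | succ j ih =>
    intro S hS
    -- Discarding an element of least weight does not lower the average.
    obtain ⟨v, hvS, hv⟩ := S.exists_min_image w (Finset.card_pos.1 (by omega))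
    have hcard : (S.erase v).card = t + j := by rw [Finset.card_erase_of_mem hvS]; omega
    obtain ⟨B, hBS, hBt, hB⟩ := ih _ hcard
    refine ⟨B, hBS.trans (Finset.erase_subset _ _), hBt, ?_⟩
    rcases Nat.eq_zero_or_pos (t + j) with h0 | h0
    · rw [show t = 0 by omega, zero_mul]
      exact Nat.zero_le _
    have h1 : (t + j) * w v ≤ ∑ u ∈ S.erase v, w u := by
      rw [← hcard, ← smul_eq_mul]
      exact Finset.card_nsmul_le_sum _ _ _ fun u hu => hv u (Finset.mem_of_mem_erase hu)
    have h2 := Finset.sum_erase_add S w hvS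
    rw [hcard] at hB
    refine Nat.le_of_mul_le_mul_left ?_ h0
    calc (t + j) * (t * ∑ u ∈ S, w u)
        = t * ((t + j) * ∑ u ∈ S.erase v, w u + (t + j) * w v) := by rw [← h2]; ring
      _ ≤ t * ((t + j) * ∑ u ∈ S.erase v, w u + ∑ u ∈ S.erase v, w u) := by gcongr
      _ = S.card * (t * ∑ u ∈ S.erase v, w u) := by rw [hS]; ring
      _ ≤ S.card * ((t + j) * ∑ u ∈ B, w u) := by gcongr
      _ = _ := by ring

/-- Vertices of `S` are chosen by their number of neighbours in `A`; a `t / |S|` share of all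
incidences between `A` and `S` then survives inside `A ∪ B`. -/
lemma exists_degSum_union_ge [DecidableEq V] (G : SimpleGraph V) {A S : Finset V} {t : ℕ}
    (ht : t ≤ S.card) :
    ∃ B ⊆ S, B.card = t ∧ t * ∑ v ∈ A, degIn G S v ≤ S.card * degSum G (A ∪ B) := by
  obtain ⟨B, hBS, hBt, hB⟩ := exists_subset_sum_ge (degIn G A) t (S.card - t) S (by omega)
  refine ⟨B, hBS, hBt, ?_⟩
  rw [sum_degIn_comm]
  refine hB.trans (Nat.mul_le_mul_left _ ?_)
  calc ∑ v ∈ B, degIn G A v ≤ ∑ v ∈ B, degIn G (A ∪ B) v :=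
        Finset.sum_le_sum fun v _ => degIn_mono_right G Finset.subset_union_left v
    _ ≤ _ := Finset.sum_le_sum_of_subset Finset.subset_union_right

/-- A maximal subgraph of maximum degree at most `D`: few edges avoid its saturated vertices. -/
lemma exists_truncation [Finite V] (G : SimpleGraph V) (T : Finset V) (D Δ : ℕ)
    (hΔ : ∀ v ∈ T, degIn G T v ≤ Δ) :
    ∃ F ≤ G, (∀ v ∈ T, degIn F T v ≤ D) ∧ ∃ Q ⊆ T, (∀ v ∈ Q, degIn F T v = D) ∧
      degSum G T ≤ degSum F T + 2 * (Q.card * Δ) := by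
  classical
  have hne : {F : SimpleGraph V | F ≤ G ∧ ∀ v ∈ T, degIn F T v ≤ D}.Nonempty :=
    ⟨⊥, bot_le, fun v _ => by simp [degIn]⟩
  obtain ⟨F, hF⟩ := Set.Finite.exists_maximal (Set.toFinite _) hne
  obtain ⟨hFG, hFD⟩ := hF.prop
  refine ⟨F, hFG, hFD, T.filter fun v => degIn F T v = D, Finset.filter_subset _ _,
    fun v hv => (Finset.mem_filter.1 hv).2, ?_⟩
  set Q := T.filter fun v => degIn F T v = D with hQ
  -- An edge of `G` between two unsaturated vertices could be added to `F`, so by maximality it is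
  -- already there.
  have hext : ∀ u ∈ T, ∀ v ∈ T, G.Adj u v → u ∉ Q → v ∉ Q → F.Adj u v := by
    intro u hu v hv huv huQ hvQ
    have hu' : degIn F T u < D :=
      lt_of_le_of_ne (hFD u hu) fun h => huQ (Finset.mem_filter.2 ⟨hu, h⟩)
    have hv' : degIn F T v < D :=
      lt_of_le_of_ne (hFD v hv) fun h => hvQ (Finset.mem_filter.2 ⟨hv, h⟩)
    have hmem : F ⊔ SimpleGraph.edge u v ∈
        {F : SimpleGraph V | F ≤ G ∧ ∀ v ∈ T, degIn F T v ≤ D} := by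
      refine ⟨sup_le hFG ?_, fun a ha => ?_⟩
      · intro a b hab
        rw [SimpleGraph.edge_adj] at hab
        rcases hab.1 with ⟨rfl, rfl⟩ | ⟨rfl, rfl⟩
        · exact huv
        · exact huv.symm
      · by_cases hau : a = u
        · subst hau
          refine le_trans ?_ (Nat.succ_le_of_lt hu')
          refine (Finset.card_le_card (t := insert v (T.filter fun b => F.Adj a b)) ?_).trans
            (Finset.card_insert_le _ _)
          intro b hb
          simp only [Finset.mem_filter, SimpleGraph.sup_adj, SimpleGraph.edge_adj] at hb
          simp only [Finset.mem_insert, Finset.mem_filter]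
          rcases hb with ⟨hbT, hb | ⟨⟨-, rfl⟩ | ⟨rfl, rfl⟩, -⟩⟩
          · exact Or.inr ⟨hbT, hb⟩
          · exact Or.inl rfl
          · exact Or.inl rfl
        · by_cases hav : a = v
          · subst hav
            refine le_trans ?_ (Nat.succ_le_of_lt hv')
            refine (Finset.card_le_card (t := insert u (T.filter fun b => F.Adj a b)) ?_).trans
              (Finset.card_insert_le _ _)
            intro b hb
            simp only [Finset.mem_filter, SimpleGraph.sup_adj, SimpleGraph.edge_adj] at hb
            simp only [Finset.mem_insert, Finset.mem_filter]
            rcases hb with ⟨hbT, hb | ⟨⟨rfl, rfl⟩ | ⟨-, rfl⟩, -⟩⟩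
            · exact Or.inr ⟨hbT, hb⟩
            · exact absurd rfl hau
            · exact Or.inl rfl
          · refine (Finset.card_le_card ?_).trans (hFD a ha)
            intro b hb
            simp only [Finset.mem_filter, SimpleGraph.sup_adj, SimpleGraph.edge_adj] at hb ⊢
            rcases hb with ⟨hbT, hb | ⟨⟨rfl, rfl⟩ | ⟨rfl, rfl⟩, -⟩⟩
            · exact ⟨hbT, hb⟩
            · exact absurd rfl hau
            · exact absurd rfl hav
    refine hF.le_of_ge hmem le_sup_left ?_
    rw [SimpleGraph.sup_adj, SimpleGraph.edge_adj]
    exact Or.inr ⟨Or.inl ⟨rfl, rfl⟩, huv.ne⟩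
  have hpoint : ∀ v ∈ T, degIn G T v ≤
      degIn F T v + ((if v ∈ Q then degIn G T v else 0) + degIn G Q v) := by
    intro v hv
    by_cases hvQ : v ∈ Q
    · rw [if_pos hvQ]; omega
    · rw [if_neg hvQ, zero_add]
      unfold degIn
      refine (Finset.card_le_card ?_).trans (Finset.card_union_le _ _)
      intro u hu
      obtain ⟨huT, huv⟩ := Finset.mem_filter.1 hu
      by_cases huQ : u ∈ Q
      · exact Finset.mem_union_right _ (Finset.mem_filter.2 ⟨huQ, huv⟩)
      · exact Finset.mem_union_left _ (Finset.mem_filter.2 ⟨huT, hext v hv u huT huv hvQ huQ⟩)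
  have hQT : Q ⊆ T := Finset.filter_subset _ _
  have hQΔ : ∑ v ∈ Q, degIn G T v ≤ Q.card * Δ := by
    rw [← smul_eq_mul]
    exact Finset.sum_le_card_nsmul _ _ _ fun v hv => hΔ v (hQT hv)
  calc degSum G T ≤ ∑ v ∈ T, (degIn F T v + ((if v ∈ Q then degIn G T v else 0) + degIn G Q v)) :=
        Finset.sum_le_sum hpoint
    _ = degSum F T + (∑ v ∈ Q, degIn G T v + ∑ v ∈ Q, degIn G T v) := by
        rw [Finset.sum_add_distrib, Finset.sum_add_distrib, sum_degIn_comm G T Q, ← Finset.sum_filter,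
          Finset.filter_mem_eq_inter, Finset.inter_eq_right.2 hQT]
        rfl
    _ ≤ _ := by omega

/-- Passing to a set of large minimum degree that keeps half of the edges. -/
lemma exists_minDegree (F : SimpleGraph V) (T : Finset V) {D : ℕ}
    (hD : ∀ v ∈ T, degIn F T v ≤ D) {δ : ℝ} (hδ : 0 ≤ δ) (h : 4 * δ * T.card ≤ degSum F T)
    (hpos : 0 < degSum F T) :
    ∃ U ⊆ T, U.Nonempty ∧ (∀ v ∈ U, δ ≤ degIn F U v) ∧ degSum F T ≤ 2 * (U.card * D) := by
  classical
  -- Removing a vertex lowers `degSum` by at most twice its degree, so at a maximum of this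
  -- functional every degree is at least `δ`. Comparison with `T` shows that half of the edges
  -- remain.
  obtain ⟨U, hU, hmax⟩ := T.powerset.exists_max_image
    (fun U => (degSum F U : ℝ) - 2 * δ * U.card) ⟨T, Finset.mem_powerset_self T⟩
  rw [Finset.mem_powerset] at hU
  have h1 := hmax T (Finset.mem_powerset_self T)
  have h2 : (degSum F T : ℝ) ≤ 2 * degSum F U := by
    have : 0 ≤ 2 * δ * U.card := by positivity
    linarith
  have h3 : degSum F T ≤ 2 * degSum F U := by exact_mod_cast h2
  refine ⟨U, hU, ?_, fun v hv => ?_, h3.trans ?_⟩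
  · by_contra hne
    rw [Finset.not_nonempty_iff_eq_empty] at hne
    have : degSum F U = 0 := by rw [hne]; rfl
    omega
  · have h4 := hmax (U \ {v}) (Finset.mem_powerset.2 (Finset.sdiff_subset.trans hU))
    have h5 := degSum_le_sdiff_add F (Finset.singleton_subset_iff.2 hv)
    rw [Finset.sum_singleton] at h5
    have h6 : (degSum F U : ℝ) ≤ degSum F (U \ {v}) + 2 * degIn F U v := by exact_mod_cast h5
    have h7 : ((U \ {v}).card : ℝ) + 1 = U.card := by
      rw [Finset.sdiff_singleton_eq_erase]
      exact_mod_cast Finset.card_erase_add_one hv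
    rw [← h7] at h4
    linarith
  · refine Nat.mul_le_mul_left _ ?_
    rw [← smul_eq_mul]
    exact Finset.sum_le_card_nsmul _ _ _ fun v hv => (degIn_mono_right F hU v).trans (hD v (hU hv))

end SmallDense

/-! ### Nearly regular pieces of extremal sets -/

namespace SmallDense

set_option linter.unusedSectionVars false

open Finset Filter

variable {V : Type*}

/-- In a set that maximizes `degSum / card ^ (1 + γ)`, the vertices of degree much larger than the
average meet at most half of the edges. -/
lemma exists_bounded_part [DecidableEq V] (G : SimpleGraph V) {S : Finset V} {s γ K d : ℝ}
    (hγ0 : 0 < γ) (hγ1 : γ ≤ 1) (hK : 1 ≤ K) (hKγ : 36 < K ^ γ) (hs : 0 < s)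
    (hmax : ∀ T : Finset V, T.Nonempty → s * T.card ≤ degSum G T →
      (degSum G T : ℝ) * (S.card : ℝ) ^ (1 + γ) ≤ degSum G S * (T.card : ℝ) ^ (1 + γ))
    (hS : 0 < S.card) (hd : (degSum G S : ℝ) = d * S.card) (hds : 12 * s ≤ d) (hdK : K ≤ d) :
    ∃ T ⊆ S, degSum G S ≤ 2 * degSum G T ∧ ∀ v ∈ T, (degIn G T v : ℝ) ≤ K * d := by
  classical
  set A := S.filter fun v => K * d < degIn G S v with hA
  have hAS : A ⊆ S := Finset.filter_subset _ _
  refine ⟨S \ A, Finset.sdiff_subset, ?_, fun v hv => ?_⟩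
  swap
  · obtain ⟨hvS, hvA⟩ := Finset.mem_sdiff.1 hv
    have : (degIn G S v : ℝ) ≤ K * d := by
      by_contra hcon
      exact hvA (Finset.mem_filter.2 ⟨hvS, not_le.1 hcon⟩)
    exact le_trans (by exact_mod_cast degIn_mono_right G Finset.sdiff_subset v) this
  suffices h : 4 * ∑ v ∈ A, degIn G S v ≤ degSum G S by
    have := degSum_le_sdiff_add G hAS
    omega
  by_contra hcon
  rw [not_le] at hcon
  set a := ∑ v ∈ A, degIn G S v with ha
  set N : ℝ := (S.card : ℝ) with hN
  have hN0 : 0 < N := by rw [hN]; exact_mod_cast hS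
  have hK0 : 0 < K := by linarith
  have hd0 : 0 < d := by linarith
  have hdN : d ≤ N := by
    have h : (degSum G S : ℝ) ≤ S.card * S.card := by exact_mod_cast degSum_le_sq G S
    rw [hd] at h
    exact le_of_mul_le_mul_right h hN0
  have hcon' : d * N < 4 * a := by rw [← hd]; exact_mod_cast hcon
  have hAcard : (A.card : ℝ) * K ≤ N := by
    have h1 : (A.card : ℝ) * (K * d) ≤ a := by
      rw [ha, ← nsmul_eq_mul]
      push_cast
      exact Finset.card_nsmul_le_sum _ _ _ fun v hv => (Finset.mem_filter.1 hv).2.le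
    have h2 : (a : ℝ) ≤ degSum G S := by
      exact_mod_cast Finset.sum_le_sum_of_subset hAS
    refine le_of_mul_le_mul_right ?_ hd0
    linarith
  -- There are at most `N / K` vertices of degree above `K * d`. Joining them with equally many
  -- well-chosen vertices keeps about a `1 / K` share of their edges on only `3 * N / K` vertices,
  -- which beats the extremal ratio once `K ^ γ > 36`.
  set t := ⌈N / K⌉₊ with ht
  have htS : t ≤ S.card := Nat.ceil_le.2 (div_le_self hN0.le hK)
  have ht1 : N ≤ t * K := (div_le_iff₀ hK0).1 (Nat.le_ceil _)
  have ht2 : (t : ℝ) * K ≤ N + K := by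
    have := (Nat.ceil_lt_add_one (by positivity : 0 ≤ N / K)).le
    calc (t : ℝ) * K ≤ (N / K + 1) * K := by gcongr
      _ = N + K := by field_simp
  obtain ⟨B, hBS, hBt, hB⟩ := exists_degSum_union_ge G (A := A) htS
  set U := A ∪ B with hU
  have hB' : (t : ℝ) * a ≤ N * degSum G U := by
    rw [hN, ha]
    exact_mod_cast hB
  have hUcard : (U.card : ℝ) * K ≤ 3 * N := by
    have h1 : (U.card : ℝ) ≤ A.card + t := by
      rw [← hBt]
      exact_mod_cast Finset.card_union_le A B
    calc (U.card : ℝ) * K ≤ (A.card + t) * K := by gcongr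
      _ ≤ _ := by linarith
  have hUsum : d * N < 4 * K * degSum G U := by
    have h1 : N * (a : ℝ) ≤ N * (K * degSum G U) := by
      calc N * (a : ℝ) ≤ t * K * a := by gcongr
        _ = K * (t * a) := by ring
        _ ≤ K * (N * degSum G U) := by gcongr
        _ = _ := by ring
    have h2 := le_of_mul_le_mul_left h1 hN0
    linarith
  have hUpos : 0 < (degSum G U : ℝ) := by
    have : 0 < 4 * K * (degSum G U : ℝ) := lt_trans (by positivity) hUsum
    exact pos_of_mul_pos_right this (by positivity)
  have hUne : U.Nonempty := by
    by_contra hne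
    rw [Finset.not_nonempty_iff_eq_empty] at hne
    rw [hne] at hUpos
    simp [degSum] at hUpos
  have h := hmax U hUne (by
    refine le_of_mul_le_mul_left ?_ (by positivity : 0 < 4 * K)
    calc 4 * K * (s * U.card) = 4 * s * (U.card * K) := by ring
      _ ≤ 4 * s * (3 * N) := by gcongr
      _ = 12 * s * N := by ring
      _ ≤ d * N := by gcongr
      _ ≤ _ := hUsum.le)
  have hpow : (U.card : ℝ) ^ (1 + γ) * (4 * K) < N ^ (1 + γ) := by
    have h1 : (U.card : ℝ) ≤ 3 * N / K := by rwa [le_div_iff₀ hK0]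
    have h2 : (3 : ℝ) ^ (1 + γ) ≤ 9 := by
      calc (3 : ℝ) ^ (1 + γ) ≤ 3 ^ (2 : ℝ) := by
            apply Real.rpow_le_rpow_of_exponent_le <;> linarith
        _ = 9 := by norm_num
    have h3 : K ^ (1 + γ) = K * K ^ γ := by rw [Real.rpow_add hK0, Real.rpow_one]
    have h4 : 0 < K ^ γ := by positivity
    calc (U.card : ℝ) ^ (1 + γ) * (4 * K) ≤ (3 * N / K) ^ (1 + γ) * (4 * K) := by gcongr
      _ = 4 * 3 ^ (1 + γ) / K ^ γ * N ^ (1 + γ) := by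
          rw [Real.div_rpow (by positivity) hK0.le, Real.mul_rpow (by norm_num) hN0.le, h3]
          field_simp
      _ ≤ 4 * 9 / K ^ γ * N ^ (1 + γ) := by gcongr
      _ < 1 * N ^ (1 + γ) := by
          gcongr
          rw [div_lt_one h4]
          linarith
      _ = _ := one_mul _
  rw [hd] at h
  have : d * N * ((U.card : ℝ) ^ (1 + γ) * (4 * K)) < d * N * ((U.card : ℝ) ^ (1 + γ) * (4 * K)) :=
    calc d * N * ((U.card : ℝ) ^ (1 + γ) * (4 * K))
        < d * N * N ^ (1 + γ) := by gcongr
      _ ≤ 4 * K * degSum G U * N ^ (1 + γ) := by gcongr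
      _ = 4 * K * (degSum G U * N ^ (1 + γ)) := by ring
      _ ≤ 4 * K * (d * N * (U.card : ℝ) ^ (1 + γ)) := by gcongr
      _ = _ := by ring
  exact lt_irrefl _ this

/-- A graph of bounded maximum degree contains a nearly regular piece with prescribed degrees. -/
lemma exists_nearly_regular [Finite V] (G : SimpleGraph V) {S T : Finset V} {K d : ℝ} (hTS : T ⊆ S)
    (hK : 1 ≤ K) (hS : 0 < S.card) (hd : (degSum G S : ℝ) = d * S.card)
    (hT : degSum G S ≤ 2 * degSum G T) (hΔ : ∀ v ∈ T, (degIn G T v : ℝ) ≤ K * d) {D : ℕ}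
    (hD : 1 ≤ D) (hDd : 4 * D ≤ d) :
    ∃ F ≤ G, ∃ U ⊆ S, U.Nonempty ∧ (∀ v ∈ U, (D : ℝ) / (32 * K) ≤ degIn F U v) ∧
      (∀ v ∈ U, degIn F U v ≤ D) ∧ (S.card : ℝ) ≤ 16 * K * U.card := by
  have hS' : (0 : ℝ) < S.card := by exact_mod_cast hS
  have hD' : (1 : ℝ) ≤ D := by exact_mod_cast hD
  have hd0 : 0 < d := by linarith
  obtain ⟨F, hFG, hFD, Q, hQT, hQ, hFT⟩ :=
    exists_truncation G T D ⌊K * d⌋₊ fun v hv => Nat.le_floor (hΔ v hv)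
  have hfloor : (⌊K * d⌋₊ : ℝ) ≤ K * d := Nat.floor_le (by positivity)
  have h1 : (degSum F T : ℝ) ≤ S.card * D := by
    have : degSum F T ≤ T.card * D := by
      rw [← smul_eq_mul]
      exact Finset.sum_le_card_nsmul _ _ _ hFD
    exact_mod_cast this.trans (Nat.mul_le_mul_right _ (Finset.card_le_card hTS))
  have h2 : (Q.card : ℝ) * D ≤ degSum F T := by
    have : Q.card * D ≤ degSum F T := by
      calc Q.card * D = ∑ v ∈ Q, degIn F T v := by
            rw [Finset.sum_congr rfl hQ, Finset.sum_const, smul_eq_mul]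
        _ ≤ _ := Finset.sum_le_sum_of_subset hQT
    exact_mod_cast this
  -- As `4 * D ≤ d`, the truncated graph holds too few of the edges, so the saturated vertices must
  -- meet the rest; each meets at most `K * d`, hence there are many of them.
  have h3 : (S.card : ℝ) ≤ 8 * K * Q.card := by
    have h4 : (degSum G S : ℝ) ≤ 2 * degSum G T := by exact_mod_cast hT
    have h5 : (degSum G T : ℝ) ≤ degSum F T + 2 * (Q.card * ⌊K * d⌋₊) := by exact_mod_cast hFT
    have h6 : (Q.card : ℝ) * ⌊K * d⌋₊ ≤ Q.card * (K * d) := by gcongr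
    have h7 : (S.card : ℝ) * (4 * D) ≤ S.card * d := by gcongr
    refine le_of_mul_le_mul_right ?_ hd0
    linarith
  have h4 : (S.card : ℝ) * D ≤ 8 * K * degSum F T := by
    calc (S.card : ℝ) * D ≤ 8 * K * Q.card * D := by gcongr
      _ = 8 * K * (Q.card * D) := by ring
      _ ≤ _ := by gcongr
  have hTS' : (T.card : ℝ) ≤ S.card := by exact_mod_cast Finset.card_le_card hTS
  obtain ⟨U, hUT, hU, hUmin, hUcard⟩ := exists_minDegree F T hFD
    (δ := (D : ℝ) / (32 * K)) (by positivity)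
    (by
      calc 4 * ((D : ℝ) / (32 * K)) * T.card ≤ 4 * ((D : ℝ) / (32 * K)) * S.card := by gcongr
        _ = S.card * D / (8 * K) := by field_simp; ring
        _ ≤ _ := by rw [div_le_iff₀ (by positivity)]; linarith)
    (by
      have : 0 < 8 * K * (degSum F T : ℝ) := lt_of_lt_of_le (by positivity) h4
      have := pos_of_mul_pos_right this (by positivity)
      exact_mod_cast this)
  refine ⟨F, hFG, U, hUT.trans hTS, hU, hUmin,
    fun v hv => (degIn_mono_right F hUT v).trans (hFD v (hUT hv)), ?_⟩
  have h5 : (degSum F T : ℝ) ≤ 2 * (U.card * D) := by exact_mod_cast hUcard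
  refine le_of_mul_le_mul_right ?_ (by positivity : (0 : ℝ) < D)
  calc (S.card : ℝ) * D ≤ 8 * K * degSum F T := h4
    _ ≤ 8 * K * (2 * (U.card * D)) := by gcongr
    _ = _ := by ring

lemma averageDegree_eq [Fintype V] (G : SimpleGraph V) :
    G.averageDegree = degSum G univ / Fintype.card V := by
  classical
  unfold SimpleGraph.averageDegree degSum
  rw [Nat.cast_sum]
  congr 1
  exact Finset.sum_congr rfl fun v _ => by rw [degree_eq_degIn]

lemma averageDegree_induce (G : SimpleGraph V) (R : Finset V) :
    (G.induce (R : Set V)).averageDegree = degSum G R / R.card := by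
  rw [averageDegree_eq]
  congr 2
  · have h : G.induce (R : Set V) = G.comap (Function.Embedding.subtype fun v => v ∈ (R : Set V)) :=
      rfl
    rw [h, degSum_comap]
    congr 1
    ext v
    simp
  · simp

/-- The nearly regular case, applied inside a set of vertices. -/
lemma exists_dense_subset.{u} {V : Type u} {s K δ C : ℝ} {F : SimpleGraph V} {U : Finset V} (hU : U.Nonempty)
    (hcore : ∀ (W : Type u) [Fintype W] [Nonempty W] [DecidableEq W]
      (G : SimpleGraph W) [DecidableRel G.Adj], (∀ v, δ ≤ G.degree v) →
      (∀ v, (G.degree v : ℝ) ≤ K * δ) → δ ^ (s / (s - 2)) ≤ Fintype.card W →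
      ∃ R : Finset W, R.Nonempty ∧
        (R.card : ℝ) ≤ Fintype.card W * δ ^ (-(s / (s - 2))) * Real.log δ ^ C ∧
        s * R.card ≤ adjPairs G R)
    (hmin : ∀ v ∈ U, δ ≤ degIn F U v) (hmax : ∀ v ∈ U, (degIn F U v : ℝ) ≤ K * δ)
    (hδ : δ ^ (s / (s - 2)) ≤ U.card) :
    ∃ R : Finset V, R.Nonempty ∧
      (R.card : ℝ) ≤ U.card * δ ^ (-(s / (s - 2))) * Real.log δ ^ C ∧ s * R.card ≤ degSum F R := by
  classical
  let f : {v // v ∈ U} ↪ V := Function.Embedding.subtype fun v => v ∈ U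
  have hdeg : ∀ v : {v // v ∈ U}, (F.comap f).degree v = degIn F U v := by
    intro v
    rw [degree_eq_degIn, degIn_comap]
    congr 1
    ext u
    simp [f]
  have : Nonempty {v // v ∈ U} := hU.to_subtype
  obtain ⟨R, hR, hRcard, hRadj⟩ := hcore {v // v ∈ U} (F.comap f)
    (fun v => by rw [hdeg]; exact hmin v v.2) (fun v => by rw [hdeg]; exact hmax v v.2)
    (by rwa [Fintype.card_coe])
  rw [Fintype.card_coe] at hRcard
  rw [adjPairs_eq_degSum, degSum_comap] at hRadj
  exact ⟨R.map f, hR.map, by rwa [Finset.card_map], by rwa [Finset.card_map]⟩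

/-- A set of average degree at least `s` that maximizes `degSum / card ^ (1 + γ)`. -/
lemma exists_extremal_set [Fintype V] [Nonempty V] (G : SimpleGraph V) {s : ℝ} (γ : ℝ)
    (h : s * Fintype.card V ≤ degSum G univ) :
    ∃ S : Finset V, S.Nonempty ∧ s * S.card ≤ degSum G S ∧
      ∀ T : Finset V, T.Nonempty → s * T.card ≤ degSum G T →
        (degSum G T : ℝ) * (S.card : ℝ) ^ (1 + γ) ≤ degSum G S * (T.card : ℝ) ^ (1 + γ) := by
  classical
  obtain ⟨S, hS, hmax⟩ :=
    (univ.filter fun T : Finset V => T.Nonempty ∧ s * T.card ≤ degSum G T).exists_max_image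
      (fun T => (degSum G T : ℝ) / (T.card : ℝ) ^ (1 + γ))
      ⟨univ, Finset.mem_filter.2 ⟨mem_univ _, Finset.univ_nonempty, h⟩⟩
  obtain ⟨-, hSne, hSs⟩ := Finset.mem_filter.1 hS
  refine ⟨S, hSne, hSs, fun T hT hTs => ?_⟩
  have h1 : (0 : ℝ) < S.card := by exact_mod_cast hSne.card_pos
  have h2 : (0 : ℝ) < T.card := by exact_mod_cast hT.card_pos
  have h3 := hmax T (Finset.mem_filter.2 ⟨mem_univ _, hT, hTs⟩)
  rwa [div_le_div_iff₀ (by positivity) (by positivity)] at h3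

end SmallDense

/-! ### Reduction of extremal sets to the nearly regular case -/

namespace SmallDense

set_option linter.unusedSectionVars false

open Finset Filter

/-- The reduction of the theorem to nearly regular graphs, for an extremal set of large average
degree. Here `x` stands for `n d ^ (-s / (s - 2))`. -/
lemma exists_dense_of_extremal.{u} {V : Type u} [Fintype V] (G : SimpleGraph V)
    {s γ θ K C δ₀ d d₀ x : ℝ} {S : Finset V} (hs : 2 < s) (hθ : θ = s / (s - 2))
    (hγθ : γ * θ = 1) (hγ0 : 0 < γ) (hγ1 : γ ≤ 1) (hK : 1 ≤ K) (hKγ : 36 < K ^ γ) (hC : 0 ≤ C)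
    (hδ₀ : 1 ≤ δ₀)
    (hcore : ∀ δ, δ₀ ≤ δ → ∀ (W : Type u) [Fintype W] [Nonempty W] [DecidableEq W]
      (G : SimpleGraph W) [DecidableRel G.Adj], (∀ v, δ ≤ G.degree v) →
      (∀ v, (G.degree v : ℝ) ≤ 32 * K * δ) → δ ^ (s / (s - 2)) ≤ Fintype.card W →
      ∃ R : Finset W, R.Nonempty ∧
        (R.card : ℝ) ≤ Fintype.card W * δ ^ (-(s / (s - 2))) * Real.log δ ^ C ∧
        s * R.card ≤ adjPairs G R)
    (hmax : ∀ T : Finset V, T.Nonempty → s * T.card ≤ degSum G T →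
      (degSum G T : ℝ) * (S.card : ℝ) ^ (1 + γ) ≤ degSum G S * (T.card : ℝ) ^ (1 + γ))
    (hS : 0 < S.card) (hd : (degSum G S : ℝ) = d₀ * S.card) (hds : 12 * s ≤ d₀) (hdK : K ≤ d₀)
    (hd₀ : 4 * (64 * K * δ₀) ≤ d₀) (hd₀θ : (64 * K * δ₀) ^ θ ≤ d₀) (hdδ : 64 * K * δ₀ ≤ d)
    (hx1 : 1 ≤ x) (hxd : S.card * d ^ (-θ) ≤ x) (hxd₀ : S.card * d₀ ^ (-θ) ≤ x) :
    ∃ R : Finset V, R.Nonempty ∧ (R.card : ℝ) ≤ x * (256 * K) ^ θ * Real.log d ^ C ∧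
      s * R.card ≤ degSum G R := by
  classical
  set N : ℝ := (S.card : ℝ) with hN
  have hN0 : 0 < N := by rw [hN]; exact_mod_cast hS
  have hθ0 : 0 < θ := by
    by_contra hcon
    nlinarith
  have hθ1 : 1 ≤ θ := by nlinarith
  set m := 64 * K * δ₀ with hm
  have hm1 : 64 ≤ m := by nlinarith
  have hd₀0 : 0 < d₀ := by linarith
  have hdN : d₀ ≤ N := by
    have h : (degSum G S : ℝ) ≤ S.card * S.card := by exact_mod_cast degSum_le_sq G S
    rw [hd] at h
    exact le_of_mul_le_mul_right h hN0
  have hmN : m ≤ N ^ γ := by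
    calc m = (m ^ θ) ^ γ := by
          rw [← Real.rpow_mul (by linarith), mul_comm, hγθ, Real.rpow_one]
      _ ≤ N ^ γ := by
          gcongr
          exact hd₀θ.trans hdN
  -- The target degree is the minimum of three caps: `d₀ / 4` for the truncation, `d` to bound `log
  -- δ` by `log d`, and `N ^ γ` so that the piece is large enough for its degree. Whichever is
  -- smallest, `N * μ ^ (-θ)` is `O(x)`; in the last case it equals 1.
  obtain ⟨μ, hμd₀, hμd, hμN, hmμ, hμ⟩ : ∃ μ, 4 * μ ≤ d₀ ∧ μ ≤ d ∧ μ ≤ N ^ γ ∧ m ≤ μ ∧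
      N * μ ^ (-θ) ≤ 4 ^ θ * x := by
    have h4 : (1 : ℝ) ≤ 4 ^ θ := Real.one_le_rpow (by norm_num) hθ0.le
    have hx4 : x ≤ 4 ^ θ * x := le_mul_of_one_le_left (by linarith) h4
    refine ⟨min (d₀ / 4) (min d (N ^ γ)), ?_, (min_le_right _ _).trans (min_le_left _ _),
      (min_le_right _ _).trans (min_le_right _ _), le_min (by linarith) (le_min hdδ hmN), ?_⟩
    · have := min_le_left (d₀ / 4) (min d (N ^ γ))
      linarith
    · rcases min_choice (d₀ / 4) (min d (N ^ γ)) with h | h <;> rw [h]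
      · rw [Real.div_rpow hd₀0.le (by norm_num), Real.rpow_neg (by norm_num : (0 : ℝ) ≤ 4)]
        calc N * (d₀ ^ (-θ) / (4 ^ θ)⁻¹) = 4 ^ θ * (N * d₀ ^ (-θ)) := by field_simp
          _ ≤ _ := by gcongr
      · rcases min_choice d (N ^ γ) with h | h <;> rw [h]
        · exact hxd.trans hx4
        · rw [← Real.rpow_mul hN0.le, mul_neg, hγθ, Real.rpow_neg_one, mul_inv_cancel₀ hN0.ne']
          exact hx1.trans hx4
  have hμ0 : 0 < μ := by linarith
  set D := ⌊μ⌋₊ with hD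
  have hDμ : (D : ℝ) ≤ μ := Nat.floor_le hμ0.le
  have hDμ' : μ ≤ 2 * D := by
    have := (Nat.lt_floor_add_one μ).le
    rw [hD]; linarith
  obtain ⟨T, hTS, hT, hTdeg⟩ := exists_bounded_part G hγ0 hγ1 hK hKγ (by linarith) hmax hS hd hds hdK
  obtain ⟨F, hFG, U, hUS, hU, hUmin, hUmax, hUcard⟩ := exists_nearly_regular G hTS hK hS hd hT hTdeg
    (D := D) (Nat.one_le_iff_ne_zero.2 (by
      rintro h
      rw [h] at hDμ'
      push_cast at hDμ'
      linarith)) (by linarith)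
  set δ := (D : ℝ) / (32 * K) with hδ
  have hδμ : μ / (64 * K) ≤ δ := by
    rw [hδ, div_le_div_iff₀ (by positivity) (by positivity)]
    nlinarith
  have hδδ₀ : δ₀ ≤ δ := by
    refine le_trans ?_ hδμ
    rw [le_div_iff₀ (by positivity)]
    linarith
  have hδ0 : 0 < δ := by linarith
  have hδθ : δ ^ (s / (s - 2)) ≤ U.card := by
    rw [← hθ, hδ, Real.div_rpow (by positivity) (by positivity), div_le_iff₀ (by positivity)]
    have h1 : (D : ℝ) ^ θ ≤ N := by
      calc (D : ℝ) ^ θ ≤ (N ^ γ) ^ θ := by gcongr; exact hDμ.trans hμN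
        _ = N := by rw [← Real.rpow_mul hN0.le, hγθ, Real.rpow_one]
    -- Since `θ ≥ 1`, dividing the degree by `32 * K` makes up for `U` being smaller than `S` by a
    -- factor `16 * K`.
    have h2 : 32 * K ≤ (32 * K) ^ θ := Real.self_le_rpow_of_one_le (by linarith) hθ1
    calc (D : ℝ) ^ θ ≤ 16 * K * U.card := h1.trans hUcard
      _ ≤ 32 * K * U.card := by gcongr; norm_num
      _ ≤ (32 * K) ^ θ * U.card := by gcongr
      _ = _ := mul_comm _ _
  obtain ⟨R, hR, hRcard, hRs⟩ := exists_dense_subset (K := 32 * K) hU (hcore δ hδδ₀) hUmin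
    (fun v hv => by
      rw [hδ, mul_div_cancel₀ _ (by positivity)]
      exact_mod_cast hUmax v hv) hδθ
  refine ⟨R, hR, ?_, hRs.trans (by exact_mod_cast degSum_mono_left hFG R)⟩
  rw [← hθ] at hRcard
  have hUN : (U.card : ℝ) ≤ N := by rw [hN]; exact_mod_cast Finset.card_le_card hUS
  have hlog0 : 0 ≤ Real.log δ := Real.log_nonneg (by linarith)
  have hδd : δ ≤ d := by
    refine le_trans ?_ (hDμ.trans hμd)
    exact div_le_self (by positivity) (by linarith)
  have hδpow : δ ^ (-θ) ≤ (64 * K) ^ θ * μ ^ (-θ) := by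
    calc δ ^ (-θ) ≤ (μ / (64 * K)) ^ (-θ) :=
          Real.rpow_le_rpow_of_nonpos (by positivity) hδμ (by linarith)
      _ = _ := by
          rw [Real.div_rpow hμ0.le (by positivity), Real.rpow_neg (by positivity : 0 ≤ 64 * K)]
          field_simp
  calc (R.card : ℝ) ≤ U.card * δ ^ (-θ) * Real.log δ ^ C := hRcard
    _ ≤ N * ((64 * K) ^ θ * μ ^ (-θ)) * Real.log d ^ C := by gcongr
    _ = (64 * K) ^ θ * (N * μ ^ (-θ)) * Real.log d ^ C := by ring
    _ ≤ (64 * K) ^ θ * (4 ^ θ * x) * Real.log d ^ C := by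
        have : 0 ≤ Real.log d := hlog0.trans (Real.log_le_log hδ0 hδd)
        gcongr
    _ = x * (256 * K) ^ θ * Real.log d ^ C := by
        rw [show 256 * K = 64 * K * 4 by ring,
          Real.mul_rpow (x := 64 * K) (y := 4) (by positivity) (by norm_num)]
        ring

end SmallDense

/-! ### The main theorem -/

theorem mainTheorem1 (s : ℝ) (hs : 2 < s) :
    ∃ C : ℝ, ∀ᶠ d : ℝ in Filter.atTop,
      ∀ (V : Type*) [Fintype V] (G : SimpleGraph V),
        d ≤ G.averageDegree →
        d ≤ (Fintype.card V : ℝ) ^ ((s - 2) / s) →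
        ∃ R : Finset V, R.Nonempty ∧
          (R.card : ℝ) ≤ (Fintype.card V : ℝ) * d ^ (-(s / (s - 2))) * (Real.log d) ^ C ∧
          s ≤ (G.induce (R : Set V)).averageDegree := by
  have hs0 : 0 < s := by linarith
  have hs2 : 0 < s - 2 := by linarith
  set γ := (s - 2) / s with hγ
  set θ := s / (s - 2) with hθ
  have hγθ : γ * θ = 1 := by rw [hγ, hθ]; field_simp
  have hγ0 : 0 < γ := by positivity
  have hγ1 : γ ≤ 1 := by rw [hγ, div_le_one hs0]; linarith
  have hθ0 : 0 < θ := by positivity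
  set K : ℝ := 37 ^ θ with hK
  have hK1 : 1 ≤ K := Real.one_le_rpow (by norm_num) hθ0.le
  have hKγ : 36 < K ^ γ := by
    rw [hK, ← Real.rpow_mul (by norm_num), mul_comm, hγθ]
    norm_num
  obtain ⟨C, hC, hev⟩ := SmallDense.exists_dense_of_nearly_regular hs (by linarith : 1 ≤ 32 * K)
  obtain ⟨δ₁, hδ₁⟩ := Filter.eventually_atTop.1 hev
  set δ₀ := max δ₁ 1 with hδ₀
  set m := 64 * K * δ₀ with hm
  set D₀ := max (max (12 * s) K) (max (4 * m) (m ^ θ)) with hD₀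
  have hlog := Real.tendsto_log_atTop
  -- The additional logarithm absorbs the constants `(256 * K) ^ θ` and `D₀ ^ θ`.
  refine ⟨C + 1, ?_⟩
  filter_upwards [Filter.eventually_ge_atTop s, Filter.eventually_ge_atTop m,
    hlog.eventually_ge_atTop 1, hlog.eventually_ge_atTop ((256 * K) ^ θ),
    hlog.eventually_ge_atTop (D₀ ^ θ)] with d hds hdm hl1 hlK hlD V _ G hd hdn
  have hd0 : 0 < d := by linarith
  rw [SmallDense.averageDegree_eq] at hd
  have hne : Nonempty V := by
    by_contra hne
    rw [not_nonempty_iff] at hne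
    rw [Fintype.card_eq_zero, Nat.cast_zero, div_zero] at hd
    linarith
  set n : ℝ := (Fintype.card V : ℝ) with hn
  have hn0 : 0 < n := by rw [hn]; exact_mod_cast Fintype.card_pos
  rw [le_div_iff₀ hn0] at hd
  obtain ⟨S, hS, hSs, hmax⟩ := SmallDense.exists_extremal_set G γ ((by gcongr : s * n ≤ d * n).trans hd)
  set N : ℝ := (S.card : ℝ) with hN
  have hN0 : 0 < N := by rw [hN]; exact_mod_cast hS.card_pos
  obtain ⟨d₀, hdS⟩ : ∃ d₀ : ℝ, (SmallDense.degSum G S : ℝ) = d₀ * N :=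
    ⟨SmallDense.degSum G S / N, by field_simp⟩
  have hd₀0 : 0 < d₀ := by
    rw [hdS] at hSs
    exact hs0.trans_le (le_of_mul_le_mul_right hSs hN0)
  set x := n * d ^ (-θ) with hx
  have hdθ : d ^ θ ≤ n := by
    calc d ^ θ ≤ (n ^ γ) ^ θ := by gcongr
      _ = n := by rw [← Real.rpow_mul hn0.le, hγθ, Real.rpow_one]
  have hx1 : 1 ≤ x := by
    rw [hx, Real.rpow_neg hd0.le, ← div_eq_mul_inv, one_le_div (by positivity)]
    exact hdθ
  have hNn : N ≤ n := by
    rw [hN, hn]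
    exact_mod_cast Finset.card_le_univ S
  -- Comparing `S` with the whole vertex set gives `d / n ^ γ ≤ d₀ / N ^ γ`; raising this to the
  -- power `θ = 1 / γ` gives the claim. This is why the exponent `1 + γ` is used.
  have hxd₀ : N * d₀ ^ (-θ) ≤ x := by
    have h1 := hmax Finset.univ Finset.univ_nonempty
      (by rw [Finset.card_univ]; exact (by gcongr : s * n ≤ d * n).trans hd)
    rw [Finset.card_univ, ← hn, hdS, Real.rpow_add hN0, Real.rpow_add hn0, Real.rpow_one,
      Real.rpow_one] at h1
    have h2 : d * N ^ γ ≤ d₀ * n ^ γ := by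
      refine le_of_mul_le_mul_left ?_ (by positivity : 0 < n * N)
      calc n * N * (d * N ^ γ) = d * n * (N * N ^ γ) := by ring
        _ ≤ _ := by gcongr
        _ ≤ _ := h1
        _ = _ := by ring
    have h3 : d ^ θ * N ≤ d₀ ^ θ * n := by
      have h4 := Real.rpow_le_rpow (by positivity) h2 hθ0.le
      rwa [Real.mul_rpow hd0.le (by positivity), Real.mul_rpow hd₀0.le (by positivity),
        ← Real.rpow_mul hN0.le, ← Real.rpow_mul hn0.le, hγθ, Real.rpow_one, Real.rpow_one] at h4
    rw [hx, Real.rpow_neg hd0.le, Real.rpow_neg hd₀0.le, ← div_eq_mul_inv, ← div_eq_mul_inv,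
      div_le_div_iff₀ (by positivity) (by positivity)]
    linarith
  have hl0 : 0 < Real.log d := by linarith
  have havg : ∀ R : Finset V, R.Nonempty → s * R.card ≤ SmallDense.degSum G R →
      s ≤ (G.induce (R : Set V)).averageDegree := by
    intro R hR h
    rw [SmallDense.averageDegree_induce, le_div_iff₀ (by exact_mod_cast hR.card_pos)]
    exact h
  have hpow : Real.log d ^ (C + 1) = Real.log d ^ C * Real.log d := by
    rw [Real.rpow_add hl0, Real.rpow_one]
  have hlC : 1 ≤ Real.log d ^ C := Real.one_le_rpow hl1 hC
  by_cases hcase : D₀ ≤ d₀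
  · obtain ⟨R, hR, hRcard, hRs⟩ := SmallDense.exists_dense_of_extremal G hs hθ hγθ hγ0 hγ1 hK1 hKγ hC
      (le_max_right δ₁ 1) (fun δ hδ W _ _ _ => hδ₁ δ ((le_max_left _ _).trans hδ) W) hmax hS.card_pos
      hdS (((le_max_left _ _).trans (le_max_left _ _)).trans hcase)
      (((le_max_right _ _).trans (le_max_left _ _)).trans hcase)
      (((le_max_left _ _).trans (le_max_right _ _)).trans hcase)
      (((le_max_right _ _).trans (le_max_right _ _)).trans hcase) hdm hx1
      (by rw [hx, ← hN]; gcongr) hxd₀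
    refine ⟨R, hR, hRcard.trans ?_, havg R hR hRs⟩
    rw [hpow]
    calc x * (256 * K) ^ θ * Real.log d ^ C ≤ x * Real.log d * Real.log d ^ C := by gcongr
      _ = _ := by ring
  -- When `d₀` is bounded, the extremal set itself has size `O(x)`.
  · refine ⟨S, hS, ?_, havg S hS hSs⟩
    have h1 : N ≤ x * d₀ ^ θ := by
      rwa [Real.rpow_neg hd₀0.le, ← div_eq_mul_inv, div_le_iff₀ (by positivity)] at hxd₀
    have h2 : d₀ ^ θ ≤ D₀ ^ θ := Real.rpow_le_rpow hd₀0.le (not_le.1 hcase).le hθ0.le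
    rw [hpow]
    calc N ≤ x * d₀ ^ θ := h1
      _ ≤ x * Real.log d := by gcongr; exact h2.trans hlD
      _ ≤ x * (Real.log d ^ C * Real.log d) := by
          gcongr
          exact le_mul_of_one_le_left hl0.le hlC
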